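/- Let $0<a<b$ and let $F\in C^5(0,\infty)$ satisfy $F''>0$ on $(0,a)\cup(b,\infty)$, $F''<0$ on $(a,b)$, $F'(0^+)<F'(b)$ and $F'(+\infty)>F'(a)$ (limits in $[-\infty,+\infty]$). Let $Q(s)=\sqrt{1+s^2}-1$, $P_\varepsilon(s)=\int_0^s Q''(\varepsilon u)\,u\,du$ and $\Phi_\sigma(z)=F(z)-\sigma z$. There is exactly one triple $(\sigma_0,\alpha_0,\beta_0)$ with $\alpha_0\in(0,a)$, $\beta_0\in(b,\infty)$, $F'(\alpha_0)=F'(\beta_0)=\sigma_0$ and $F(\beta_0)-F(\alpha_0)=\sigma_0(\beta_0-\alpha_0)$. Put $\Delta_0=(\sigma_0,b_0)$ with $b_0=\Phi_{\sigma_0}(\alpha_0)=\Phi_{\sigma_0}(\beta_0)$ (the Maxwell point). For $F'(b)<\sigma<F'(a)$ let $\alpha_\sigma\in(0,a)$, $\zeta_\sigma\in(a,b)$, $\beta_\sigma\in(b,\infty)$ be the critical points of $\Phi_\sigma$; a pair $\Delta=(\sigma,c)$ is admissible if $\sigma\in(F'(b),F'(a))$ and $\max\{\Phi_\sigma(\alpha_\sigma),\Phi_\sigma(\beta_\sigma)\}<c<\Phi_\sigma(\zeta_\sigma)$.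 For $\varepsilon>0$ and $r\in(\alpha_0,\beta_0)$, a simple solution with admissible pair $\Delta=(\sigma,c)$ is a strictly increasing positive function $z\in C^2([-\varepsilon^{-1},\varepsilon^{-1}])$ such that $$Q''(\varepsilon z')z''=F'(z)-\sigma\ \text{ in }(-\varepsilon^{-1},\varepsilon^{-1}),\qquad z'(\pm\varepsilon^{-1})=0,\qquad \int_{-\varepsilon^{-1}}^{\varepsilon^{-1}}z\,dt=2r\varepsilon^{-1},$$ and $P_\varepsilon(z')=\Phi_\sigma(z)-c$ on $[-\varepsilon^{-1},\varepsilon^{-1}]$. For every $\delta\in(0,(\beta_0-\alpha_0)/2)$ there are $\varepsilon_\delta>0$ and a neighbourhood $\mathcal N_\delta$ of $\Delta_0$ such that for all $\varepsilon\in(0,\varepsilon_\delta)$ and $r\in[\alpha_0+\delta,\beta_0-\delta]$ there is exactly one simple solution with admissible pair in $\mathcal N_\delta$, the Maxwell solution $z_{\varepsilon r}$. For any such choice of $\delta,\varepsilon_\delta,\mathcal N_\delta$, any $r\in(\alpha_0,\beta_0)$ with $r\in[\alpha_0+\delta,\beta_0-\delta]$, and any $x\in[-1,1]$, the functions $u_{\varepsilon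 r}(x)=z_{\varepsilon r}(x/\varepsilon)$ and $u^R_{\varepsilon r}(x)=u_{\varepsilon r}(-x)$ satisfy $$\lim_{\varepsilon\to0^+}u_{\varepsilon r}(x)=u_0(x)\ \text{ if }x\ne-1+\ell_1,\qquad \lim_{\varepsilon\to0^+}u^R_{\varepsilon r}(x)=u_0(-x)\ \text{ if }x\ne-1+\ell_2,$$ where $\ell_1=\frac{2(\beta_0-r)}{\beta_0-\alpha_0}$, $\ell_2=\frac{2(r-\alpha_0)}{\beta_0-\alpha_0}$, $u_0(x)=\alpha_0$ for $x\le-1+\ell_1$ and $u_0(x)=\beta_0$ for $x>-1+\ell_1$. -/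

import Mathlib

open Set Filter Topology

namespace MaxwellSolution

/-- The mean-curvature density `Q(s) = √(1+s²) - 1`. -/
noncomputable def Q (s : ℝ) : ℝ := Real.sqrt (1 + s ^ 2) - 1

/-- The structural hypotheses on the free energy `F` (only its values on `(0,∞)` matter): `F` is
of class `C⁵` on `(0,∞)`, `F'' > 0` on `(0,a) ∪ (b,∞)`, `F'' < 0` on `(a,b)`, `F'(0) < F'(b)` and
`F'(∞) > F'(a)`, where `F'(0)` and `F'(∞)` are the limits of `F'` at `0⁺` and at `+∞` in the
extended reals (they exist because `F'` is monotone near `0` and near `+∞`). -/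
structure IsFreeEnergy (F : ℝ → ℝ) (a b : ℝ) : Prop where
  pos : 0 < a
  lt : a < b
  contDiffOn : ContDiffOn ℝ 5 F (Ioi 0)
  convex_left : ∀ u ∈ Ioo 0 a, 0 < deriv (deriv F) u
  concave_mid : ∀ u ∈ Ioo a b, deriv (deriv F) u < 0
  convex_right : ∀ u ∈ Ioi b, 0 < deriv (deriv F) u
  limit_zero : ∃ L : EReal, Tendsto (fun u : ℝ => ((deriv F u : ℝ) : EReal)) (𝓝[>] 0) (𝓝 L) ∧
    L < ((deriv F b : ℝ) : EReal)
  limit_top : ∃ L : EReal, Tendsto (fun u : ℝ => ((deriv F u : ℝ) : EReal)) atTop (𝓝 L) ∧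
    ((deriv F a : ℝ) : EReal) < L

/-- The Gibbs function `Φ_σ(z) = F(z) - σ z`. -/
def gibbs (F : ℝ → ℝ) (σ z : ℝ) : ℝ := F z - σ * z

/-- `α₀ < a` and `β₀ > b` are the two phases of the equal area rule and `σ₀` is the corresponding
value of the Lagrange multiplier. -/
structure IsMaxwellPoint (F : ℝ → ℝ) (a b σ₀ α₀ β₀ : ℝ) : Prop where
  left_mem : α₀ ∈ Ioo 0 a
  right_mem : β₀ ∈ Ioi b
  deriv_left : deriv F α₀ = σ₀
  deriv_right : deriv F β₀ = σ₀
  equal_area : F β₀ - F α₀ = σ₀ * (β₀ - α₀)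

/-- `α < ζ < β` are the three critical points `α_σ < ζ_σ < β_σ` of the Gibbs function `Φ_σ`. Each
of the three branches of `F'` is strictly monotone, so the triple is determined by `σ`. -/
structure IsCriticalTriple (F : ℝ → ℝ) (a b σ α ζ β : ℝ) : Prop where
  left_mem : α ∈ Ioo 0 a
  mid_mem : ζ ∈ Ioo a b
  right_mem : β ∈ Ioi b
  deriv_left : deriv F α = σ
  deriv_mid : deriv F ζ = σ
  deriv_right : deriv F β = σ

/-- The pair `Δ = (σ, b')` is admissible: `F'(b) < σ < F'(a)` and
`max {Φ_σ(α_σ), Φ_σ(β_σ)} < b' < Φ_σ(ζ_σ)`. -/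
def Admissible (F : ℝ → ℝ) (a b : ℝ) (Δ : ℝ × ℝ) : Prop :=
  Δ.1 ∈ Ioo (deriv F b) (deriv F a) ∧
    ∃ α ζ β : ℝ, IsCriticalTriple F a b Δ.1 α ζ β ∧
      max (gibbs F Δ.1 α) (gibbs F Δ.1 β) < Δ.2 ∧ Δ.2 < gibbs F Δ.1 ζ

/-- `P_ε(s) = ∫₀ˢ Q''(ε u) u du`. -/
noncomputable def P (ε s : ℝ) : ℝ := ∫ u in (0 : ℝ)..s, deriv (deriv Q) (ε * u) * u

/-- The interval `[-1/ε, 1/ε]`. -/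
def dom (ε : ℝ) : Set ℝ := Icc (-ε⁻¹) ε⁻¹

/-- `z : [-1/ε, 1/ε] → (0,∞)` is a classical solution, with Lagrange multiplier `σ`, of
`Q''(ε z') z'' = F'(z) - σ` in `(-1/ε, 1/ε)`, `z'(±1/ε) = 0`, `∫ z = 2r/ε`.
Derivatives are taken relative to `[-1/ε, 1/ε]`, hence are one-sided at the end points. -/
structure IsSolution (F : ℝ → ℝ) (ε r σ : ℝ) (z : ℝ → ℝ) : Prop where
  contDiffOn : ContDiffOn ℝ 2 z (dom ε)
  pos : ∀ t ∈ dom ε, 0 < z t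
  ode : ∀ t ∈ Ioo (-ε⁻¹) ε⁻¹,
    deriv (deriv Q) (ε * derivWithin z (dom ε) t) *
      derivWithin (derivWithin z (dom ε)) (dom ε) t = deriv F (z t) - σ
  neumann_left : derivWithin z (dom ε) (-ε⁻¹) = 0
  neumann_right : derivWithin z (dom ε) ε⁻¹ = 0
  mass : ∫ t in (-ε⁻¹)..ε⁻¹, z t = 2 * r * ε⁻¹

/-- A simple solution (a strictly increasing solution) whose corresponding admissible pair is
`Δ = (σ, b')`: `σ` is its Lagrange multiplier and `b'` the constant in the first integral
`P_ε(z') = Φ_σ(z) - b'`. -/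
structure IsSimpleSolution (F : ℝ → ℝ) (a b ε r : ℝ) (Δ : ℝ × ℝ) (z : ℝ → ℝ) : Prop where
  solution : IsSolution F ε r Δ.1 z
  strictMono : StrictMonoOn z (dom ε)
  admissible : Admissible F a b Δ
  first_integral : ∀ t ∈ dom ε, P ε (derivWithin z (dom ε) t) = gibbs F Δ.1 (z t) - Δ.2

/-- `z ε r` is the Maxwell solution, with corresponding admissible pair `Δ ε r`, for all
`0 < ε < ε₀` and `r ∈ [α₀ + δ, β₀ - δ]`: `N` is a neighbourhood of the Maxwell point `(σ₀, b₀)`,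
`b₀ = Φ_{σ₀}(α₀)`, and `z ε r` is the one and only simple solution whose pair lies in `N`.
(Functions count as equal when they agree on `[-1/ε, 1/ε]`.) -/
structure IsMaxwellFamily (F : ℝ → ℝ) (a b σ₀ α₀ β₀ δ ε₀ : ℝ) (N : Set (ℝ × ℝ))
    (Δ : ℝ → ℝ → ℝ × ℝ) (z : ℝ → ℝ → ℝ → ℝ) : Prop where
  pos : 0 < ε₀
  nhds : N ∈ 𝓝 (σ₀, gibbs F σ₀ α₀)
  simple : ∀ ε ∈ Ioo 0 ε₀, ∀ r ∈ Icc (α₀ + δ) (β₀ - δ),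
    IsSimpleSolution F a b ε r (Δ ε r) (z ε r) ∧ Δ ε r ∈ N
  unique : ∀ ε ∈ Ioo 0 ε₀, ∀ r ∈ Icc (α₀ + δ) (β₀ - δ), ∀ (Δ' : ℝ × ℝ) (w : ℝ → ℝ),
    IsSimpleSolution F a b ε r Δ' w → Δ' ∈ N → Δ' = Δ ε r ∧ EqOn w (z ε r) (dom ε)

/-- `ℓ₁ = 2(β₀ - r)/(β₀ - α₀)`. -/
noncomputable def ell₁ (α₀ β₀ r : ℝ) : ℝ := 2 * (β₀ - r) / (β₀ - α₀)

/-- `ℓ₂ = 2(r - α₀)/(β₀ - α₀)`. -/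
noncomputable def ell₂ (α₀ β₀ r : ℝ) : ℝ := 2 * (r - α₀) / (β₀ - α₀)

open Classical in
/-- The increasing single-interface function `u₀`: `α₀` up to `-1 + ℓ₁`, then `β₀`. -/
noncomputable def u₀ (α₀ β₀ r x : ℝ) : ℝ := if x ≤ -1 + ell₁ α₀ β₀ r then α₀ else β₀

/-- The rescaled function `u_{εr}(x) = z_{εr}(x/ε)`. -/
noncomputable def rescaled (z : ℝ → ℝ → ℝ → ℝ) (ε r x : ℝ) : ℝ := z ε r (x / ε)

/-- The reversal `u_{εr}^R(x) = u_{εr}(-x)`. -/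
noncomputable def reversal (z : ℝ → ℝ → ℝ → ℝ) (ε r x : ℝ) : ℝ := rescaled z ε r (-x)

end MaxwellSolution

namespace MaxwellSolution

/-! ### The function `P` and the quadrature kernel -/

/-! Solving the first integral `P ε z' = Φ_σ(z) - c` for `z'` gives `dt = Kern ε (Φ_σ(z) - c) dz`
along an increasing solution. A simple solution is therefore the same thing as an admissible pair
`(σ, c)` for which the integrals of `Kern` and of `z * Kern`, taken between the two inner zeros of
`Φ_σ - c`, equal `2/ε` and `2r/ε`. This is a system of two equations in two unknowns.

Near the Maxwell point `c` lies just above both minima of `Φ_σ`, and the integrals diverge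
logarithmically. Write the two heights of `c` above the minima as `exp (-x₁)^2 / 2` and `exp (-x₂)^2
/ 2`. The time spent near a phase is then `xᵢ / √F''` at that phase, up to lower order terms. The
weights `β₀ - z` and `z - α₀` each vanish at one phase, so with them the system is diagonal to
leading order: `k₁ x₁ ≈ 2(β₀ - r)/ε` and `k₂ x₂ ≈ 2(r - α₀)/ε`. The remainders have a small
Lipschitz constant in `(x₁, x₂)`. A contraction on a square of size of order `1/ε` gives existence.
A priori bounds place every deep enough solution in that square, and the same Lipschitz estimate
then gives uniqueness (`PhaseCharts.exists_solvesQuadrature`).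

The estimates come from Morse coordinates at each minimum (`exists_chart`), in which the excess over
the tangent line is `y^2 / 2`. Substituting `y = m cosh s` with `m = exp (-x)` turns the excess over
the level into `(m sinh s)^2 / 2`, and `dy` cancels the square root singularity of `Kern`
(`IsChart.quadrature`). What remains is a Lipschitz integrand over an interval of length `x - ℓ`,
which produces the term linear in `x`. The middle piece stays bounded and depends on the pair with
an exponentially small Lipschitz constant (`PhaseCharts.exists_mid_bound`).

For the limit, existence holds in every neighbourhood of the Maxwell point, so the uniqueness
property of a Maxwell family forces its pairs to converge (`IsMaxwellFamily.tendsto_pair`). Away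
from the two phases the speed `z'` is bounded below uniformly in `ε`, so the transition takes
bounded time and hence a length of order `ε` after rescaling. Monotonicity and the mass constraint
then locate the interface (`tendsto_of_tendsto_pair`). -/

lemma sqrt_one_add_sq_pos (s : ℝ) : 0 < Real.sqrt (1 + s ^ 2) := Real.sqrt_pos.2 (by positivity)

lemma hasDerivAt_sqrt_one_add_sq (s : ℝ) :
    HasDerivAt (fun s : ℝ => Real.sqrt (1 + s ^ 2)) (s / Real.sqrt (1 + s ^ 2)) s := by
  have h := (((hasDerivAt_id s).pow 2).const_add 1).sqrt (by simp; positivity)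
  refine h.congr_deriv ?_
  have := sqrt_one_add_sq_pos s
  simp
  field_simp

lemma deriv_Q : deriv Q = fun s => s / Real.sqrt (1 + s ^ 2) := by
  funext s
  exact ((hasDerivAt_sqrt_one_add_sq s).sub_const 1).deriv

lemma deriv_deriv_Q (s : ℝ) :
    deriv (deriv Q) s = 1 / ((1 + s ^ 2) * Real.sqrt (1 + s ^ 2)) := by
  have h0 := sqrt_one_add_sq_pos s
  have hs : Real.sqrt (1 + s ^ 2) ^ 2 = 1 + s ^ 2 := Real.sq_sqrt (by positivity)
  have h1 : (0 : ℝ) < 1 + s ^ 2 := by positivity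
  have hd : HasDerivAt (fun s => s / Real.sqrt (1 + s ^ 2)) _ s :=
    (hasDerivAt_id s).div (hasDerivAt_sqrt_one_add_sq s) h0.ne'
  rw [deriv_Q, hd.deriv]
  simp only [id]
  field_simp
  rw [hs]; ring

lemma deriv_deriv_Q_pos (s : ℝ) : 0 < deriv (deriv Q) s := by
  rw [deriv_deriv_Q]
  have := sqrt_one_add_sq_pos s
  positivity

lemma continuous_deriv_deriv_Q : Continuous (deriv (deriv Q)) := by
  have : deriv (deriv Q) = fun s => 1 / ((1 + s ^ 2) * Real.sqrt (1 + s ^ 2)) :=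
    funext deriv_deriv_Q
  rw [this]
  refine continuous_const.div (by fun_prop) fun s => ?_
  have := sqrt_one_add_sq_pos s
  positivity

lemma hasDerivAt_P (ε s : ℝ) : HasDerivAt (P ε) (deriv (deriv Q) (ε * s) * s) s := by
  have hc : Continuous fun u : ℝ => deriv (deriv Q) (ε * u) * u :=
    (continuous_deriv_deriv_Q.comp (continuous_const.mul continuous_id)).mul continuous_id
  exact intervalIntegral.integral_hasDerivAt_right (hc.intervalIntegrable _ _)
    hc.stronglyMeasurable.stronglyMeasurableAtFilter hc.continuousAt

/-- For this `Q` the integral is elementary. In particular `P ε` is bounded by `1/ε^2`, which is why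
the condition `ε^2 * q < 1` accompanies every use of its inverse. -/
lemma P_eq {ε : ℝ} (hε : ε ≠ 0) (s : ℝ) :
    P ε s = (1 - 1 / Real.sqrt (1 + (ε * s) ^ 2)) / ε ^ 2 := by
  have hc : Continuous fun u : ℝ => deriv (deriv Q) (ε * u) * u :=
    (continuous_deriv_deriv_Q.comp (continuous_const.mul continuous_id)).mul continuous_id
  have hd : ∀ u : ℝ, HasDerivAt (fun u => (1 - 1 / Real.sqrt (1 + (ε * u) ^ 2)) / ε ^ 2)
      (deriv (deriv Q) (ε * u) * u) u := by
    intro u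
    have h0 := sqrt_one_add_sq_pos (ε * u)
    have hs : Real.sqrt (1 + (ε * u) ^ 2) ^ 2 = 1 + (ε * u) ^ 2 := Real.sq_sqrt (by positivity)
    have h1 : HasDerivAt (fun u : ℝ => Real.sqrt (1 + (ε * u) ^ 2))
        ((ε * u) / Real.sqrt (1 + (ε * u) ^ 2) * ε) u := by
      have := (hasDerivAt_sqrt_one_add_sq (ε * u)).comp u ((hasDerivAt_id u).const_mul ε)
      rw [mul_one] at this
      exact this
    have h2 := ((h1.inv h0.ne').const_sub 1).div_const (ε ^ 2)
    simp only [one_div]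
    refine h2.congr_deriv ?_
    rw [deriv_deriv_Q]
    have h3 : (0 : ℝ) < 1 + (ε * u) ^ 2 := by positivity
    set w := Real.sqrt (1 + (ε * u) ^ 2)
    rw [← hs]
    field_simp
  have := intervalIntegral.integral_eq_sub_of_hasDerivAt (a := 0) (b := s)
    (fun u _ => hd u) (hc.intervalIntegrable _ _)
  rw [P, this]
  simp

/-- The reciprocal of the inverse function of `P ε` on `(0,∞)`. -/
noncomputable def Kern (ε q : ℝ) : ℝ := (1 - ε ^ 2 * q) / Real.sqrt (q * (2 - ε ^ 2 * q))

/-- The regular factor of `Kern`. -/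
noncomputable def kap (t : ℝ) : ℝ := (1 - t) / Real.sqrt (1 - t / 2)

/-- Separates the singularity `1/√(2q)` of the semilinear problem from a factor smooth near `0` with
value `1` there, so that the dependence on `ε` is a regular perturbation. -/
lemma Kern_eq {ε q : ℝ} (hq : 0 ≤ q) : Kern ε q = kap (ε ^ 2 * q) / Real.sqrt (2 * q) := by
  rw [Kern, kap, show q * (2 - ε ^ 2 * q) = (1 - ε ^ 2 * q / 2) * (2 * q) by ring,
    Real.sqrt_mul' _ (by positivity), div_div]

lemma Kern_pos {ε q : ℝ} (hq : 0 < q) (h : ε ^ 2 * q < 1) : 0 < Kern ε q := by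
  unfold Kern
  have : 0 < q * (2 - ε ^ 2 * q) := mul_pos hq (by linarith)
  have := Real.sqrt_pos.2 this
  exact div_pos (by linarith) this

lemma P_nonneg_lt {ε : ℝ} (hε : 0 < ε) (s : ℝ) : 0 ≤ P ε s ∧ ε ^ 2 * P ε s < 1 := by
  have h0 := sqrt_one_add_sq_pos (ε * s)
  have h1 : 1 ≤ Real.sqrt (1 + (ε * s) ^ 2) := Real.one_le_sqrt.2 (by nlinarith [sq_nonneg (ε * s)])
  have h2 : 1 / Real.sqrt (1 + (ε * s) ^ 2) ≤ 1 := (div_le_one h0).2 h1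
  have h3 : 0 < 1 / Real.sqrt (1 + (ε * s) ^ 2) := by positivity
  rw [P_eq hε.ne']
  constructor
  · exact div_nonneg (by linarith) (by positivity)
  · rw [mul_div_cancel₀ _ (by positivity)]; linarith

/-- Identifies `Kern` as the slowness `dt/dz` along a solution of the first integral. -/
lemma mul_Kern_P {ε s : ℝ} (hε : 0 < ε) (hs : 0 < s) : s * Kern ε (P ε s) = 1 := by
  have h0 := sqrt_one_add_sq_pos (ε * s)
  set w := Real.sqrt (1 + (ε * s) ^ 2) with hw
  have hs2 : w ^ 2 = 1 + (ε * s) ^ 2 := Real.sq_sqrt (by positivity)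
  have h1 : 1 - ε ^ 2 * P ε s = 1 / w := by
    rw [P_eq hε.ne', mul_div_cancel₀ _ (by positivity)]; ring
  have h2 : P ε s * (2 - ε ^ 2 * P ε s) = (s / w) ^ 2 := by
    have : 2 - ε ^ 2 * P ε s = 1 + 1 / w := by linarith
    rw [this, P_eq hε.ne', ← hw, div_pow]
    field_simp
    linear_combination hs2
  rw [Kern, h1, h2, Real.sqrt_sq (by positivity)]
  field_simp

/-- Used at the end to convert a lower bound for `Φ_σ(z) - c` into a lower bound for the speed that
does not depend on `ε`. -/
lemma P_le {ε s : ℝ} (hε : 0 < ε) : P ε s ≤ s ^ 2 / 2 := by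
  have h0 := sqrt_one_add_sq_pos (ε * s)
  have h1 : Real.sqrt (1 + (ε * s) ^ 2) ≤ 1 + (ε * s) ^ 2 / 2 := by
    rw [Real.sqrt_le_left (by positivity)]
    nlinarith [sq_nonneg ((ε * s) ^ 2)]
  have h1' : 1 ≤ Real.sqrt (1 + (ε * s) ^ 2) := Real.one_le_sqrt.2 (by nlinarith [sq_nonneg (ε * s)])
  rw [P_eq hε.ne', div_le_iff₀ (by positivity)]
  have h2 : 1 - 1 / Real.sqrt (1 + (ε * s) ^ 2) =
    (Real.sqrt (1 + (ε * s) ^ 2) - 1) / Real.sqrt (1 + (ε * s) ^ 2) := by field_simp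
  rw [h2, div_le_iff₀ h0]
  nlinarith [sq_nonneg (ε * s)]

/-- The inverse function of `P ε` on `[0,∞)`. -/
noncomputable def PInv (ε q : ℝ) : ℝ := Real.sqrt (q * (2 - ε ^ 2 * q)) / (1 - ε ^ 2 * q)

lemma PInv_eq_inv (ε q : ℝ) : PInv ε q = (Kern ε q)⁻¹ := by rw [PInv, Kern, inv_div]

lemma P_PInv {ε q : ℝ} (hε : 0 < ε) (hq : 0 ≤ q) (h : ε ^ 2 * q < 1) : P ε (PInv ε q) = q := by
  have h1 : 0 < 1 - ε ^ 2 * q := by linarith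
  have h2 : 1 + (ε * PInv ε q) ^ 2 = (1 / (1 - ε ^ 2 * q)) ^ 2 := by
    rw [PInv, mul_pow, div_pow, Real.sq_sqrt (mul_nonneg hq (by linarith))]
    field_simp
    ring
  rw [P_eq hε.ne', h2, Real.sqrt_sq (by positivity)]
  field_simp
  ring

lemma continuousAt_PInv {ε q : ℝ} (h : ε ^ 2 * q < 1) : ContinuousAt (PInv ε) q := by
  unfold PInv
  refine ContinuousAt.div (by fun_prop) (by fun_prop) (by linarith)

lemma continuousAt_Kern {ε q : ℝ} (hq : 0 < q) (h : ε ^ 2 * q < 1) :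
    ContinuousAt (Kern ε) q := by
  unfold Kern
  refine ContinuousAt.div (by fun_prop) (by fun_prop) (Real.sqrt_pos.2 ?_).ne'
  exact mul_pos hq (by linarith)

lemma kap_zero : kap 0 = 1 := by simp [kap]

/-- Negative arguments are included because `chartJ` is estimated for independent `y` and `m`, so
that `y^2 - m^2` may have either sign. -/
lemma exists_lipschitz_kap : ∃ C : ℝ, 0 < C ∧ (∀ s ∈ Icc (-1 / 2 : ℝ) (1 / 2),
    ∀ t ∈ Icc (-1 / 2 : ℝ) (1 / 2), |kap s - kap t| ≤ C * |s - t|) ∧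
    ∀ s ∈ Icc (-1 / 2 : ℝ) (1 / 2), |kap s| ≤ C := by
  have hk : ContDiffOn ℝ 1 kap (Icc (-1 / 2 : ℝ) (1 / 2)) := by
    intro s hs
    have h1 : 0 < 1 - s / 2 := by linarith [hs.2]
    refine ContDiffAt.contDiffWithinAt ?_
    unfold kap
    refine ContDiffAt.div (by fun_prop) (ContDiffAt.sqrt (by fun_prop) h1.ne')
      (Real.sqrt_pos.2 h1).ne'
  obtain ⟨K, hK⟩ := hk.exists_lipschitzOnWith one_ne_zero (convex_Icc _ _) isCompact_Icc
  have hL : ∀ s ∈ Icc (-1 / 2 : ℝ) (1 / 2), ∀ t ∈ Icc (-1 / 2 : ℝ) (1 / 2),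
      |kap s - kap t| ≤ (K : ℝ) * |s - t| := fun s hs t ht => by
    simpa [Real.dist_eq] using hK.dist_le_mul s hs t ht
  refine ⟨K + 1, by positivity, fun s hs t ht => (hL s hs t ht).trans ?_, fun s hs => ?_⟩
  · gcongr; linarith
  · have h1 := hL s hs 0 (by constructor <;> norm_num)
    rw [kap_zero, sub_zero] at h1
    have h2 : |s| ≤ 1 := abs_le.2 ⟨by linarith [hs.1], by linarith [hs.2]⟩
    have h3 : |kap s| ≤ |kap s - 1| + 1 := by
      have := abs_add_le (kap s - 1) 1
      simpa using this
    have : (K : ℝ) * |s| ≤ K := mul_le_of_le_one_right K.2 h2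
    linarith

/-! ### Change of variables along a strictly increasing function -/

lemma image_Ioo_of_strictMonoOn {f : ℝ → ℝ} {a b : ℝ} (hab : a ≤ b)
    (hc : ContinuousOn f (Icc a b)) (hm : StrictMonoOn f (Icc a b)) :
    f '' Ioo a b = Ioo (f a) (f b) := by
  refine Subset.antisymm ?_ (intermediate_value_Ioo hab hc)
  rintro _ ⟨x, hx, rfl⟩
  exact ⟨hm (left_mem_Icc.2 hab) (Ioo_subset_Icc_self hx) hx.1,
    hm (Ioo_subset_Icc_self hx) (right_mem_Icc.2 hab) hx.2⟩

open MeasureTheory in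
/-- Substitution `y = f x` along a strictly increasing `f`; neither side needs to be integrable. -/
lemma integral_comp_of_strictMonoOn {f f' : ℝ → ℝ} {a b : ℝ} (hab : a ≤ b)
    (hc : ContinuousOn f (Icc a b)) (hm : StrictMonoOn f (Icc a b))
    (hd : ∀ x ∈ Ioo a b, HasDerivAt f (f' x) x) (g : ℝ → ℝ) :
    (IntervalIntegrable g volume (f a) (f b) ↔
      IntervalIntegrable (fun x => f' x * g (f x)) volume a b) ∧
    ∫ y in (f a)..(f b), g y = ∫ x in a..b, f' x * g (f x) := by
  have hfab : f a ≤ f b := hm.monotoneOn (left_mem_Icc.2 hab) (right_mem_Icc.2 hab) hab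
  have him := image_Ioo_of_strictMonoOn hab hc hm
  have hm' : MonotoneOn f (Ioo a b) := (hm.mono Ioo_subset_Icc_self).monotoneOn
  have hd' : ∀ x ∈ Ioo a b, HasDerivWithinAt f (f' x) (Ioo a b) x :=
    fun x hx => (hd x hx).hasDerivWithinAt
  constructor
  · rw [intervalIntegrable_iff_integrableOn_Ioo_of_le hfab,
      intervalIntegrable_iff_integrableOn_Ioo_of_le hab, ← him]
    exact integrableOn_image_iff_integrableOn_deriv_smul_of_monotoneOn measurableSet_Ioo hd' hm' g
  · rw [intervalIntegral.integral_of_le hfab, intervalIntegral.integral_of_le hab,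
      integral_Ioc_eq_integral_Ioo, integral_Ioc_eq_integral_Ioo, ← him]
    exact integral_image_eq_integral_deriv_smul_of_monotoneOn measurableSet_Ioo hd' hm' g

/-! ### Morse coordinates at a nondegenerate minimum -/

/-- `f` has derivatives `f1`, `f2` near `p0`, with `f2` Lipschitz and bounded between positive
constants. -/
structure LocalWell (f f1 f2 : ℝ → ℝ) (p0 R l0 l1 M : ℝ) : Prop where
  R_pos : 0 < R
  l0_pos : 0 < l0
  deriv1 : ∀ z ∈ Icc (p0 - 2 * R) (p0 + 2 * R), HasDerivAt f (f1 z) z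
  deriv2 : ∀ z ∈ Icc (p0 - 2 * R) (p0 + 2 * R), HasDerivAt f1 (f2 z) z
  lower : ∀ z ∈ Icc (p0 - 2 * R) (p0 + 2 * R), l0 ≤ f2 z
  upper : ∀ z ∈ Icc (p0 - 2 * R) (p0 + 2 * R), f2 z ≤ l1
  lip : ∀ z ∈ Icc (p0 - 2 * R) (p0 + 2 * R), ∀ w ∈ Icc (p0 - 2 * R) (p0 + 2 * R),
    |f2 z - f2 w| ≤ M * |z - w|

/-- `Ω p y` is the displacement `ω ≥ 0` with `f (p + ω) - f p - f1 p * ω = y² / 2`, and `E` is its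
`y`-derivative. -/
structure IsChart (f f1 : ℝ → ℝ) (p0 lam ρ Y C : ℝ) (Ω E : ℝ → ℝ → ℝ) : Prop where
  ρ_pos : 0 < ρ
  Y_pos : 0 < Y
  C_pos : 0 < C
  Ω_zero : ∀ p ∈ Icc (p0 - ρ) (p0 + ρ), Ω p 0 = 0
  level : ∀ p ∈ Icc (p0 - ρ) (p0 + ρ), ∀ y ∈ Icc 0 Y,
    f (p + Ω p y) - f p - f1 p * Ω p y = y ^ 2 / 2
  slope : ∀ p ∈ Icc (p0 - ρ) (p0 + ρ), ∀ y ∈ Icc 0 Y, E p y * (f1 (p + Ω p y) - f1 p) = y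
  E_pos : ∀ p ∈ Icc (p0 - ρ) (p0 + ρ), ∀ y ∈ Icc 0 Y, 0 < E p y
  E_le : ∀ p ∈ Icc (p0 - ρ) (p0 + ρ), ∀ y ∈ Icc 0 Y, E p y ≤ C
  E_base : E p0 0 = 1 / Real.sqrt lam
  lip_Ω : ∀ p ∈ Icc (p0 - ρ) (p0 + ρ), ∀ q ∈ Icc (p0 - ρ) (p0 + ρ), ∀ y ∈ Icc 0 Y, ∀ y' ∈ Icc 0 Y,
    |Ω p y - Ω q y'| ≤ C * (|p - q| + |y - y'|)
  lip_E : ∀ p ∈ Icc (p0 - ρ) (p0 + ρ), ∀ q ∈ Icc (p0 - ρ) (p0 + ρ), ∀ y ∈ Icc 0 Y, ∀ y' ∈ Icc 0 Y,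
    |E p y - E q y'| ≤ C * (|p - q| + |y - y'|)
  deriv : ∀ p ∈ Icc (p0 - ρ) (p0 + ρ), ∀ y ∈ Ioo 0 Y, HasDerivAt (Ω p) (E p y) y
  steep : ∀ p ∈ Icc (p0 - ρ) (p0 + ρ), ∀ q ∈ Icc (p0 - ρ) (p0 + ρ), |p - q| ≤ C * |f1 p - f1 q|

lemma IsChart.mono {f f1 : ℝ → ℝ} {p0 lam ρ Y C ρ' Y' C' : ℝ} {Ω E : ℝ → ℝ → ℝ}
    (h : IsChart f f1 p0 lam ρ Y C Ω E) (hρ : 0 < ρ') (hρ' : ρ' ≤ ρ) (hY : 0 < Y') (hY' : Y' ≤ Y)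
    (hC : C ≤ C') : IsChart f f1 p0 lam ρ' Y' C' Ω E := by
  have h1 : Icc (p0 - ρ') (p0 + ρ') ⊆ Icc (p0 - ρ) (p0 + ρ) :=
    Icc_subset_Icc (by linarith) (by linarith)
  have h2 : Icc 0 Y' ⊆ Icc 0 Y := Icc_subset_Icc_right hY'
  have h3 : Ioo 0 Y' ⊆ Ioo 0 Y := Ioo_subset_Ioo_right hY'
  exact ⟨hρ, hY, h.C_pos.trans_le hC, fun p hp => h.Ω_zero p (h1 hp),
    fun p hp y hy => h.level p (h1 hp) y (h2 hy), fun p hp y hy => h.slope p (h1 hp) y (h2 hy),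
    fun p hp y hy => h.E_pos p (h1 hp) y (h2 hy),
    fun p hp y hy => (h.E_le p (h1 hp) y (h2 hy)).trans hC, h.E_base,
    fun p hp q hq y hy y' hy' => (h.lip_Ω p (h1 hp) q (h1 hq) y (h2 hy) y' (h2 hy')).trans
      (by gcongr),
    fun p hp q hq y hy y' hy' => (h.lip_E p (h1 hp) q (h1 hq) y (h2 hy) y' (h2 hy')).trans
      (by gcongr),
    fun p hp y hy => h.deriv p (h1 hp) y (h3 hy),
    fun p hp q hq => (h.steep p (h1 hp) q (h1 hq)).trans (by gcongr)⟩

/-- Weighted mean of `f2` over the segment from `p` to `p + ω`. -/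
noncomputable def segMean (g f2 : ℝ → ℝ) (p ω : ℝ) : ℝ := ∫ t in (0 : ℝ)..1, g t * f2 (p + t * ω)

namespace LocalWell

variable {f f1 f2 : ℝ → ℝ} {p0 R l0 l1 M : ℝ}

lemma mem (h : LocalWell f f1 f2 p0 R l0 l1 M) {p ω t : ℝ} (hp : p ∈ Icc (p0 - R) (p0 + R))
    (hω : ω ∈ Icc 0 R) (ht : t ∈ Icc (0 : ℝ) 1) :
    p + t * ω ∈ Icc (p0 - 2 * R) (p0 + 2 * R) := by
  have hR := h.R_pos
  have h1 : 0 ≤ t * ω := mul_nonneg ht.1 hω.1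
  have h2 : t * ω ≤ R := (mul_le_of_le_one_left hω.1 ht.2).trans hω.2
  constructor <;> linarith [hp.1, hp.2]

lemma continuousOn_f2 (h : LocalWell f f1 f2 p0 R l0 l1 M) {p ω : ℝ}
    (hp : p ∈ Icc (p0 - R) (p0 + R)) (hω : ω ∈ Icc 0 R) :
    ContinuousOn (fun t => f2 (p + t * ω)) (Icc 0 1) := by
  have h1 : ContinuousOn f2 (Icc (p0 - 2 * R) (p0 + 2 * R)) := by
    have : LipschitzOnWith (Real.toNNReal M) f2 (Icc (p0 - 2 * R) (p0 + 2 * R)) := by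
      refine LipschitzOnWith.of_dist_le_mul fun x hx y hy => ?_
      rw [Real.dist_eq, Real.dist_eq]
      exact (h.lip x hx y hy).trans (by gcongr; exact Real.le_coe_toNNReal M)
    exact this.continuousOn
  exact h1.comp (by fun_prop) fun t ht => h.mem hp hω ht

lemma intervalIntegrable (h : LocalWell f f1 f2 p0 R l0 l1 M) {g : ℝ → ℝ} (hg : Continuous g)
    {p ω : ℝ} (hp : p ∈ Icc (p0 - R) (p0 + R)) (hω : ω ∈ Icc 0 R) :
    IntervalIntegrable (fun t => g t * f2 (p + t * ω)) MeasureTheory.volume 0 1 := by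
  refine ContinuousOn.intervalIntegrable ?_
  rw [uIcc_of_le zero_le_one]
  exact hg.continuousOn.mul (h.continuousOn_f2 hp hω)

lemma segMean_mem (h : LocalWell f f1 f2 p0 R l0 l1 M) {g : ℝ → ℝ} (hg : Continuous g)
    (hg0 : ∀ t ∈ Icc (0 : ℝ) 1, 0 ≤ g t)
    {p ω : ℝ} (hp : p ∈ Icc (p0 - R) (p0 + R)) (hω : ω ∈ Icc 0 R) :
    segMean g f2 p ω ∈ Icc (l0 * ∫ t in (0 : ℝ)..1, g t) (l1 * ∫ t in (0 : ℝ)..1, g t) := by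
  rw [← intervalIntegral.integral_const_mul, ← intervalIntegral.integral_const_mul]
  have hi := h.intervalIntegrable hg hp hω
  constructor
  · refine intervalIntegral.integral_mono_on zero_le_one
      ((continuous_const.mul hg).intervalIntegrable _ _) hi fun t ht => ?_
    rw [mul_comm]
    exact mul_le_mul_of_nonneg_left (h.lower _ (h.mem hp hω ht)) (hg0 t ht)
  · refine intervalIntegral.integral_mono_on zero_le_one hi
      ((continuous_const.mul hg).intervalIntegrable _ _) fun t ht => ?_
    rw [mul_comm l1]
    exact mul_le_mul_of_nonneg_left (h.upper _ (h.mem hp hω ht)) (hg0 t ht)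

lemma M_nonneg (h : LocalWell f f1 f2 p0 R l0 l1 M) : 0 ≤ M := by
  have hR := h.R_pos
  have h1 := h.lip (p0 + R) (by constructor <;> linarith) p0 (by constructor <;> linarith)
  rw [add_sub_cancel_left, abs_of_pos hR] at h1
  have := (abs_nonneg _).trans h1
  exact nonneg_of_mul_nonneg_left this hR

lemma l0_le_l1 (h : LocalWell f f1 f2 p0 R l0 l1 M) : l0 ≤ l1 := by
  have hR := h.R_pos
  have hm : p0 ∈ Icc (p0 - 2 * R) (p0 + 2 * R) := by constructor <;> linarith
  exact (h.lower _ hm).trans (h.upper _ hm)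

lemma segMean_lip (h : LocalWell f f1 f2 p0 R l0 l1 M) {g : ℝ → ℝ} (hg : Continuous g)
    (hg0 : ∀ t ∈ Icc (0 : ℝ) 1, |g t| ≤ 1) {p ω p' ω' : ℝ} (hp : p ∈ Icc (p0 - R) (p0 + R))
    (hω : ω ∈ Icc 0 R) (hp' : p' ∈ Icc (p0 - R) (p0 + R)) (hω' : ω' ∈ Icc 0 R) :
    |segMean g f2 p ω - segMean g f2 p' ω'| ≤ M * (|p - p'| + |ω - ω'|) := by
  rw [segMean, segMean, ← intervalIntegral.integral_sub (h.intervalIntegrable hg hp hω)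
    (h.intervalIntegrable hg hp' hω')]
  have := intervalIntegral.norm_integral_le_of_norm_le_const (a := 0) (b := 1)
    (f := fun t => g t * f2 (p + t * ω) - g t * f2 (p' + t * ω')) (C := M * (|p - p'| + |ω - ω'|)) ?_
  · simpa using this
  intro t ht
  rw [uIoc_of_le zero_le_one] at ht
  have ht' := Ioc_subset_Icc_self ht
  rw [Real.norm_eq_abs, ← mul_sub, abs_mul]
  calc |g t| * |f2 (p + t * ω) - f2 (p' + t * ω')|
      ≤ 1 * (M * |(p + t * ω) - (p' + t * ω')|) :=
        mul_le_mul (hg0 t ht') (h.lip _ (h.mem hp hω ht') _ (h.mem hp' hω' ht')) (abs_nonneg _)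
          zero_le_one
    _ ≤ M * (|p - p'| + |ω - ω'|) := by
        rw [one_mul]
        refine mul_le_mul_of_nonneg_left ?_ h.M_nonneg
        rw [show (p + t * ω) - (p' + t * ω') = (p - p') + t * (ω - ω') by ring]
        refine (abs_add_le _ _).trans ?_
        rw [abs_mul, abs_of_nonneg ht'.1]
        gcongr
        exact mul_le_of_le_one_left (abs_nonneg _) ht'.2

lemma mul_segMean_one (h : LocalWell f f1 f2 p0 R l0 l1 M) {p ω : ℝ}
    (hp : p ∈ Icc (p0 - R) (p0 + R)) (hω : ω ∈ Icc 0 R) :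
    ω * segMean (fun _ => 1) f2 p ω = f1 (p + ω) - f1 p := by
  have hd : ∀ t ∈ uIcc (0 : ℝ) 1, HasDerivAt (fun t => f1 (p + t * ω)) (ω * (1 * f2 (p + t * ω))) t := by
    intro t ht
    rw [uIcc_of_le zero_le_one] at ht
    have h1 : HasDerivAt (fun t : ℝ => p + t * ω) ω t := by
      simpa using ((hasDerivAt_id t).mul_const ω).const_add p
    have := (h.deriv2 _ (h.mem hp hω ht)).comp t h1
    exact this.congr_deriv (by ring)
  have := intervalIntegral.integral_eq_sub_of_hasDerivAt hd
    ((h.intervalIntegrable continuous_const hp hω).const_mul ω)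
  rw [intervalIntegral.integral_const_mul] at this
  simpa [segMean] using this

/-- Taylor's formula with integral remainder. Factoring out `ω^2` leaves a quotient that is positive
and Lipschitz up to `ω = 0`, so its square root can be taken there. -/
lemma sq_mul_segMean (h : LocalWell f f1 f2 p0 R l0 l1 M) {p ω : ℝ}
    (hp : p ∈ Icc (p0 - R) (p0 + R)) (hω : ω ∈ Icc 0 R) :
    ω ^ 2 * segMean (fun t => 1 - t) f2 p ω = f (p + ω) - f p - f1 p * ω := by
  have hd : ∀ t ∈ uIcc (0 : ℝ) 1,
      HasDerivAt (fun t => (1 - t) * (ω * f1 (p + t * ω)) + f (p + t * ω))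
        (ω ^ 2 * ((1 - t) * f2 (p + t * ω))) t := by
    intro t ht
    rw [uIcc_of_le zero_le_one] at ht
    have h1 : HasDerivAt (fun t : ℝ => p + t * ω) ω t := by
      simpa using ((hasDerivAt_id t).mul_const ω).const_add p
    have h2 := (h.deriv2 _ (h.mem hp hω ht)).comp t h1
    have h3 := (h.deriv1 _ (h.mem hp hω ht)).comp t h1
    have h4 := (((hasDerivAt_id t).const_sub 1).mul (h2.const_mul ω)).add h3
    refine h4.congr_deriv ?_
    simp only [id, Function.comp]
    ring
  have := intervalIntegral.integral_eq_sub_of_hasDerivAt hd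
    ((h.intervalIntegrable (by fun_prop) hp hω).const_mul (ω ^ 2))
  rw [intervalIntegral.integral_const_mul] at this
  rw [segMean, this]
  simp
  ring

end LocalWell

/-- With `k` and `l` the weighted means of `f2` in the two Taylor remainders, set `y = ω √(2k)`.
Then `dy/dω = l / √(2k)` is bounded below, so `y` can be inverted by intermediate values with a
Lipschitz inverse `Ω`, and `E = √(2k) / l` is the derivative of that inverse. The formula for `E`
makes sense at `ω = 0` and is Lipschitz there, although `f2` is only Lipschitz. -/
theorem exists_chart {f f1 f2 : ℝ → ℝ} {p0 R l0 l1 M : ℝ}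
    (h : LocalWell f f1 f2 p0 R l0 l1 M) :
    ∃ ρ Y C Ω E, IsChart f f1 p0 (f2 p0) ρ Y C Ω E := by
  have hR := h.R_pos
  have hl0 := h.l0_pos
  have hl1 := h.l0_le_l1
  have hM := h.M_nonneg
  set k := segMean (fun t => 1 - t) f2 with hk
  set l := segMean (fun _ => 1) f2 with hl
  have hint : ∫ t in (0 : ℝ)..1, (1 - t) = 1 / 2 := by
    rw [intervalIntegral.integral_sub (by simp) (by simp)]; simp; norm_num
  have hkm : ∀ p ∈ Icc (p0 - R) (p0 + R), ∀ ω ∈ Icc 0 R, k p ω ∈ Icc (l0 / 2) (l1 / 2) := by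
    intro p hp ω hω
    have := h.segMean_mem (g := fun t => 1 - t) (by fun_prop) (fun t ht => by linarith [ht.2]) hp hω
    rw [hint] at this
    simpa [div_eq_mul_inv] using this
  have hlm : ∀ p ∈ Icc (p0 - R) (p0 + R), ∀ ω ∈ Icc 0 R, l p ω ∈ Icc l0 l1 := by
    intro p hp ω hω
    have := h.segMean_mem (g := fun t => 1) (by fun_prop) (fun t ht => by linarith [ht.2]) hp hω
    simpa using this
  have hkl : ∀ p ∈ Icc (p0 - R) (p0 + R), ∀ p' ∈ Icc (p0 - R) (p0 + R), ∀ ω ∈ Icc 0 R, ∀ ω' ∈ Icc 0 R,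
      |k p ω - k p' ω'| ≤ M * (|p - p'| + |ω - ω'|) := fun p hp p' hp' ω hω ω' hω' =>
    h.segMean_lip (by fun_prop) (fun t ht => abs_le.2 ⟨by linarith [ht.2], by linarith [ht.1]⟩)
      hp hω hp' hω'
  have hll : ∀ p ∈ Icc (p0 - R) (p0 + R), ∀ p' ∈ Icc (p0 - R) (p0 + R), ∀ ω ∈ Icc 0 R, ∀ ω' ∈ Icc 0 R,
      |l p ω - l p' ω'| ≤ M * (|p - p'| + |ω - ω'|) := fun p hp p' hp' ω hω ω' hω' =>
    h.segMean_lip (by fun_prop) (fun t ht => by simp) hp hω hp' hω'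
  -- Lipschitz bounds for the two elementary functions of `k` and `l`
  obtain ⟨K1, hK1⟩ : ∃ K, LipschitzOnWith K (fun x : ℝ => Real.sqrt (2 * x)) (Icc (l0 / 2) (l1 / 2)) := by
    refine ContDiffOn.exists_lipschitzOnWith (n := 1) (fun x hx => ?_) one_ne_zero (convex_Icc _ _)
      isCompact_Icc
    exact (ContDiffAt.sqrt (by fun_prop) (by linarith [hx.1])).contDiffWithinAt
  obtain ⟨K2, hK2⟩ : ∃ K, LipschitzOnWith K (fun x : ℝ × ℝ => Real.sqrt (2 * x.1) / x.2)
      (Icc (l0 / 2) (l1 / 2) ×ˢ Icc l0 l1) := by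
    refine ContDiffOn.exists_lipschitzOnWith (n := 1) (fun x hx => ?_) one_ne_zero
      ((convex_Icc _ _).prod (convex_Icc _ _)) (isCompact_Icc.prod isCompact_Icc)
    refine ContDiffAt.contDiffWithinAt (ContDiffAt.div
      (ContDiffAt.sqrt (by fun_prop) (by linarith [hx.1.1])) (by fun_prop) (by linarith [hx.2.1]))
  -- Lower bound for `dy/dω = l / √(2k)`, from `l ≥ l0` and `2k ≤ l1`.
  set c := l0 / Real.sqrt l1 with hc
  have hsl1 : 0 < Real.sqrt l1 := Real.sqrt_pos.2 (hl0.trans_le hl1)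
  have hcpos : 0 < c := div_pos hl0 hsl1
  set yv : ℝ → ℝ → ℝ := fun p ω => ω * Real.sqrt (2 * k p ω) with hyv
  have hkpos : ∀ p ∈ Icc (p0 - R) (p0 + R), ∀ ω ∈ Icc 0 R, 0 < Real.sqrt (2 * k p ω) :=
    fun p hp ω hω => Real.sqrt_pos.2 (by linarith [(hkm p hp ω hω).1])
  have hyv_eq : ∀ p ∈ Icc (p0 - R) (p0 + R), ∀ ω ∈ Icc 0 R,
      yv p ω = Real.sqrt (2 * (f (p + ω) - f p - f1 p * ω)) := by
    intro p hp ω hω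
    rw [← h.sq_mul_segMean hp hω, show 2 * (ω ^ 2 * segMean (fun t => 1 - t) f2 p ω) =
      ω ^ 2 * (2 * k p ω) by rw [hk]; ring, Real.sqrt_mul (sq_nonneg ω), Real.sqrt_sq hω.1]
  have hyv_lip : ∀ p ∈ Icc (p0 - R) (p0 + R), ∀ p' ∈ Icc (p0 - R) (p0 + R), ∀ ω ∈ Icc 0 R,
      |yv p ω - yv p' ω| ≤ R * (K1 * M) * |p - p'| := by
    intro p hp p' hp' ω hω
    have h1 := hK1.dist_le_mul _ (hkm p hp ω hω) _ (hkm p' hp' ω hω)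
    rw [Real.dist_eq, Real.dist_eq] at h1
    have h2 := hkl p hp p' hp' ω hω ω hω
    rw [sub_self, abs_zero, add_zero] at h2
    rw [hyv]
    simp only
    rw [← mul_sub, abs_mul, abs_of_nonneg hω.1, mul_assoc]
    refine mul_le_mul hω.2 (h1.trans ?_) (abs_nonneg _) hR.le
    rw [mul_assoc]
    exact mul_le_mul_of_nonneg_left h2 K1.2
  have hcont : ∀ p ∈ Icc (p0 - R) (p0 + R), ContinuousOn (yv p) (Icc 0 R) := by
    intro p hp
    refine ContinuousOn.congr ?_ (hyv_eq p hp)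
    have : ContinuousOn (fun ω => f (p + ω)) (Icc 0 R) := by
      intro ω hω
      have hm := h.mem hp hω (right_mem_Icc.2 zero_le_one)
      rw [one_mul] at hm
      exact ((h.deriv1 _ hm).continuousAt.comp (by fun_prop)).continuousWithinAt
    exact (continuousOn_const.mul ((this.sub continuousOn_const).sub (by fun_prop))).sqrt
  have hderiv : ∀ p ∈ Icc (p0 - R) (p0 + R), ∀ ω ∈ Ioo 0 R,
      HasDerivAt (yv p) (l p ω / Real.sqrt (2 * k p ω)) ω := by
    intro p hp ω hω
    have hω' := Ioo_subset_Icc_self hω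
    have hev : yv p =ᶠ[𝓝 ω] fun ω => Real.sqrt (2 * (f (p + ω) - f p - f1 p * ω)) := by
      filter_upwards [Ioo_mem_nhds hω.1 hω.2] with x hx
      exact hyv_eq p hp x (Ioo_subset_Icc_self hx)
    have hm := h.mem hp hω' (right_mem_Icc.2 zero_le_one)
    rw [one_mul] at hm
    have h1 : HasDerivAt (fun ω => f (p + ω)) (f1 (p + ω)) ω := by
      have := (h.deriv1 _ hm).comp ω ((hasDerivAt_id ω).const_add p)
      rw [mul_one] at this
      exact this
    have h2 := ((h1.sub_const (f p)).sub ((hasDerivAt_id ω).const_mul (f1 p))).const_mul 2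
    have hpos := hkpos p hp ω hω'
    have hypos : 0 < Real.sqrt (2 * (f (p + ω) - f p - f1 p * ω)) := by
      rw [← hyv_eq p hp ω hω']; exact mul_pos hω.1 hpos
    have h3 := h2.sqrt (Real.sqrt_pos.1 hypos).ne'
    refine (h3.congr_of_eventuallyEq hev).congr_deriv ?_
    simp only [id, Pi.sub_apply]
    rw [← hyv_eq p hp ω hω', mul_one, ← h.mul_segMean_one hp hω', hyv]
    have := hω.1
    simp only
    rw [← hl]
    field_simp
  have hexp : ∀ p ∈ Icc (p0 - R) (p0 + R), ∀ ω ∈ Icc 0 R, ∀ ω' ∈ Icc 0 R,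
      c * |ω - ω'| ≤ |yv p ω - yv p ω'| := by
    intro p hp
    have hmono : MonotoneOn (fun ω => yv p ω - c * ω) (Icc 0 R) := by
      refine monotoneOn_of_deriv_nonneg (convex_Icc _ _) ((hcont p hp).sub (by fun_prop)) ?_ ?_
      · intro ω hω
        rw [interior_Icc] at hω
        exact ((hderiv p hp ω hω).differentiableAt.sub (by fun_prop)).differentiableWithinAt
      · intro ω hω
        rw [interior_Icc] at hω
        have hω' := Ioo_subset_Icc_self hω
        have hd : HasDerivAt (fun ω => yv p ω - c * ω) _ ω :=
          (hderiv p hp ω hω).sub ((hasDerivAt_id ω).const_mul c)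
        rw [hd.deriv, mul_one, sub_nonneg, hc]
        refine div_le_div₀ (hl0.le.trans (hlm p hp ω hω').1) (hlm p hp ω hω').1 (hkpos p hp ω hω') ?_
        exact Real.sqrt_le_sqrt (by linarith [(hkm p hp ω hω').2])
    have key : ∀ ω ∈ Icc 0 R, ∀ ω' ∈ Icc 0 R, ω ≤ ω' → c * |ω - ω'| ≤ |yv p ω - yv p ω'| := by
      intro ω hω ω' hω' hle
      have := hmono hω hω' hle
      simp only at this
      rw [abs_sub_comm, abs_of_nonneg (sub_nonneg.2 hle), abs_sub_comm]
      refine le_trans ?_ (le_abs_self _)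
      linarith
    intro ω hω ω' hω'
    rcases le_total ω ω' with hle | hle
    · exact key ω hω ω' hω' hle
    · rw [abs_sub_comm ω, abs_sub_comm (yv p ω)]
      exact key ω' hω' ω hω hle
  have hex : ∀ p ∈ Icc (p0 - R) (p0 + R), ∀ y ∈ Icc 0 (c * R), ∃ ω ∈ Icc 0 R, yv p ω = y := by
    intro p hp y hy
    have h0 : yv p 0 = 0 := by simp [hyv]
    have h1 : c * R ≤ yv p R := by
      have := hexp p hp R (right_mem_Icc.2 hR.le) 0 (left_mem_Icc.2 hR.le)
      rw [h0, sub_zero, sub_zero, abs_of_pos hR] at this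
      rwa [abs_of_nonneg (mul_nonneg hR.le (Real.sqrt_nonneg _))] at this
    exact intermediate_value_Icc hR.le (hcont p hp) ⟨h0.trans_le hy.1, hy.2.trans h1⟩
  choose! Ω hΩm hΩ using hex
  set C1 := (1 + R * (K1 * M)) / c with hC1
  have hlipΩ : ∀ p ∈ Icc (p0 - R) (p0 + R), ∀ q ∈ Icc (p0 - R) (p0 + R), ∀ y ∈ Icc 0 (c * R),
      ∀ y' ∈ Icc 0 (c * R), |Ω p y - Ω q y'| ≤ C1 * (|p - q| + |y - y'|) := by
    intro p hp q hq y hy y' hy'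
    -- The expansion estimate at the fixed base point `p` compares `Ω p y` with `Ω q y'`; replacing
    -- `yv p` by `yv q` then costs a multiple of `|p - q|`.
    have h1 := hexp p hp _ (hΩm p hp y hy) _ (hΩm q hq y' hy')
    have h2 := hyv_lip q hq p hp _ (hΩm q hq y' hy')
    rw [hΩ p hp y hy] at h1
    rw [hΩ q hq y' hy'] at h2
    have h3 : |y - yv p (Ω q y')| ≤ |y - y'| + |y' - yv p (Ω q y')| := abs_sub_le _ _ _
    have h4 : 0 ≤ R * (K1 * M) := by positivity
    rw [hC1, div_mul_eq_mul_div, le_div_iff₀ hcpos]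
    rw [abs_sub_comm q p] at h2
    nlinarith [abs_nonneg (y - y'), abs_nonneg (p - q), mul_nonneg h4 (abs_nonneg (y - y'))]
  have hC1pos : 0 < C1 := by positivity
  set e : ℝ → ℝ → ℝ := fun p ω => Real.sqrt (2 * k p ω) / l p ω with he
  have he_lip : ∀ p ∈ Icc (p0 - R) (p0 + R), ∀ p' ∈ Icc (p0 - R) (p0 + R), ∀ ω ∈ Icc 0 R, ∀ ω' ∈ Icc 0 R,
      |e p ω - e p' ω'| ≤ K2 * (M * (|p - p'| + |ω - ω'|)) := by
    intro p hp p' hp' ω hω ω' hω'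
    have h1 := hK2.dist_le_mul (k p ω, l p ω) ⟨hkm p hp ω hω, hlm p hp ω hω⟩ (k p' ω', l p' ω')
      ⟨hkm p' hp' ω' hω', hlm p' hp' ω' hω'⟩
    rw [Real.dist_eq, Prod.dist_eq, Real.dist_eq, Real.dist_eq] at h1
    exact h1.trans (mul_le_mul_of_nonneg_left
      (max_le (hkl p hp p' hp' ω hω ω' hω') (hll p hp p' hp' ω hω ω' hω')) K2.2)
  have he_pos : ∀ p ∈ Icc (p0 - R) (p0 + R), ∀ ω ∈ Icc 0 R, 0 < e p ω := fun p hp ω hω =>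
    div_pos (hkpos p hp ω hω) (hl0.trans_le (hlm p hp ω hω).1)
  have hΩ0 : ∀ p ∈ Icc (p0 - R) (p0 + R), Ω p 0 = 0 := by
    intro p hp
    have h0 : (0 : ℝ) ∈ Icc 0 (c * R) := left_mem_Icc.2 (by positivity)
    have h1 := hΩ p hp 0 h0
    exact (mul_eq_zero.1 h1).resolve_right (hkpos p hp _ (hΩm p hp 0 h0)).ne'
  have hp0 : p0 ∈ Icc (p0 - R) (p0 + R) := by constructor <;> linarith
  -- The four summands serve, in order, the Lipschitz bound for `Ω`, the Lipschitz bound for `E`,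
  -- the supremum of `E`, and the inverse Lipschitz bound for `f1`.
  set C := C1 + K2 * M * (1 + C1) + Real.sqrt l1 / l0 + 1 / l0 with hC
  have hK2M : 0 ≤ K2 * M := by positivity
  have hCle : C1 ≤ C := by
    have : 0 ≤ K2 * M * (1 + C1) + Real.sqrt l1 / l0 + 1 / l0 := by positivity
    linarith
  refine ⟨R, c * R, C, Ω, fun p y => e p (Ω p y), hR, by positivity, hC1pos.trans_le hCle, hΩ0,
    ?_, ?_, ?_, ?_, ?_, ?_, ?_, ?_, ?_⟩
  · intro p hp y hy
    rw [← h.sq_mul_segMean hp (hΩm p hp y hy)]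
    nth_rewrite 3 [← hΩ p hp y hy]
    rw [hyv]
    simp only
    rw [mul_pow, Real.sq_sqrt (by linarith [(hkm p hp _ (hΩm p hp y hy)).1])]
    ring
  · intro p hp y hy
    have hlp := hl0.trans_le (hlm p hp _ (hΩm p hp y hy)).1
    rw [← h.mul_segMean_one hp (hΩm p hp y hy), ← hl, he]
    refine Eq.trans ?_ (hΩ p hp y hy)
    simp only [hyv]
    field_simp
  · intro p hp y hy
    exact he_pos p hp _ (hΩm p hp y hy)
  · intro p hp y hy
    have hm := hΩm p hp y hy
    have : e p (Ω p y) ≤ Real.sqrt l1 / l0 :=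
      div_le_div₀ hsl1.le (Real.sqrt_le_sqrt (by linarith [(hkm p hp _ hm).2])) hl0 (hlm p hp _ hm).1
    refine this.trans ?_
    rw [hC]
    have : 0 ≤ C1 + K2 * M * (1 + C1) + 1 / l0 := by positivity
    linarith
  · simp only [hΩ0 p0 hp0, he]
    have hf2 : 0 < f2 p0 := hl0.trans_le (h.lower p0 (by constructor <;> linarith))
    have h1 : k p0 0 = f2 p0 / 2 := by
      simp only [hk, segMean, mul_zero, add_zero, intervalIntegral.integral_mul_const, hint]
      ring
    have h2 : l p0 0 = f2 p0 := by simp [hl, segMean]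
    rw [h1, h2, mul_div_cancel₀ _ two_ne_zero]
    have := Real.sqrt_pos.2 hf2
    rw [div_eq_div_iff hf2.ne' this.ne', Real.mul_self_sqrt hf2.le, one_mul]
  · intro p hp q hq y hy y' hy'
    exact (hlipΩ p hp q hq y hy y' hy').trans (by gcongr)
  · intro p hp q hq y hy y' hy'
    refine (he_lip p hp q hq _ (hΩm p hp y hy) _ (hΩm q hq y' hy')).trans ?_
    have h1 := hlipΩ p hp q hq y hy y' hy'
    have h2 : |p - q| + |Ω p y - Ω q y'| ≤ (1 + C1) * (|p - q| + |y - y'|) := by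
      nlinarith [abs_nonneg (y - y'), abs_nonneg (p - q)]
    calc K2 * (M * (|p - q| + |Ω p y - Ω q y'|)) ≤ K2 * (M * ((1 + C1) * (|p - q| + |y - y'|))) := by
          gcongr
      _ = (K2 * M * (1 + C1)) * (|p - q| + |y - y'|) := by ring
      _ ≤ C * (|p - q| + |y - y'|) := by
          gcongr
          rw [hC]
          have : 0 ≤ Real.sqrt l1 / l0 + 1 / l0 := by positivity
          linarith
  · intro p hp y hy
    have hy' := Ioo_subset_Icc_self hy
    have hm := hΩm p hp y hy'
    have hle : c * Ω p y ≤ y := by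
      have := hexp p hp _ hm 0 (left_mem_Icc.2 hR.le)
      rw [hΩ p hp y hy'] at this
      simp only [hyv, zero_mul, sub_zero] at this
      rwa [abs_of_nonneg hm.1, abs_of_pos hy.1] at this
    have hpos : 0 < Ω p y := by
      rcases hm.1.lt_or_eq with h1 | h1
      · exact h1
      · exfalso
        have := hΩ p hp y hy'
        rw [← h1] at this
        simp only [hyv, zero_mul] at this
        exact hy.1.ne this
    have hlt : Ω p y < R := by
      by_contra hcon
      push Not at hcon
      nlinarith [hy.2]
    have hcontΩ : ContinuousAt (Ω p) y := by
      have : ContinuousOn (Ω p) (Icc 0 (c * R)) := by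
        have : LipschitzOnWith (Real.toNNReal C1) (Ω p) (Icc 0 (c * R)) := by
          refine LipschitzOnWith.of_dist_le_mul fun x hx y hy => ?_
          have := hlipΩ p hp p hp x hx y hy
          rw [sub_self, abs_zero, zero_add] at this
          rwa [Real.dist_eq, Real.dist_eq, Real.coe_toNNReal _ hC1pos.le]
        exact this.continuousOn
      exact this.continuousAt (Icc_mem_nhds hy.1 hy.2)
    have hinv : e p (Ω p y) = (l p (Ω p y) / Real.sqrt (2 * k p (Ω p y)))⁻¹ := by rw [he, inv_div]
    rw [hinv]
    refine HasDerivAt.of_local_left_inverse hcontΩ (hderiv p hp _ ⟨hpos, hlt⟩) ?_ ?_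
    · exact (div_pos (hl0.trans_le (hlm p hp _ hm).1) (hkpos p hp _ hm)).ne'
    · filter_upwards [Icc_mem_nhds hy.1 hy.2] with x hx
      exact hΩ p hp x hx
  · intro p hp q hq
    have hsub : Icc (p0 - R) (p0 + R) ⊆ Icc (p0 - 2 * R) (p0 + 2 * R) :=
      Icc_subset_Icc (by linarith) (by linarith)
    have hmono : MonotoneOn (fun z => f1 z - l0 * z) (Icc (p0 - R) (p0 + R)) := by
      have hd : ∀ z ∈ Icc (p0 - R) (p0 + R), HasDerivAt (fun z => f1 z - l0 * z) (f2 z - l0) z := by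
        intro z hz
        have := (h.deriv2 z (hsub hz)).sub ((hasDerivAt_id z).const_mul l0)
        rw [mul_one] at this
        exact this
      refine monotoneOn_of_deriv_nonneg (convex_Icc _ _)
        (fun z hz => (hd z hz).continuousAt.continuousWithinAt)
        (fun z hz => (hd z (interior_subset hz)).differentiableAt.differentiableWithinAt) ?_
      intro z hz
      rw [(hd z (interior_subset hz)).deriv, sub_nonneg]
      exact h.lower z (hsub (interior_subset hz))
    have key : ∀ p ∈ Icc (p0 - R) (p0 + R), ∀ q ∈ Icc (p0 - R) (p0 + R), p ≤ q →
        |p - q| ≤ C * |f1 p - f1 q| := by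
      intro p hp q hq hle
      have h1 := hmono hp hq hle
      simp only at h1
      have h2 : 1 / l0 ≤ C := by
        have : 0 ≤ C1 + K2 * M * (1 + C1) + Real.sqrt l1 / l0 := by positivity
        linarith
      refine le_trans ?_ (mul_le_mul_of_nonneg_right h2 (abs_nonneg _))
      rw [abs_sub_comm, abs_of_nonneg (sub_nonneg.2 hle), abs_sub_comm, one_div_mul_eq_div,
        le_div_iff₀ hl0]
      refine le_trans ?_ (le_abs_self _)
      linarith
    rcases le_total p q with hle | hle
    · exact key p hp q hq hle
    · rw [abs_sub_comm p, abs_sub_comm (f1 p)]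
      exact key q hq p hp hle

/-! ### The contribution of one phase to the quadrature integrals -/

/-- `J` is Lipschitz in its three variables. -/
def IsLip3 (J : ℝ → ℝ → ℝ → ℝ) (p0 ρ Y C : ℝ) : Prop :=
  ∀ p ∈ Icc (p0 - ρ) (p0 + ρ), ∀ q ∈ Icc (p0 - ρ) (p0 + ρ), ∀ y ∈ Icc 0 Y, ∀ y' ∈ Icc 0 Y,
    ∀ m ∈ Icc 0 Y, ∀ m' ∈ Icc 0 Y, |J p y m - J q y' m'| ≤ C * (|p - q| + |y - y'| + |m - m'|)

/-- The integral along the hyperbolic parametrization `y = exp (-x) * cosh s`. -/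
noncomputable def sideInt (J : ℝ → ℝ → ℝ → ℝ) (ℓ p x : ℝ) : ℝ :=
  ∫ s in (0 : ℝ)..(x - ℓ), J p (Real.exp (-x) * Real.cosh s) (Real.exp (-x))

lemma cosh_le_exp {s : ℝ} (hs : 0 ≤ s) : Real.cosh s ≤ Real.exp s := by
  rw [Real.cosh_eq]
  have : Real.exp (-s) ≤ Real.exp s := Real.exp_le_exp.2 (by linarith)
  linarith

lemma exp_mul_cosh_mem {x ℓ s : ℝ} (hs : s ∈ Icc 0 (x - ℓ)) :
    Real.exp (-x) * Real.cosh s ∈ Icc 0 (Real.exp (-ℓ)) := by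
  have h0 := Real.cosh_pos s
  refine ⟨by positivity, ?_⟩
  calc Real.exp (-x) * Real.cosh s ≤ Real.exp (-x) * Real.exp s := by
        gcongr; exact cosh_le_exp hs.1
    _ = Real.exp (-x + s) := (Real.exp_add _ _).symm
    _ ≤ Real.exp (-ℓ) := Real.exp_le_exp.2 (by linarith [hs.2])

lemma exp_neg_mul_two_sinh_le (x ℓ : ℝ) :
    Real.exp (-x) * (2 * Real.sinh (x - ℓ)) ≤ Real.exp (-ℓ) := by
  rw [Real.sinh_eq, mul_div_cancel₀ _ two_ne_zero, mul_sub, ← Real.exp_add]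
  have : 0 < Real.exp (-x) * Real.exp (-(x - ℓ)) := by positivity
  have h2 : -x + (x - ℓ) = -ℓ := by ring
  rw [h2]; linarith

lemma exp_neg_mul_le_one {x : ℝ} : Real.exp (-x) * x ≤ 1 := by
  have := Real.add_one_le_exp x
  rw [Real.exp_neg, inv_mul_le_iff₀ (Real.exp_pos x)]
  linarith

lemma exp_neg_sub_exp_neg_le (x x' : ℝ) :
    Real.exp (-x) - Real.exp (-x') ≤ Real.exp (-x) * (x' - x) := by
  have h1 := Real.add_one_le_exp (x - x')
  have h2 : Real.exp (-x') = Real.exp (-x) * Real.exp (x - x') := by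
    rw [← Real.exp_add]; congr 1; ring
  rw [h2]
  nlinarith [Real.exp_pos (-x)]

lemma integral_cosh (u v : ℝ) : ∫ s in u..v, Real.cosh s = Real.sinh v - Real.sinh u :=
  intervalIntegral.integral_eq_sub_of_hasDerivAt (fun s _ => Real.hasDerivAt_sinh s)
    (Real.continuous_cosh.intervalIntegrable _ _)

namespace IsLip3

variable {J : ℝ → ℝ → ℝ → ℝ} {p0 ρ Y C ℓ p x : ℝ}

lemma nonneg (h : IsLip3 J p0 ρ Y C) (hρ : 0 < ρ) (hY : 0 < Y) : 0 ≤ C := by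
  have h0 : (0 : ℝ) ∈ Icc 0 Y := left_mem_Icc.2 hY.le
  have h1 := h (p0 + ρ) (by constructor <;> linarith) p0 (by constructor <;> linarith) 0 h0 0 h0 0 h0 0 h0
  simp only [add_sub_cancel_left, sub_self, abs_zero, add_zero, abs_of_pos hρ] at h1
  exact nonneg_of_mul_nonneg_left ((abs_nonneg _).trans h1) hρ

lemma continuousOn (h : IsLip3 J p0 ρ Y C) (hp : p ∈ Icc (p0 - ρ) (p0 + ρ)) {m : ℝ}
    (hm : m ∈ Icc 0 Y) : ContinuousOn (fun y => J p y m) (Icc 0 Y) := by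
  have : LipschitzOnWith (Real.toNNReal C) (fun y => J p y m) (Icc 0 Y) := by
    refine LipschitzOnWith.of_dist_le_mul fun y hy y' hy' => ?_
    have h1 := h p hp p hp y hy y' hy' m hm m hm
    rw [sub_self, abs_zero, sub_self, abs_zero, zero_add, add_zero] at h1
    rw [Real.dist_eq, Real.dist_eq]
    exact h1.trans (by gcongr; exact Real.le_coe_toNNReal C)
  exact this.continuousOn

lemma intervalIntegrable (h : IsLip3 J p0 ρ Y C) (hℓ : Real.exp (-ℓ) ≤ Y)
    (hp : p ∈ Icc (p0 - ρ) (p0 + ρ)) {u v : ℝ} (hu : u ∈ Icc 0 (x - ℓ)) (hv : v ∈ Icc 0 (x - ℓ)) :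
    IntervalIntegrable (fun s => J p (Real.exp (-x) * Real.cosh s) (Real.exp (-x)))
      MeasureTheory.volume u v := by
  refine ContinuousOn.intervalIntegrable ?_
  have hx : ℓ ≤ x := by linarith [hu.1.trans hu.2]
  have hm : Real.exp (-x) ∈ Icc 0 Y :=
    ⟨(Real.exp_pos _).le, (Real.exp_le_exp.2 (by linarith)).trans hℓ⟩
  refine (h.continuousOn hp hm).comp (by fun_prop) fun s hs => ?_
  have hs' : s ∈ Icc 0 (x - ℓ) := uIcc_subset_Icc hu hv hs
  have := exp_mul_cosh_mem hs'
  exact ⟨this.1, this.2.trans hℓ⟩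

lemma abs_sub_le (h : IsLip3 J p0 ρ Y C) (hρ : 0 < ρ) (hY : 0 < Y) (hℓ : Real.exp (-ℓ) ≤ Y)
    (hp : p ∈ Icc (p0 - ρ) (p0 + ρ)) {s : ℝ} (hs : s ∈ Icc 0 (x - ℓ)) :
    |J p (Real.exp (-x) * Real.cosh s) (Real.exp (-x)) - J p0 0 0| ≤
      C * (|p - p0| + Real.exp (-x) * Real.cosh s + Real.exp (-x)) := by
  have hx : ℓ ≤ x := by linarith [hs.1.trans hs.2]
  have hy := exp_mul_cosh_mem hs
  have hm : Real.exp (-x) ∈ Icc 0 Y :=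
    ⟨(Real.exp_pos _).le, (Real.exp_le_exp.2 (by linarith)).trans hℓ⟩
  have h0 : (0 : ℝ) ∈ Icc 0 Y := left_mem_Icc.2 hY.le
  have := h p hp p0 (by constructor <;> linarith) _ ⟨hy.1, hy.2.trans hℓ⟩ 0 h0 _ hm 0 h0
  rwa [sub_zero, sub_zero, abs_of_nonneg hy.1, abs_of_nonneg hm.1] at this

/-- Replacing the integrand by its value at `(p0, 0, 0)` gives the linear term. The error from `y`
stays bounded because `exp (-x) * cosh s` has integral `exp (-x) * sinh (x - ℓ) ≤ exp (-ℓ) / 2`, and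
the error from `m` because `exp (-x) * x ≤ 1`. Only the displacement of `p` is multiplied by the
length `x`. -/
lemma sideInt_approx (h : IsLip3 J p0 ρ Y C) (hρ : 0 < ρ) (hY : 0 < Y) (hℓ0 : 0 ≤ ℓ)
    (hℓ : Real.exp (-ℓ) ≤ Y) (hp : p ∈ Icc (p0 - ρ) (p0 + ρ)) (hx : ℓ ≤ x) :
    |sideInt J ℓ p x - J p0 0 0 * x| ≤ C * |p - p0| * x + (2 * C + |J p0 0 0| * ℓ) := by
  have hC := h.nonneg hρ hY
  have hxl : 0 ≤ x - ℓ := by linarith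
  have hl : (0 : ℝ) ∈ Icc 0 (x - ℓ) := left_mem_Icc.2 hxl
  have hr : x - ℓ ∈ Icc 0 (x - ℓ) := right_mem_Icc.2 hxl
  have hi := h.intervalIntegrable hℓ hp hl hr
  have e1 : sideInt J ℓ p x - J p0 0 0 * x =
      (∫ s in (0 : ℝ)..(x - ℓ), (J p (Real.exp (-x) * Real.cosh s) (Real.exp (-x)) - J p0 0 0))
        - J p0 0 0 * ℓ := by
    rw [intervalIntegral.integral_sub hi (by simp), intervalIntegral.integral_const, sideInt]
    simp only [smul_eq_mul]; ring
  have e2 : |∫ s in (0 : ℝ)..(x - ℓ), (J p (Real.exp (-x) * Real.cosh s) (Real.exp (-x)) - J p0 0 0)|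
      ≤ ∫ s in (0 : ℝ)..(x - ℓ), C * (|p - p0| + Real.exp (-x) * Real.cosh s + Real.exp (-x)) := by
    rw [← Real.norm_eq_abs]
    refine intervalIntegral.norm_integral_le_of_norm_le hxl
      (Filter.Eventually.of_forall fun s hs => ?_) (Continuous.intervalIntegrable (by fun_prop) _ _)
    exact h.abs_sub_le hρ hY hℓ hp (Ioc_subset_Icc_self hs)
  have e3 : (∫ s in (0 : ℝ)..(x - ℓ), C * (|p - p0| + Real.exp (-x) * Real.cosh s + Real.exp (-x)))
      = C * ((|p - p0| + Real.exp (-x)) * (x - ℓ) + Real.exp (-x) * Real.sinh (x - ℓ)) := by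
    rw [intervalIntegral.integral_const_mul, intervalIntegral.integral_add
      (Continuous.intervalIntegrable (by fun_prop) _ _)
      (Continuous.intervalIntegrable (by fun_prop) _ _), intervalIntegral.integral_add
      (Continuous.intervalIntegrable (by fun_prop) _ _)
      (Continuous.intervalIntegrable (by fun_prop) _ _), intervalIntegral.integral_const_mul,
      intervalIntegral.integral_const, intervalIntegral.integral_const, integral_cosh]
    simp only [smul_eq_mul, Real.sinh_zero]; ring
  have e4 := exp_neg_mul_two_sinh_le x ℓ
  have e5 : Real.exp (-ℓ) ≤ 1 := Real.exp_le_one_iff.2 (by linarith)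
  have e6 := exp_neg_mul_le_one (x := x)
  have e7 := (Real.exp_pos (-x)).le
  have e8 : (|p - p0| + Real.exp (-x)) * (x - ℓ) + Real.exp (-x) * Real.sinh (x - ℓ) ≤
      |p - p0| * x + 2 := by
    nlinarith [abs_nonneg (p - p0), mul_nonneg e7 hℓ0, mul_nonneg (abs_nonneg (p - p0)) hℓ0]
  rw [e1]
  refine (abs_sub _ _).trans ?_
  rw [abs_mul, abs_of_nonneg hℓ0]
  have := mul_le_mul_of_nonneg_left e8 hC
  linarith

/-- The difference consists of the additional stretch from `x - ℓ` to `x' - ℓ`, where the integrand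
is close to `J p0 0 0`, and of the common stretch, where `y` and `m` change by `exp (-x) - exp
(-x')` times `cosh s` and `1`. The second contribution integrates to at most `exp (-ℓ) * (x' - x)`.
The coefficient of `x' - x` is thus small when the phase is near `p0` and `ℓ` is large. -/
lemma sideInt_sub_of_le (h : IsLip3 J p0 ρ Y C) (hρ : 0 < ρ) (hY : 0 < Y) (hℓ0 : 0 ≤ ℓ)
    (hℓ : Real.exp (-ℓ) ≤ Y) (hp : p ∈ Icc (p0 - ρ) (p0 + ρ)) {p' x' : ℝ}
    (hp' : p' ∈ Icc (p0 - ρ) (p0 + ρ)) (hx : ℓ ≤ x) (hxx : x ≤ x') :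
    |sideInt J ℓ p' x' - sideInt J ℓ p x - J p0 0 0 * (x' - x)| ≤
      C * (|p' - p0| + 3 * Real.exp (-ℓ)) * (x' - x) + C * x * |p' - p| := by
  have hC := h.nonneg hρ hY
  have hxl : 0 ≤ x - ℓ := by linarith
  have hxl' : 0 ≤ x' - ℓ := by linarith
  have m1 : (0 : ℝ) ∈ Icc 0 (x' - ℓ) := left_mem_Icc.2 hxl'
  have m2 : x - ℓ ∈ Icc 0 (x' - ℓ) := ⟨hxl, by linarith⟩
  have m3 : x' - ℓ ∈ Icc 0 (x' - ℓ) := right_mem_Icc.2 hxl'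
  have i1 := h.intervalIntegrable hℓ hp' m1 m2
  have i2 := h.intervalIntegrable hℓ hp' m2 m3
  have i3 := h.intervalIntegrable hℓ hp (left_mem_Icc.2 hxl) (right_mem_Icc.2 hxl)
  have e0 : sideInt J ℓ p' x' - sideInt J ℓ p x - J p0 0 0 * (x' - x) =
      (∫ s in (x - ℓ)..(x' - ℓ), (J p' (Real.exp (-x') * Real.cosh s) (Real.exp (-x')) - J p0 0 0)) +
      ∫ s in (0 : ℝ)..(x - ℓ), (J p' (Real.exp (-x') * Real.cosh s) (Real.exp (-x')) -
        J p (Real.exp (-x) * Real.cosh s) (Real.exp (-x))) := by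
    rw [intervalIntegral.integral_sub i2 (by simp), intervalIntegral.integral_sub i1 i3, sideInt,
      sideInt, ← intervalIntegral.integral_add_adjacent_intervals i1 i2,
      intervalIntegral.integral_const]
    simp only [smul_eq_mul]; ring
  have b1 : |∫ s in (x - ℓ)..(x' - ℓ),
      (J p' (Real.exp (-x') * Real.cosh s) (Real.exp (-x')) - J p0 0 0)| ≤
      C * (|p' - p0| + 2 * Real.exp (-ℓ)) * (x' - x) := by
    have := intervalIntegral.norm_integral_le_of_norm_le_const (a := x - ℓ) (b := x' - ℓ)
      (f := fun s => J p' (Real.exp (-x') * Real.cosh s) (Real.exp (-x')) - J p0 0 0)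
      (C := C * (|p' - p0| + 2 * Real.exp (-ℓ))) ?_
    · rwa [Real.norm_eq_abs, show x' - ℓ - (x - ℓ) = x' - x by ring,
        abs_of_nonneg (sub_nonneg.2 hxx)] at this
    intro s hs
    rw [uIoc_of_le (by linarith)] at hs
    have hs' : s ∈ Icc 0 (x' - ℓ) := ⟨hxl.trans hs.1.le, hs.2⟩
    refine (h.abs_sub_le hρ hY hℓ hp' hs').trans (mul_le_mul_of_nonneg_left ?_ hC)
    have := (exp_mul_cosh_mem hs').2
    have : Real.exp (-x') ≤ Real.exp (-ℓ) := Real.exp_le_exp.2 (by linarith)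
    linarith
  have hexp : Real.exp (-x') ≤ Real.exp (-x) := Real.exp_le_exp.2 (by linarith)
  have b2 : |∫ s in (0 : ℝ)..(x - ℓ), (J p' (Real.exp (-x') * Real.cosh s) (Real.exp (-x')) -
        J p (Real.exp (-x) * Real.cosh s) (Real.exp (-x)))| ≤
      ∫ s in (0 : ℝ)..(x - ℓ), C * (|p' - p| + (Real.exp (-x) - Real.exp (-x')) * (Real.cosh s + 1)) := by
    rw [← Real.norm_eq_abs]
    refine intervalIntegral.norm_integral_le_of_norm_le hxl
      (Filter.Eventually.of_forall fun s hs => ?_) (Continuous.intervalIntegrable (by fun_prop) _ _)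
    have hs1 := exp_mul_cosh_mem (Ioc_subset_Icc_self hs)
    have hs2 := exp_mul_cosh_mem (x := x') (ℓ := ℓ) (s := s) ⟨hs.1.le, by linarith [hs.2]⟩
    have hm1 : Real.exp (-x) ∈ Icc 0 Y :=
      ⟨(Real.exp_pos _).le, (Real.exp_le_exp.2 (by linarith)).trans hℓ⟩
    have hm2 : Real.exp (-x') ∈ Icc 0 Y := ⟨(Real.exp_pos _).le, hexp.trans hm1.2⟩
    refine (h p' hp' p hp _ ⟨hs2.1, hs2.2.trans hℓ⟩ _ ⟨hs1.1, hs1.2.trans hℓ⟩ _ hm2 _ hm1).trans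
      (mul_le_mul_of_nonneg_left (le_of_eq ?_) hC)
    rw [← sub_mul, abs_mul, abs_of_nonpos (sub_nonpos.2 hexp), abs_of_pos (Real.cosh_pos s)]
    ring
  have e3 : (∫ s in (0 : ℝ)..(x - ℓ),
      C * (|p' - p| + (Real.exp (-x) - Real.exp (-x')) * (Real.cosh s + 1)))
      = C * (|p' - p| * (x - ℓ) + (Real.exp (-x) - Real.exp (-x')) * (Real.sinh (x - ℓ) + (x - ℓ))) := by
    rw [intervalIntegral.integral_const_mul, intervalIntegral.integral_add
      (Continuous.intervalIntegrable (by fun_prop) _ _)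
      (Continuous.intervalIntegrable (by fun_prop) _ _), intervalIntegral.integral_const_mul,
      intervalIntegral.integral_add
      (Continuous.intervalIntegrable (by fun_prop) _ _)
      (Continuous.intervalIntegrable (by fun_prop) _ _),
      intervalIntegral.integral_const, intervalIntegral.integral_const, integral_cosh]
    simp only [smul_eq_mul, Real.sinh_zero]; ring
  have e4 := exp_neg_mul_two_sinh_le x ℓ
  have e5 : x - ℓ ≤ Real.sinh (x - ℓ) := Real.self_le_sinh_iff.2 hxl
  have e6 := exp_neg_sub_exp_neg_le x x'
  have e7 : (Real.exp (-x) - Real.exp (-x')) * (Real.sinh (x - ℓ) + (x - ℓ)) ≤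
      Real.exp (-ℓ) * (x' - x) := by
    calc (Real.exp (-x) - Real.exp (-x')) * (Real.sinh (x - ℓ) + (x - ℓ))
        ≤ (Real.exp (-x) * (x' - x)) * (2 * Real.sinh (x - ℓ)) := by
          refine mul_le_mul e6 (by linarith) (by linarith) ?_
          exact mul_nonneg (Real.exp_pos _).le (by linarith)
      _ = (Real.exp (-x) * (2 * Real.sinh (x - ℓ))) * (x' - x) := by ring
      _ ≤ Real.exp (-ℓ) * (x' - x) := mul_le_mul_of_nonneg_right e4 (by linarith)
  have e8 : |p' - p| * (x - ℓ) ≤ x * |p' - p| := by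
    nlinarith [abs_nonneg (p' - p), mul_nonneg (abs_nonneg (p' - p)) hℓ0]
  rw [e0]
  refine (abs_add_le _ _).trans ((add_le_add b1 (b2.trans (e3.trans_le
    (mul_le_mul_of_nonneg_left (add_le_add e8 e7) hC)))).trans (le_of_eq ?_))
  ring

lemma sideInt_sub (h : IsLip3 J p0 ρ Y C) (hρ : 0 < ρ) (hY : 0 < Y) (hℓ0 : 0 ≤ ℓ)
    (hℓ : Real.exp (-ℓ) ≤ Y) {p' x' d X : ℝ} (hd : d ≤ ρ) (hp : |p - p0| ≤ d) (hp' : |p' - p0| ≤ d)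
    (hx : x ∈ Icc ℓ X) (hx' : x' ∈ Icc ℓ X) :
    |sideInt J ℓ p' x' - sideInt J ℓ p x - J p0 0 0 * (x' - x)| ≤
      C * (d + 3 * Real.exp (-ℓ)) * |x' - x| + C * X * |p' - p| := by
  have hC := h.nonneg hρ hY
  have hmem : ∀ {q : ℝ}, |q - p0| ≤ d → q ∈ Icc (p0 - ρ) (p0 + ρ) := fun {q} hq => by
    have := abs_le.1 hq
    constructor <;> linarith [this.1, this.2]
  rcases le_total x x' with hxx | hxx
  · refine (h.sideInt_sub_of_le hρ hY hℓ0 hℓ (hmem hp) (hmem hp') hx.1 hxx).trans ?_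
    rw [abs_of_nonneg (sub_nonneg.2 hxx)]
    have := sub_nonneg.2 hxx
    gcongr
    exact hx.2
  · have := h.sideInt_sub_of_le hρ hY hℓ0 hℓ (hmem hp') (hmem hp) hx'.1 hxx
    rw [← abs_neg, show -(sideInt J ℓ p' x' - sideInt J ℓ p x - J p0 0 0 * (x' - x)) =
      sideInt J ℓ p x - sideInt J ℓ p' x' - J p0 0 0 * (x - x') by ring, abs_sub_comm x' x,
      abs_of_nonneg (sub_nonneg.2 hxx), abs_sub_comm p' p]
    refine this.trans ?_
    have := sub_nonneg.2 hxx
    gcongr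
    exact hx'.2

end IsLip3

/-- The integrand along the chart for the weight `g`. -/
noncomputable def chartJ (g : ℝ → ℝ) (Ω E : ℝ → ℝ → ℝ) (ε p y m : ℝ) : ℝ :=
  g (p + Ω p y) * E p y * kap (ε ^ 2 * ((y ^ 2 - m ^ 2) / 2))

section Chart

variable {f f1 : ℝ → ℝ} {p0 lam ρ Y C : ℝ} {Ω E : ℝ → ℝ → ℝ}

lemma chartJ_base (h : IsChart f f1 p0 lam ρ Y C Ω E) (g : ℝ → ℝ) (ε : ℝ) :
    chartJ g Ω E ε p0 0 0 = g p0 / Real.sqrt lam := by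
  have hρ := h.ρ_pos
  rw [chartJ, h.Ω_zero p0 (by constructor <;> linarith), h.E_base]
  simp [kap_zero, div_eq_mul_inv]

/-- The constant does not depend on `ε`. The cut-off `min Y 1` and `ε ≤ 1` keep the argument of
`kap` in `[-1/2, 1/2]`. -/
lemma exists_lip_chartJ (h : IsChart f f1 p0 lam ρ Y C Ω E) {g : ℝ → ℝ}
    (hg : ∀ z w, |g z - g w| ≤ |z - w|) :
    ∃ C', ∀ ε ∈ Ioc (0 : ℝ) 1, IsLip3 (chartJ g Ω E ε) p0 ρ (min Y 1) C' := by
  obtain ⟨Ck, hCk, hkl, hkb⟩ := exists_lipschitz_kap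
  have hC := h.C_pos
  have hρ := h.ρ_pos
  have hY := h.Y_pos
  set B := |g p0| + (ρ + C * Y) with hB
  have hBpos : 0 ≤ B := by positivity
  refine ⟨(1 + C) * C * Ck + B * C * Ck + B * C * Ck, ?_⟩
  intro ε hε p hp q hq y hy y' hy' m hm m' hm'
  have hyY : y ∈ Icc 0 Y := ⟨hy.1, hy.2.trans (min_le_left _ _)⟩
  have hyY' : y' ∈ Icc 0 Y := ⟨hy'.1, hy'.2.trans (min_le_left _ _)⟩
  have hε2 : ε ^ 2 ≤ 1 := by nlinarith [hε.1, hε.2]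
  have hy1 : y ≤ 1 := hy.2.trans (min_le_right _ _)
  have hy1' : y' ≤ 1 := hy'.2.trans (min_le_right _ _)
  have hm1 : m ≤ 1 := hm.2.trans (min_le_right _ _)
  have hm1' : m' ≤ 1 := hm'.2.trans (min_le_right _ _)
  have htm : ∀ {a b : ℝ}, 0 ≤ a → a ≤ 1 → 0 ≤ b → b ≤ 1 →
      ε ^ 2 * ((a ^ 2 - b ^ 2) / 2) ∈ Icc (-1 / 2 : ℝ) (1 / 2) := by
    intro a b ha ha1 hb hb1
    have h1 : |(a ^ 2 - b ^ 2) / 2| ≤ 1 / 2 := by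
      rw [abs_le]; constructor <;> nlinarith
    have h2 : |ε ^ 2 * ((a ^ 2 - b ^ 2) / 2)| ≤ 1 / 2 := by
      rw [abs_mul, abs_of_nonneg (sq_nonneg ε)]
      nlinarith [abs_nonneg ((a ^ 2 - b ^ 2) / 2)]
    have := abs_le.1 h2
    constructor <;> linarith [this.1, this.2]
  set D := |p - q| + |y - y'| + |m - m'| with hD
  have a1 := abs_nonneg (p - q)
  have a2 := abs_nonneg (y - y')
  have a3 := abs_nonneg (m - m')
  have k1 : |kap (ε ^ 2 * ((y ^ 2 - m ^ 2) / 2)) - kap (ε ^ 2 * ((y' ^ 2 - m' ^ 2) / 2))| ≤ Ck * D := by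
    refine (hkl _ (htm hy.1 hy1 hm.1 hm1) _ (htm hy'.1 hy1' hm'.1 hm1')).trans
      (mul_le_mul_of_nonneg_left ?_ hCk.le)
    rw [← mul_sub, abs_mul, abs_of_nonneg (sq_nonneg ε),
      show (y ^ 2 - m ^ 2) / 2 - (y' ^ 2 - m' ^ 2) / 2 =
        (y + y') / 2 * (y - y') - (m + m') / 2 * (m - m') by ring]
    have b1 : |(y + y') / 2 * (y - y') - (m + m') / 2 * (m - m')| ≤ |y - y'| + |m - m'| := by
      refine (abs_sub _ _).trans ?_
      rw [abs_mul, abs_mul, abs_of_nonneg (by linarith [hy.1, hy'.1] : 0 ≤ (y + y') / 2),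
        abs_of_nonneg (by linarith [hm.1, hm'.1] : 0 ≤ (m + m') / 2)]
      exact add_le_add (mul_le_of_le_one_left a2 (by linarith))
        (mul_le_of_le_one_left a3 (by linarith))
    calc ε ^ 2 * |(y + y') / 2 * (y - y') - (m + m') / 2 * (m - m')| ≤ 1 * (|y - y'| + |m - m'|) := by
          gcongr
      _ ≤ D := by rw [hD]; linarith
  have e1 : |E p y - E q y'| ≤ C * D :=
    (h.lip_E p hp q hq y hyY y' hyY').trans (mul_le_mul_of_nonneg_left (by rw [hD]; linarith) hC.le)
  have g1 : |g (p + Ω p y) - g (q + Ω q y')| ≤ (1 + C) * D := by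
    refine (hg _ _).trans ?_
    rw [show p + Ω p y - (q + Ω q y') = (p - q) + (Ω p y - Ω q y') by ring]
    refine (abs_add_le _ _).trans ?_
    have := h.lip_Ω p hp q hq y hyY y' hyY'
    rw [hD]
    nlinarith
  have g2 : |g (q + Ω q y')| ≤ B := by
    have b1 := hg (q + Ω q y') p0
    have b2 := h.lip_Ω q hq q hq y' hyY' 0 (left_mem_Icc.2 hY.le)
    rw [h.Ω_zero q hq, sub_self, abs_zero, zero_add, sub_zero, sub_zero, abs_of_nonneg hy'.1] at b2
    have b3 : |q + Ω q y' - p0| ≤ ρ + C * Y := by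
      rw [show q + Ω q y' - p0 = (q - p0) + Ω q y' by ring]
      refine (abs_add_le _ _).trans (add_le_add ?_ (b2.trans ?_))
      · rw [abs_le]; constructor <;> linarith [hq.1, hq.2]
      · exact mul_le_mul_of_nonneg_left hyY'.2 hC.le
    have b4 : |g (q + Ω q y')| ≤ |g (q + Ω q y') - g p0| + |g p0| := by
      have := abs_add_le (g (q + Ω q y') - g p0) (g p0)
      simpa using this
    rw [hB]; linarith
  have e2 : ∀ {p y : ℝ}, p ∈ Icc (p0 - ρ) (p0 + ρ) → y ∈ Icc 0 Y → |E p y| ≤ C :=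
    fun hp hy => by rw [abs_of_pos (h.E_pos _ hp _ hy)]; exact h.E_le _ hp _ hy
  have k2 := hkb _ (htm hy.1 hy1 hm.1 hm1)
  have hDn : 0 ≤ D := by rw [hD]; linarith
  unfold chartJ
  set G := g (p + Ω p y)
  set G' := g (q + Ω q y')
  set K := kap (ε ^ 2 * ((y ^ 2 - m ^ 2) / 2))
  set K' := kap (ε ^ 2 * ((y' ^ 2 - m' ^ 2) / 2))
  rw [show G * E p y * K - G' * E q y' * K' = (G - G') * E p y * K + G' * (E p y - E q y') * K +
    G' * E q y' * (K - K') by ring]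
  refine (abs_add_three _ _ _).trans ?_
  simp only [abs_mul]
  have t1 : |G - G'| * |E p y| * |K| ≤ ((1 + C) * D) * C * Ck := by
    gcongr; exact e2 hp hyY
  have t2 : |G'| * |E p y - E q y'| * |K| ≤ B * (C * D) * Ck := by gcongr
  have t3 : |G'| * |E q y'| * |K - K'| ≤ B * C * (Ck * D) := by gcongr; exact e2 hq hyY'
  linarith

lemma IsChart.continuousOn_Ω (h : IsChart f f1 p0 lam ρ Y C Ω E) {p : ℝ}
    (hp : p ∈ Icc (p0 - ρ) (p0 + ρ)) : ContinuousOn (Ω p) (Icc 0 Y) := by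
  have : LipschitzOnWith (Real.toNNReal C) (Ω p) (Icc 0 Y) := by
    refine LipschitzOnWith.of_dist_le_mul fun x hx y hy => ?_
    have := h.lip_Ω p hp p hp x hx y hy
    rw [sub_self, abs_zero, zero_add] at this
    rwa [Real.dist_eq, Real.dist_eq, Real.coe_toNNReal _ h.C_pos.le]
  exact this.continuousOn

lemma IsChart.strictMonoOn_Ω (h : IsChart f f1 p0 lam ρ Y C Ω E) {p : ℝ}
    (hp : p ∈ Icc (p0 - ρ) (p0 + ρ)) : StrictMonoOn (Ω p) (Icc 0 Y) := by
  refine strictMonoOn_of_deriv_pos (convex_Icc _ _) (h.continuousOn_Ω hp) fun y hy => ?_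
  rw [interior_Icc] at hy
  rw [(h.deriv p hp y hy).deriv]
  exact h.E_pos p hp y (Ioo_subset_Icc_self hy)

/-- The quadrature integral near one phase in hyperbolic coordinates. -/
lemma IsChart.quadrature (h : IsChart f f1 p0 lam ρ Y C Ω E) {p x ℓ : ℝ}
    (hp : p ∈ Icc (p0 - ρ) (p0 + ρ)) (hℓ : Real.exp (-ℓ) ≤ Y) (hx : ℓ ≤ x) (g : ℝ → ℝ) (ε : ℝ) :
    (IntervalIntegrable (fun w => g w * Kern ε (f w - f p - f1 p * (w - p) - Real.exp (-x) ^ 2 / 2))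
        MeasureTheory.volume (p + Ω p (Real.exp (-x)))
        (p + Ω p (Real.exp (-x) * Real.cosh (x - ℓ))) ↔
      IntervalIntegrable (fun s => chartJ g Ω E ε p (Real.exp (-x) * Real.cosh s) (Real.exp (-x)))
        MeasureTheory.volume 0 (x - ℓ)) ∧
    ∫ w in (p + Ω p (Real.exp (-x)))..(p + Ω p (Real.exp (-x) * Real.cosh (x - ℓ))),
        g w * Kern ε (f w - f p - f1 p * (w - p) - Real.exp (-x) ^ 2 / 2) =
      sideInt (chartJ g Ω E ε) ℓ p x := by
  set m := Real.exp (-x) with hm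
  have hmpos : 0 < m := Real.exp_pos _
  have hxl : 0 ≤ x - ℓ := by linarith
  have hys : ∀ s ∈ Icc 0 (x - ℓ), m * Real.cosh s ∈ Icc 0 Y := fun s hs =>
    ⟨(exp_mul_cosh_mem hs).1, (exp_mul_cosh_mem hs).2.trans hℓ⟩
  have hcm : StrictMonoOn (fun s => m * Real.cosh s) (Icc 0 (x - ℓ)) := by
    intro s hs t ht hst
    have := Real.cosh_lt_cosh.2 (show |s| < |t| by rwa [abs_of_nonneg hs.1, abs_of_nonneg ht.1])
    exact mul_lt_mul_of_pos_left this hmpos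
  have hcont : ContinuousOn (fun s => p + Ω p (m * Real.cosh s)) (Icc 0 (x - ℓ)) :=
    continuousOn_const.add ((h.continuousOn_Ω hp).comp (by fun_prop) hys)
  have hmono : StrictMonoOn (fun s => p + Ω p (m * Real.cosh s)) (Icc 0 (x - ℓ)) := by
    intro s hs t ht hst
    have := h.strictMonoOn_Ω hp (hys s hs) (hys t ht) (hcm hs ht hst)
    simpa using this
  have hyo : ∀ s ∈ Ioo 0 (x - ℓ), m * Real.cosh s ∈ Ioo 0 Y := fun s hs =>
    ⟨mul_pos hmpos (Real.cosh_pos s), (hcm (Ioo_subset_Icc_self hs) (right_mem_Icc.2 hxl) hs.2).trans_le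
      (hys _ (right_mem_Icc.2 hxl)).2⟩
  have hderiv : ∀ s ∈ Ioo 0 (x - ℓ), HasDerivAt (fun s => p + Ω p (m * Real.cosh s))
      (E p (m * Real.cosh s) * (m * Real.sinh s)) s := fun s hs =>
    ((h.deriv p hp _ (hyo s hs)).comp s ((Real.hasDerivAt_cosh s).const_mul m)).const_add p
  have key := integral_comp_of_strictMonoOn hxl hcont hmono hderiv
    (fun w => g w * Kern ε (f w - f p - f1 p * (w - p) - m ^ 2 / 2))
  -- The excess over the level is `(m sinh s)^2 / 2`, so the denominator of `Kern` equals the factor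
  -- `m sinh s` of the Jacobian. The singularity at the turning point `s = 0` disappears.
  have hEq : ∀ s ∈ Ioo 0 (x - ℓ), E p (m * Real.cosh s) * (m * Real.sinh s) *
      (g (p + Ω p (m * Real.cosh s)) * Kern ε (f (p + Ω p (m * Real.cosh s)) - f p -
        f1 p * (p + Ω p (m * Real.cosh s) - p) - m ^ 2 / 2)) =
      chartJ g Ω E ε p (m * Real.cosh s) m := by
    intro s hs
    have hsinh : 0 < Real.sinh s := Real.sinh_pos_iff.2 hs.1
    have h1 : f (p + Ω p (m * Real.cosh s)) - f p - f1 p * (p + Ω p (m * Real.cosh s) - p) - m ^ 2 / 2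
        = ((m * Real.cosh s) ^ 2 - m ^ 2) / 2 := by
      have := h.level p hp _ (hys s (Ioo_subset_Icc_self hs))
      rw [add_sub_cancel_left]; linarith
    have h2 : ((m * Real.cosh s) ^ 2 - m ^ 2) = (m * Real.sinh s) ^ 2 := by
      rw [mul_pow, Real.cosh_sq]; ring
    rw [h1, Kern_eq (by rw [h2]; positivity), chartJ, mul_div_cancel₀ _ two_ne_zero]
    nth_rewrite 2 [h2]
    rw [Real.sqrt_sq (by positivity)]
    field_simp
  simp only [Real.cosh_zero, mul_one] at key
  refine ⟨key.1.trans ?_, key.2.trans ?_⟩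
  · rw [intervalIntegrable_iff_integrableOn_Ioo_of_le hxl,
      intervalIntegrable_iff_integrableOn_Ioo_of_le hxl]
    exact MeasureTheory.integrableOn_congr_fun hEq measurableSet_Ioo
  · rw [sideInt, intervalIntegral.integral_of_le hxl, intervalIntegral.integral_of_le hxl,
      MeasureTheory.integral_Ioc_eq_integral_Ioo, MeasureTheory.integral_Ioc_eq_integral_Ioo]
    exact MeasureTheory.setIntegral_congr_fun measurableSet_Ioo hEq

end Chart

/-! ### The Gibbs function and the Maxwell point -/

namespace IsFreeEnergy

variable {F : ℝ → ℝ} {a b : ℝ}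

lemma contDiffOn_deriv (hF : IsFreeEnergy F a b) : ContDiffOn ℝ 4 (deriv F) (Ioi 0) :=
  hF.contDiffOn.deriv_of_isOpen isOpen_Ioi (by norm_num)

lemma contDiffOn_deriv2 (hF : IsFreeEnergy F a b) : ContDiffOn ℝ 3 (deriv (deriv F)) (Ioi 0) :=
  hF.contDiffOn_deriv.deriv_of_isOpen isOpen_Ioi (by norm_num)

lemma hasDerivAt (hF : IsFreeEnergy F a b) {z : ℝ} (hz : 0 < z) : HasDerivAt F (deriv F z) z :=
  ((hF.contDiffOn.contDiffAt (Ioi_mem_nhds hz)).differentiableAt (by norm_num)).hasDerivAt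

lemma hasDerivAt_deriv (hF : IsFreeEnergy F a b) {z : ℝ} (hz : 0 < z) :
    HasDerivAt (deriv F) (deriv (deriv F) z) z :=
  ((hF.contDiffOn_deriv.contDiffAt (Ioi_mem_nhds hz)).differentiableAt (by norm_num)).hasDerivAt

lemma continuousOn (hF : IsFreeEnergy F a b) : ContinuousOn F (Ioi 0) := hF.contDiffOn.continuousOn

lemma continuousOn_deriv (hF : IsFreeEnergy F a b) : ContinuousOn (deriv F) (Ioi 0) :=
  hF.contDiffOn_deriv.continuousOn

lemma pos_b (hF : IsFreeEnergy F a b) : 0 < b := hF.pos.trans hF.lt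

lemma mono_left (hF : IsFreeEnergy F a b) : StrictMonoOn (deriv F) (Ioc 0 a) := by
  refine strictMonoOn_of_deriv_pos (convex_Ioc _ _) (hF.continuousOn_deriv.mono fun z hz => hz.1) ?_
  rw [interior_Ioc]
  exact hF.convex_left

lemma anti_mid (hF : IsFreeEnergy F a b) : StrictAntiOn (deriv F) (Icc a b) := by
  refine strictAntiOn_of_deriv_neg (convex_Icc _ _)
    (hF.continuousOn_deriv.mono fun z hz => hF.pos.trans_le hz.1) ?_
  rw [interior_Icc]
  exact hF.concave_mid

lemma mono_right (hF : IsFreeEnergy F a b) : StrictMonoOn (deriv F) (Ici b) := by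
  refine strictMonoOn_of_deriv_pos (convex_Ici _)
    (hF.continuousOn_deriv.mono fun z hz => hF.pos_b.trans_le hz) ?_
  rw [interior_Ici]
  exact hF.convex_right

lemma deriv_b_lt (hF : IsFreeEnergy F a b) : deriv F b < deriv F a :=
  hF.anti_mid (left_mem_Icc.2 hF.lt.le) (right_mem_Icc.2 hF.lt.le) hF.lt

/-- The end values of `σ` are included because `exists_gap` applies the intermediate value theorem
between them. -/
lemma exists_left (hF : IsFreeEnergy F a b) {σ : ℝ} (hσ : σ ∈ Icc (deriv F b) (deriv F a)) :
    ∃ α ∈ Ioc 0 a, deriv F α = σ := by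
  obtain ⟨L, hL, hLb⟩ := hF.limit_zero
  have h1 : ∀ᶠ u in 𝓝[>] (0 : ℝ), ((deriv F u : ℝ) : EReal) < ((deriv F b : ℝ) : EReal) :=
    hL.eventually (Iio_mem_nhds hLb)
  have h2 : ∀ᶠ u in 𝓝[>] (0 : ℝ), u ∈ Ioo 0 a := Ioo_mem_nhdsGT hF.pos
  obtain ⟨u, hu1, hu2⟩ := (h1.and h2).exists
  rw [EReal.coe_lt_coe_iff] at hu1
  obtain ⟨α, hα, h⟩ := intermediate_value_Icc hu2.2.le
    (hF.continuousOn_deriv.mono fun z hz => hu2.1.trans_le hz.1) ⟨hu1.le.trans hσ.1, hσ.2⟩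
  exact ⟨α, ⟨hu2.1.trans_le hα.1, hα.2⟩, h⟩

lemma exists_right (hF : IsFreeEnergy F a b) {σ : ℝ} (hσ : σ ∈ Icc (deriv F b) (deriv F a)) :
    ∃ β ∈ Ici b, deriv F β = σ := by
  obtain ⟨L, hL, hLb⟩ := hF.limit_top
  have h1 : ∀ᶠ u in atTop, ((deriv F a : ℝ) : EReal) < ((deriv F u : ℝ) : EReal) :=
    hL.eventually (Ioi_mem_nhds hLb)
  obtain ⟨u, hu1, hu2⟩ := (h1.and (eventually_ge_atTop b)).exists
  rw [EReal.coe_lt_coe_iff] at hu1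
  obtain ⟨β, hβ, h⟩ := intermediate_value_Icc hu2
    (hF.continuousOn_deriv.mono fun z hz => hF.pos_b.trans_le hz.1) ⟨hσ.1, hσ.2.trans hu1.le⟩
  exact ⟨β, hβ.1, h⟩

lemma exists_mid (hF : IsFreeEnergy F a b) {σ : ℝ} (hσ : σ ∈ Ioo (deriv F b) (deriv F a)) :
    ∃ ζ ∈ Ioo a b, deriv F ζ = σ :=
  intermediate_value_Ioo' hF.lt.le
    (hF.continuousOn_deriv.mono fun _ hz => hF.pos.trans_le hz.1) hσ

lemma hasDerivAt_gibbs (hF : IsFreeEnergy F a b) (σ : ℝ) {z : ℝ} (hz : 0 < z) :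
    HasDerivAt (gibbs F σ) (deriv F z - σ) z := by
  have := (hF.hasDerivAt hz).sub ((hasDerivAt_id z).const_mul σ)
  rw [mul_one] at this
  exact this

lemma continuousOn_gibbs (hF : IsFreeEnergy F a b) (σ : ℝ) : ContinuousOn (gibbs F σ) (Ioi 0) :=
  fun _ hz => (hF.hasDerivAt_gibbs σ hz).continuousAt.continuousWithinAt

variable {σ α ζ β : ℝ}

lemma gibbs_anti_left (hF : IsFreeEnergy F a b) (hα : α ∈ Ioc 0 a) (h : deriv F α = σ) :
    StrictAntiOn (gibbs F σ) (Ioc 0 α) := by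
  refine strictAntiOn_of_deriv_neg (convex_Ioc _ _)
    ((hF.continuousOn_gibbs σ).mono fun z hz => hz.1) fun z hz => ?_
  rw [interior_Ioc] at hz
  rw [(hF.hasDerivAt_gibbs σ hz.1).deriv, sub_neg, ← h]
  exact hF.mono_left ⟨hz.1, hz.2.le.trans hα.2⟩ hα hz.2

lemma gibbs_mono_left_a (hF : IsFreeEnergy F a b) (hα : α ∈ Ioc 0 a) (h : deriv F α = σ) :
    StrictMonoOn (gibbs F σ) (Icc α a) := by
  refine strictMonoOn_of_deriv_pos (convex_Icc _ _)
    ((hF.continuousOn_gibbs σ).mono fun z hz => hα.1.trans_le hz.1) fun z hz => ?_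
  rw [interior_Icc] at hz
  rw [(hF.hasDerivAt_gibbs σ (hα.1.trans hz.1)).deriv, sub_pos, ← h]
  exact hF.mono_left hα ⟨hα.1.trans hz.1, hz.2.le⟩ hz.1

lemma gibbs_mono_left (hF : IsFreeEnergy F a b) (hα : α ∈ Ioc 0 a) (h : deriv F α = σ)
    (hζ : ζ ∈ Icc a b) (h' : deriv F ζ = σ) : StrictMonoOn (gibbs F σ) (Icc α ζ) := by
  refine strictMonoOn_of_deriv_pos (convex_Icc _ _)
    ((hF.continuousOn_gibbs σ).mono fun z hz => hα.1.trans_le hz.1) fun z hz => ?_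
  rw [interior_Icc] at hz
  rw [(hF.hasDerivAt_gibbs σ (hα.1.trans hz.1)).deriv, sub_pos]
  rcases le_total z a with hza | hza
  · rw [← h]
    exact hF.mono_left hα ⟨hα.1.trans hz.1, hza⟩ hz.1
  · rw [← h']
    exact hF.anti_mid ⟨hza, hz.2.le.trans hζ.2⟩ hζ hz.2

lemma gibbs_mono_right (hF : IsFreeEnergy F a b) (hβ : β ∈ Ici b) (h : deriv F β = σ) :
    StrictMonoOn (gibbs F σ) (Ici β) := by
  have hb := hF.pos_b
  refine strictMonoOn_of_deriv_pos (convex_Ici _)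
    ((hF.continuousOn_gibbs σ).mono fun z hz => hb.trans_le (le_trans hβ hz)) fun z hz => ?_
  rw [interior_Ici] at hz
  rw [(hF.hasDerivAt_gibbs σ (hb.trans_le (le_trans hβ (le_of_lt hz)))).deriv, sub_pos, ← h]
  exact hF.mono_right hβ (mem_Ici.2 ((mem_Ici.1 hβ).trans (mem_Ioi.1 hz).le)) hz

lemma gibbs_anti_right_b (hF : IsFreeEnergy F a b) (hβ : β ∈ Ici b) (h : deriv F β = σ) :
    StrictAntiOn (gibbs F σ) (Icc b β) := by
  have hb := hF.pos_b
  refine strictAntiOn_of_deriv_neg (convex_Icc _ _)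
    ((hF.continuousOn_gibbs σ).mono fun z hz => hb.trans_le hz.1) fun z hz => ?_
  rw [interior_Icc] at hz
  rw [(hF.hasDerivAt_gibbs σ (hb.trans hz.1)).deriv, sub_neg, ← h]
  exact hF.mono_right hz.1.le hβ hz.2

lemma gibbs_anti_right (hF : IsFreeEnergy F a b) (hζ : ζ ∈ Icc a b) (h' : deriv F ζ = σ)
    (hβ : β ∈ Ici b) (h : deriv F β = σ) : StrictAntiOn (gibbs F σ) (Icc ζ β) := by
  have hζ0 : 0 < ζ := hF.pos.trans_le hζ.1
  refine strictAntiOn_of_deriv_neg (convex_Icc _ _)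
    ((hF.continuousOn_gibbs σ).mono fun z hz => hζ0.trans_le hz.1) fun z hz => ?_
  rw [interior_Icc] at hz
  rw [(hF.hasDerivAt_gibbs σ (hζ0.trans hz.1)).deriv, sub_neg]
  rcases le_total z b with hzb | hzb
  · rw [← h']
    exact hF.anti_mid hζ ⟨hζ.1.trans hz.1.le, hzb⟩ hz.1
  · rw [← h]
    exact hF.mono_right hzb hβ hz.2

lemma gibbs_min_left (hF : IsFreeEnergy F a b) (hα : α ∈ Ioc 0 a) (h : deriv F α = σ) {z : ℝ}
    (hz : z ∈ Ioc 0 a) : gibbs F σ α ≤ gibbs F σ z := by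
  rcases le_total z α with hle | hle
  · exact (hF.gibbs_anti_left hα h).antitoneOn ⟨hz.1, hle⟩ ⟨hα.1, le_rfl⟩ hle
  · exact (hF.gibbs_mono_left_a hα h).monotoneOn ⟨le_rfl, hα.2⟩ ⟨hle, hz.2⟩ hle

lemma gibbs_min_right (hF : IsFreeEnergy F a b) (hβ : β ∈ Ici b) (h : deriv F β = σ) {z : ℝ}
    (hz : z ∈ Ici b) : gibbs F σ β ≤ gibbs F σ z := by
  rcases le_total z β with hle | hle
  · exact (hF.gibbs_anti_right_b hβ h).antitoneOn ⟨hz, hle⟩ ⟨hβ, le_rfl⟩ hle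
  · exact (hF.gibbs_mono_right hβ h).monotoneOn self_mem_Ici hle hle

variable {σ' α' β' : ℝ}

/-- Testing each minimum against the minimiser for the other multiplier gives a discrete form of the
envelope formula: the gap between the right and the left minimum has derivative `-(β - α)` in `σ`.
-/
lemma gap_le (hF : IsFreeEnergy F a b) (hα : α ∈ Ioc 0 a) (hασ : deriv F α = σ)
    (hβ : β ∈ Ici b) (hα' : α' ∈ Ioc 0 a) (hβ' : β' ∈ Ici b) (hβσ' : deriv F β' = σ') :
    gibbs F σ' β' - gibbs F σ' α' ≤ gibbs F σ β - gibbs F σ α - (σ' - σ) * (β - α') := by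
  have h1 := hF.gibbs_min_right hβ' hβσ' hβ
  have h2 := hF.gibbs_min_left hα hασ hα'
  unfold gibbs at *
  linarith

/-- The phases are at least `b - a` apart, so the gap decreases with slope at most `-(b - a)`. This
gives uniqueness of the Maxwell point and controls `σ` by the difference of the two depths. -/
lemma abs_sub_le_gap (hF : IsFreeEnergy F a b) (hα : α ∈ Ioc 0 a) (hασ : deriv F α = σ)
    (hβ : β ∈ Ici b) (hβσ : deriv F β = σ) (hα' : α' ∈ Ioc 0 a) (hασ' : deriv F α' = σ')
    (hβ' : β' ∈ Ici b) (hβσ' : deriv F β' = σ') :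
    |σ' - σ| * (b - a) ≤
      |(gibbs F σ' β' - gibbs F σ' α') - (gibbs F σ β - gibbs F σ α)| := by
  have h1 := hF.gap_le hα hασ hβ hα' hβ' hβσ'
  have h2 := hF.gap_le hα' hασ' hβ' hα hβ hβσ
  have hβb : b ≤ β := hβ
  have hβb' : b ≤ β' := hβ'
  rcases le_total σ σ' with h | h
  · rw [abs_of_nonneg (sub_nonneg.2 h), abs_sub_comm]
    refine le_trans ?_ (le_abs_self _)
    nlinarith [hα'.2]
  · rw [abs_of_nonpos (sub_nonpos.2 h)]
    refine le_trans ?_ (le_abs_self _)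
    nlinarith [hα.2]

/-- The difference of the two minima of the Gibbs function takes all values near `0`. -/
lemma exists_gap (hF : IsFreeEnergy F a b) : ∃ κ > 0, ∀ d : ℝ, |d| < κ →
    ∃ σ ∈ Ioo (deriv F b) (deriv F a), ∃ α ∈ Ioo 0 a, ∃ β ∈ Ioi b, deriv F α = σ ∧ deriv F β = σ ∧
      gibbs F σ β - gibbs F σ α = d := by
  choose! αf hαm hα using fun σ (hσ : σ ∈ Icc (deriv F b) (deriv F a)) => hF.exists_left hσ
  choose! βf hβm hβ using fun σ (hσ : σ ∈ Icc (deriv F b) (deriv F a)) => hF.exists_right hσ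
  have hlt := hF.deriv_b_lt
  set s1 := deriv F b with hs1
  set s2 := deriv F a with hs2
  have m1 : s1 ∈ Icc s1 s2 := left_mem_Icc.2 hlt.le
  have m2 : s2 ∈ Icc s1 s2 := right_mem_Icc.2 hlt.le
  set D : ℝ → ℝ := fun σ => gibbs F σ (βf σ) - gibbs F σ (αf σ) with hD
  have hβle : ∀ σ ∈ Icc s1 s2, βf σ ≤ βf s2 := by
    intro σ hσ
    rw [← hF.mono_right.le_iff_le (hβm σ hσ) (hβm s2 m2), hβ σ hσ, hβ s2 m2]
    exact hσ.2
  have key : ∀ σ ∈ Icc s1 s2, ∀ σ' ∈ Icc s1 s2, D σ' - D σ ≤ βf s2 * |σ' - σ| := by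
    intro σ hσ σ' hσ'
    have h1 := hF.gap_le (hαm σ hσ) (hα σ hσ) (hβm σ hσ) (hαm σ' hσ') (hβm σ' hσ') (hβ σ' hσ')
    have hb := hβle σ hσ
    have hb2 : b ≤ βf σ := hβm σ hσ
    have ha := hαm σ' hσ'
    have hab := hF.lt
    have h2 := neg_abs_le (σ' - σ)
    have h3 := abs_nonneg (σ' - σ)
    have h4 : -((σ' - σ) * (βf σ - αf σ')) ≤ |σ' - σ| * (βf σ - αf σ') := by
      have : 0 ≤ βf σ - αf σ' := by linarith [ha.2]
      nlinarith
    have h5 : |σ' - σ| * (βf σ - αf σ') ≤ |σ' - σ| * βf s2 := by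
      gcongr; linarith [ha.1]
    rw [hD]; simp only; linarith
  have hcont : ContinuousOn D (Icc s1 s2) := by
    have : LipschitzOnWith (Real.toNNReal (βf s2)) D (Icc s1 s2) := by
      refine LipschitzOnWith.of_dist_le_mul fun x hx y hy => ?_
      rw [Real.dist_eq, Real.dist_eq, Real.coe_toNNReal _ (hF.pos_b.le.trans (hβm s2 m2))]
      refine abs_le.2 ⟨?_, key y hy x hx⟩
      have := key x hx y hy
      rw [abs_sub_comm] at this
      linarith
    exact this.continuousOn
  -- At the end values of `σ` one phase merges with the middle critical point. For `σ = F'(a)` the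
  -- left phase is `a` and the Gibbs function decreases from there to the right phase; for `σ =
  -- F'(b)` the right phase is `b` and it increases up to there. The gap therefore has opposite
  -- signs at the two ends.
  have hα2 : αf s2 = a := hF.mono_left.injOn (hαm s2 m2) ⟨hF.pos, le_rfl⟩ (hα s2 m2)
  have hβ1 : βf s1 = b := hF.mono_right.injOn (hβm s1 m1) self_mem_Ici (hβ s1 m1)
  have hD2 : D s2 < 0 := by
    have hba : a < βf s2 := hF.lt.trans_le (hβm s2 m2)
    have := hF.gibbs_anti_right (left_mem_Icc.2 hF.lt.le) rfl (hβm s2 m2) (hβ s2 m2)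
      (left_mem_Icc.2 hba.le) (right_mem_Icc.2 hba.le) hba
    rw [hD]; simp only
    rw [hα2]; linarith
  have hD1 : 0 < D s1 := by
    have hba : αf s1 < b := (hαm s1 m1).2.trans_lt hF.lt
    have := hF.gibbs_mono_left (hαm s1 m1) (hα s1 m1) (right_mem_Icc.2 hF.lt.le) rfl
      (left_mem_Icc.2 hba.le) (right_mem_Icc.2 hba.le) hba
    rw [hD]; simp only
    rw [hβ1]; linarith
  refine ⟨min (-D s2) (D s1), lt_min (by linarith) hD1, fun d hd => ?_⟩
  have hd' := abs_lt.1 hd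
  have hd1 : D s2 < d := by linarith [hd'.1, min_le_left (-D s2) (D s1)]
  have hd2 : d < D s1 := hd'.2.trans_le (min_le_right _ _)
  obtain ⟨σ, hσ, hσd⟩ := intermediate_value_Ioo' hlt.le hcont ⟨hd1, hd2⟩
  have hσ' := Ioo_subset_Icc_self hσ
  refine ⟨σ, hσ, αf σ, ⟨(hαm σ hσ').1, ?_⟩, βf σ, ?_, hα σ hσ', hβ σ hσ', hσd⟩
  · rw [← hF.mono_left.lt_iff_lt (hαm σ hσ') ⟨hF.pos, le_rfl⟩, hα σ hσ']
    exact hσ.2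
  · rw [mem_Ioi, ← hF.mono_right.lt_iff_lt self_mem_Ici (hβm σ hσ'), hβ σ hσ']
    exact hσ.1

end IsFreeEnergy

lemma isMaxwellPoint_iff {F : ℝ → ℝ} {a b σ α β : ℝ} : IsMaxwellPoint F a b σ α β ↔
    α ∈ Ioo 0 a ∧ β ∈ Ioi b ∧ deriv F α = σ ∧ deriv F β = σ ∧ gibbs F σ β - gibbs F σ α = 0 := by
  constructor
  · rintro ⟨h1, h2, h3, h4, h5⟩
    refine ⟨h1, h2, h3, h4, ?_⟩
    unfold gibbs; linarith
  · rintro ⟨h1, h2, h3, h4, h5⟩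
    refine ⟨h1, h2, h3, h4, ?_⟩
    unfold gibbs at h5; linarith

/-- The equal area rule says that the gap between the two minima of the Gibbs function vanishes, and
the gap is continuous, strictly decreasing in `σ` and changes sign. -/
theorem existsUnique_isMaxwellPoint {F : ℝ → ℝ} {a b : ℝ} (hF : IsFreeEnergy F a b) :
    ∃! p : ℝ × ℝ × ℝ, IsMaxwellPoint F a b p.1 p.2.1 p.2.2 := by
  obtain ⟨κ, hκ, h⟩ := hF.exists_gap
  obtain ⟨σ, -, α, hα, β, hβ, h1, h2, h3⟩ := h 0 (by simpa using hκ)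
  refine ⟨(σ, α, β), isMaxwellPoint_iff.2 ⟨hα, hβ, h1, h2, h3⟩, ?_⟩
  rintro ⟨σ', α', β'⟩ hp
  obtain ⟨hα', hβ', h1', h2', h3'⟩ := isMaxwellPoint_iff.1 hp
  simp only at hα' hβ' h1' h2' h3'
  have mα := Ioo_subset_Ioc_self hα
  have mα' := Ioo_subset_Ioc_self hα'
  have mβ := Ioi_subset_Ici_self hβ
  have mβ' := Ioi_subset_Ici_self hβ'
  have hσ : σ' = σ := by
    have := hF.abs_sub_le_gap mα h1 mβ h2 mα' h1' mβ' h2'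
    rw [h3, h3', sub_self, abs_zero] at this
    have h0 : |σ' - σ| ≤ 0 := nonpos_of_mul_nonpos_left this (sub_pos.2 hF.lt)
    exact sub_eq_zero.1 (abs_nonpos_iff.1 h0)
  subst hσ
  have hαα : α' = α := hF.mono_left.injOn mα' mα (h1'.trans h1.symm)
  have hββ : β' = β := hF.mono_right.injOn mβ' mβ (h2'.trans h2.symm)
  rw [hαα, hββ]

namespace IsMaxwellPoint

variable {F : ℝ → ℝ} {a b σ₀ α₀ β₀ : ℝ}

lemma mem_Ioo (h : IsMaxwellPoint F a b σ₀ α₀ β₀) (hF : IsFreeEnergy F a b) :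
    σ₀ ∈ Ioo (deriv F b) (deriv F a) := by
  constructor
  · rw [← h.deriv_right]
    exact hF.mono_right self_mem_Ici (Ioi_subset_Ici_self h.right_mem) h.right_mem
  · rw [← h.deriv_left]
    exact hF.mono_left (Ioo_subset_Ioc_self h.left_mem) ⟨hF.pos, le_rfl⟩ h.left_mem.2

lemma gibbs_eq (h : IsMaxwellPoint F a b σ₀ α₀ β₀) : gibbs F σ₀ β₀ = gibbs F σ₀ α₀ := by
  have := (isMaxwellPoint_iff.1 h).2.2.2.2
  linarith

lemma lt (h : IsMaxwellPoint F a b σ₀ α₀ β₀) (hF : IsFreeEnergy F a b) : α₀ < β₀ :=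
  h.left_mem.2.trans (hF.lt.trans h.right_mem)

end IsMaxwellPoint

/-! ### Morse coordinates at the two phases -/

/-- Charts only describe displacements `ω ≥ 0`. A solution leaves the right phase to its left, so
the reflection lets the same chart construction serve both phases. -/
lemma LocalWell.neg {f f1 f2 : ℝ → ℝ} {p0 R l0 l1 M : ℝ} (h : LocalWell f f1 f2 p0 R l0 l1 M) :
    LocalWell (fun w => f (-w)) (fun w => -f1 (-w)) (fun w => f2 (-w)) (-p0) R l0 l1 M := by
  have hm : ∀ z ∈ Icc (-p0 - 2 * R) (-p0 + 2 * R), -z ∈ Icc (p0 - 2 * R) (p0 + 2 * R) :=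
    fun z hz => by constructor <;> linarith [hz.1, hz.2]
  refine ⟨h.R_pos, h.l0_pos, fun z hz => ?_, fun z hz => ?_, fun z hz => h.lower _ (hm z hz),
    fun z hz => h.upper _ (hm z hz), fun z hz w hw => ?_⟩
  · have := (h.deriv1 _ (hm z hz)).comp z (hasDerivAt_neg z)
    exact this.congr_deriv (by ring)
  · have := ((h.deriv2 _ (hm z hz)).comp z (hasDerivAt_neg z)).neg
    exact this.congr_deriv (by ring)
  · refine (h.lip _ (hm z hz) _ (hm w hw)).trans (le_of_eq ?_)
    rw [← abs_neg (z - w)]; congr 2; ring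

lemma IsFreeEnergy.exists_localWell {F : ℝ → ℝ} {a b p0 : ℝ} (hF : IsFreeEnergy F a b)
    (hp : 0 < p0) (h2 : 0 < deriv (deriv F) p0) :
    ∃ R l0 l1 M, LocalWell F (deriv F) (deriv (deriv F)) p0 R l0 l1 M := by
  have hc := hF.contDiffOn_deriv2
  have hca : ContinuousAt (deriv (deriv F)) p0 := (hc.contDiffAt (Ioi_mem_nhds hp)).continuousAt
  have hev : ∀ᶠ z in 𝓝 p0, deriv (deriv F) p0 / 2 < deriv (deriv F) z ∧ 0 < z :=
    (hca.eventually (Ioi_mem_nhds (by linarith))).and (Ioi_mem_nhds hp)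
  obtain ⟨r, hr, hball⟩ := Metric.eventually_nhds_iff.1 hev
  set I := Icc (p0 - 2 * (r / 4)) (p0 + 2 * (r / 4)) with hI
  have hIz : ∀ z ∈ I, deriv (deriv F) p0 / 2 < deriv (deriv F) z ∧ 0 < z := fun z hz => by
    refine hball ?_
    rw [Real.dist_eq, abs_lt]
    constructor <;> linarith [hz.1, hz.2]
  have hcI : ContDiffOn ℝ 3 (deriv (deriv F)) I := hc.mono fun z hz => (hIz z hz).2
  obtain ⟨K, hK⟩ := hcI.exists_lipschitzOnWith (by norm_num) (convex_Icc _ _) isCompact_Icc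
  obtain ⟨l1, hl1⟩ := isCompact_Icc.exists_bound_of_continuousOn hcI.continuousOn
  refine ⟨r / 4, deriv (deriv F) p0 / 2, l1, K, by positivity, by positivity,
    fun z hz => hF.hasDerivAt (hIz z hz).2, fun z hz => hF.hasDerivAt_deriv (hIz z hz).2,
    fun z hz => (hIz z hz).1.le, fun z hz => (le_abs_self _).trans (hl1 z hz), fun z hz w hw => ?_⟩
  simpa [Real.dist_eq] using hK.dist_le_mul z hz w hw

/-- Morse coordinates at the two phases, with common constants. -/
structure PhaseCharts (F : ℝ → ℝ) (a b α₀ β₀ ρ Y C : ℝ) (ΩL EL ΩR ER : ℝ → ℝ → ℝ) : Prop where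
  left : IsChart F (deriv F) α₀ (deriv (deriv F) α₀) ρ Y C ΩL EL
  right : IsChart (fun w => F (-w)) (fun w => -deriv F (-w)) (-β₀) (deriv (deriv F) β₀) ρ Y C ΩR ER
  pos : 0 < α₀ - ρ
  left_lt : α₀ + ρ + C * Y < a
  right_lt : b < β₀ - ρ - C * Y
  Y_le : Y ≤ 1

lemma exists_phaseCharts {F : ℝ → ℝ} {a b σ₀ α₀ β₀ : ℝ} (hF : IsFreeEnergy F a b)
    (hM : IsMaxwellPoint F a b σ₀ α₀ β₀) :
    ∃ ρ Y C ΩL EL ΩR ER, PhaseCharts F a b α₀ β₀ ρ Y C ΩL EL ΩR ER := by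
  obtain ⟨R1, l1, u1, M1, h1⟩ := hF.exists_localWell hM.left_mem.1 (hF.convex_left α₀ hM.left_mem)
  obtain ⟨R2, l2, u2, M2, h2⟩ := hF.exists_localWell (hF.pos_b.trans hM.right_mem)
    (hF.convex_right β₀ hM.right_mem)
  obtain ⟨ρ1, Y1, C1, ΩL, EL, c1⟩ := exists_chart h1
  obtain ⟨ρ2, Y2, C2, ΩR, ER, c2⟩ := exists_chart h2.neg
  rw [neg_neg] at c2
  set C := max C1 C2
  have hC : 0 < C := c1.C_pos.trans_le (le_max_left _ _)
  -- The room around the two phases inside the convex branches. The displacement `ρ` of a phase and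
  -- the range `C * Y` of its chart each use at most a third of it.
  set g := min (min α₀ (a - α₀)) (β₀ - b) with hg
  have hgpos : 0 < g := lt_min (lt_min hM.left_mem.1 (sub_pos.2 hM.left_mem.2)) (sub_pos.2 hM.right_mem)
  have g1 : g ≤ α₀ := (min_le_left _ _).trans (min_le_left _ _)
  have g2 : g ≤ a - α₀ := (min_le_left _ _).trans (min_le_right _ _)
  have g3 : g ≤ β₀ - b := min_le_right _ _
  set ρ := min (min ρ1 ρ2) (g / 3) with hρ
  set Y := min (min (min Y1 Y2) (g / (3 * C))) 1 with hY
  have hρpos : 0 < ρ := lt_min (lt_min c1.ρ_pos c2.ρ_pos) (by positivity)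
  have hYpos : 0 < Y := lt_min (lt_min (lt_min c1.Y_pos c2.Y_pos) (by positivity)) one_pos
  have r3 : ρ ≤ g / 3 := min_le_right _ _
  have y3 : Y ≤ g / (3 * C) := (min_le_left _ _).trans (min_le_right _ _)
  have y4 : C * Y ≤ g / 3 := by
    calc C * Y ≤ C * (g / (3 * C)) := by gcongr
      _ = g / 3 := by field_simp
  refine ⟨ρ, Y, C, ΩL, EL, ΩR, ER, c1.mono hρpos ((min_le_left _ _).trans (min_le_left _ _)) hYpos ?_
    (le_max_left _ _), c2.mono hρpos ((min_le_left _ _).trans (min_le_right _ _)) hYpos ?_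
    (le_max_right _ _), by linarith, by linarith, by linarith, min_le_right _ _⟩
  · exact (min_le_left _ _).trans ((min_le_left _ _).trans (min_le_left _ _))
  · exact (min_le_left _ _).trans ((min_le_left _ _).trans (min_le_right _ _))

/-! ### Pairs near the Maxwell point -/

/-- The pair `(σ, c)` near the Maxwell point has phases `α`, `β` and depths `exp (-2 x₁) / 2`,
`exp (-2 x₂) / 2` below the level `c`. -/
structure IsConfig (F : ℝ → ℝ) (α₀ β₀ d σ c α β x₁ x₂ : ℝ) : Prop where
  left_near : |α - α₀| ≤ d
  right_near : |β - β₀| ≤ d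
  deriv_left : deriv F α = σ
  deriv_right : deriv F β = σ
  level_left : c = gibbs F σ α + Real.exp (-x₁) ^ 2 / 2
  level_right : c = gibbs F σ β + Real.exp (-x₂) ^ 2 / 2

/-- The quadrature integral with weight `g`. -/
noncomputable def quadInt (F g : ℝ → ℝ) (ε σ c u v : ℝ) : ℝ :=
  ∫ z in u..v, g z * Kern ε (gibbs F σ z - c)

section Config

variable {F : ℝ → ℝ} {a b σ₀ α₀ β₀ ρ Y C : ℝ} {ΩL EL ΩR ER : ℝ → ℝ → ℝ}
  {d σ c α β x₁ x₂ ℓ : ℝ}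

lemma IsConfig.mono {d' : ℝ} (h : IsConfig F α₀ β₀ d σ c α β x₁ x₂) (hd : d ≤ d') :
    IsConfig F α₀ β₀ d' σ c α β x₁ x₂ :=
  ⟨h.left_near.trans hd, h.right_near.trans hd, h.deriv_left, h.deriv_right, h.level_left,
    h.level_right⟩

lemma mem_Icc_of_abs_sub_le {p p0 d ρ : ℝ} (h : |p - p0| ≤ d) (hd : d ≤ ρ) :
    p ∈ Icc (p0 - ρ) (p0 + ρ) := by
  have := abs_le.1 h
  constructor <;> linarith [this.1, this.2]

lemma IsChart.Ω_mem {f f1 : ℝ → ℝ} {p0 lam : ℝ} {Ω E : ℝ → ℝ → ℝ}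
    (h : IsChart f f1 p0 lam ρ Y C Ω E) {p y : ℝ} (hp : p ∈ Icc (p0 - ρ) (p0 + ρ))
    (hy : y ∈ Icc 0 Y) : Ω p y ∈ Icc 0 (C * Y) := by
  have h0 : (0 : ℝ) ∈ Icc 0 Y := left_mem_Icc.2 h.Y_pos.le
  constructor
  · rw [← h.Ω_zero p hp]
    exact (h.strictMonoOn_Ω hp).monotoneOn h0 hy hy.1
  · have := h.lip_Ω p hp p hp y hy 0 h0
    rw [h.Ω_zero p hp, sub_self, abs_zero, zero_add, sub_zero, sub_zero, abs_of_nonneg hy.1] at this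
    exact (le_abs_self _).trans (this.trans (mul_le_mul_of_nonneg_left hy.2 h.C_pos.le))

lemma exp_neg_mem {x ℓ Y : ℝ} (hℓ : Real.exp (-ℓ) ≤ Y) (hx : ℓ ≤ x) : Real.exp (-x) ∈ Icc 0 Y :=
  ⟨(Real.exp_pos _).le, (Real.exp_le_exp.2 (by linarith)).trans hℓ⟩

lemma exp_neg_mul_cosh_mem {x ℓ Y : ℝ} (hℓ : Real.exp (-ℓ) ≤ Y) (hx : ℓ ≤ x) :
    Real.exp (-x) * Real.cosh (x - ℓ) ∈ Icc 0 Y := by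
  have := exp_mul_cosh_mem (x := x) (ℓ := ℓ) (s := x - ℓ) (right_mem_Icc.2 (by linarith))
  exact ⟨this.1, this.2.trans hℓ⟩

/-- The end points of the left, middle and right pieces. -/
structure PieceBounds (F : ℝ → ℝ) (a b ℓ σ c α β u m n v : ℝ) : Prop where
  left_lt : α < u
  left_le : u ≤ m
  mid_left : m < a
  mid_right : b < n
  right_le : n ≤ v
  right_lt : v < β
  level_u : gibbs F σ u = c
  level_v : gibbs F σ v = c
  height_m : Real.exp (-ℓ) ^ 2 / 32 ≤ gibbs F σ m - c
  height_n : Real.exp (-ℓ) ^ 2 / 32 ≤ gibbs F σ n - c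

/-- If the hyperbolic range has length at least `1`, its inner end lies above the level by an amount
depending on `ℓ` only, not on the depth. This keeps the middle piece away from the singularity. -/
lemma exp_neg_mul_sinh_ge {x ℓ : ℝ} (hx : ℓ + 1 ≤ x) :
    Real.exp (-ℓ) / 4 ≤ Real.exp (-x) * Real.sinh (x - ℓ) := by
  have h1 : Real.exp (-x) * Real.sinh (x - ℓ) =
      Real.exp (-ℓ) * ((1 - Real.exp (-(2 * (x - ℓ)))) / 2) := by
    rw [Real.sinh_eq]
    have e1 : Real.exp (-x) * Real.exp (x - ℓ) = Real.exp (-ℓ) := by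
      rw [← Real.exp_add]; congr 1; ring
    have e2 : Real.exp (-x) * Real.exp (-(x - ℓ)) = Real.exp (-ℓ) * Real.exp (-(2 * (x - ℓ))) := by
      rw [← Real.exp_add, ← Real.exp_add]; congr 1; ring
    linear_combination e1 / 2 - e2 / 2
  have h2 : Real.exp (-(2 * (x - ℓ))) ≤ 1 / 2 := by
    have := Real.add_one_le_exp (2 * (x - ℓ))
    rw [Real.exp_neg, inv_le_comm₀ (Real.exp_pos _) (by norm_num)]
    linarith
  rw [h1]
  nlinarith [Real.exp_pos (-ℓ)]

lemma IsConfig.pieceBounds (h : IsConfig F α₀ β₀ d σ c α β x₁ x₂)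
    (hP : PhaseCharts F a b α₀ β₀ ρ Y C ΩL EL ΩR ER) (hd : d ≤ ρ) (hℓ : Real.exp (-ℓ) ≤ Y)
    (hx₁ : ℓ + 1 ≤ x₁) (hx₂ : ℓ + 1 ≤ x₂) :
    PieceBounds F a b ℓ σ c α β (α + ΩL α (Real.exp (-x₁)))
      (α + ΩL α (Real.exp (-x₁) * Real.cosh (x₁ - ℓ)))
      (β - ΩR (-β) (Real.exp (-x₂) * Real.cosh (x₂ - ℓ))) (β - ΩR (-β) (Real.exp (-x₂))) := by
  have hα := mem_Icc_of_abs_sub_le h.left_near hd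
  have hβ : -β ∈ Icc (-β₀ - ρ) (-β₀ + ρ) := by
    have := mem_Icc_of_abs_sub_le h.right_near hd
    constructor <;> linarith [this.1, this.2]
  have key : ∀ {x : ℝ}, ℓ + 1 ≤ x → Real.exp (-x) ∈ Icc 0 Y ∧
      Real.exp (-x) * Real.cosh (x - ℓ) ∈ Icc 0 Y ∧
      Real.exp (-x) ≤ Real.exp (-x) * Real.cosh (x - ℓ) ∧
      Real.exp (-ℓ) ^ 2 / 32 ≤ (Real.exp (-x) * Real.cosh (x - ℓ)) ^ 2 / 2 - Real.exp (-x) ^ 2 / 2 := by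
    intro x hx
    refine ⟨exp_neg_mem hℓ (by linarith), exp_neg_mul_cosh_mem hℓ (by linarith),
      le_mul_of_one_le_right (Real.exp_pos _).le (Real.one_le_cosh _), ?_⟩
    have h1 := exp_neg_mul_sinh_ge hx
    have h2 : (Real.exp (-x) * Real.cosh (x - ℓ)) ^ 2 / 2 - Real.exp (-x) ^ 2 / 2 =
        (Real.exp (-x) * Real.sinh (x - ℓ)) ^ 2 / 2 := by
      rw [mul_pow, Real.cosh_sq]; ring
    rw [h2]
    nlinarith [Real.exp_pos (-ℓ)]
  obtain ⟨a1, a2, a3, a4⟩ := key hx₁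
  obtain ⟨b1, b2, b3, b4⟩ := key hx₂
  have h0 : (0 : ℝ) ∈ Icc 0 Y := left_mem_Icc.2 hP.left.Y_pos.le
  have L1 := hP.left.level α hα _ a1
  have L2 := hP.left.level α hα _ a2
  have R1 := hP.right.level (-β) hβ _ b1
  have R2 := hP.right.level (-β) hβ _ b2
  have oL := (hP.left.Ω_mem hα a2).2
  have oR := (hP.right.Ω_mem hβ b2).2
  have pL : 0 < ΩL α (Real.exp (-x₁)) := by
    rw [← hP.left.Ω_zero α hα]
    exact hP.left.strictMonoOn_Ω hα h0 a1 (Real.exp_pos _)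
  have pR : 0 < ΩR (-β) (Real.exp (-x₂)) := by
    rw [← hP.right.Ω_zero (-β) hβ]
    exact hP.right.strictMonoOn_Ω hβ h0 b1 (Real.exp_pos _)
  have mL := (hP.left.strictMonoOn_Ω hα).monotoneOn a1 a2 a3
  have mR := (hP.right.strictMonoOn_Ω hβ).monotoneOn b1 b2 b3
  have hl := h.level_left
  have hr := h.level_right
  have g1 : ∀ y, -(-β + ΩR (-β) y) = β - ΩR (-β) y := fun y => by ring
  simp only [neg_neg, g1, h.deriv_right] at R1 R2
  simp only [h.deriv_left] at L1 L2
  refine ⟨by linarith, by linarith, ?_, ?_, by linarith, by linarith, ?_, ?_, ?_, ?_⟩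
  · linarith [hα.2, hP.left_lt]
  · linarith [hβ.2, hP.right_lt]
  · rw [hl]; unfold gibbs; linarith
  · rw [hr]; unfold gibbs; linarith
  · rw [hl]; unfold gibbs; linarith
  · rw [hr]; unfold gibbs; linarith

lemma IsConfig.left_mem (h : IsConfig F α₀ β₀ d σ c α β x₁ x₂)
    (hP : PhaseCharts F a b α₀ β₀ ρ Y C ΩL EL ΩR ER) (hd : d ≤ ρ) : α ∈ Ioo 0 a := by
  have hα := mem_Icc_of_abs_sub_le h.left_near hd
  have := hP.left_lt
  have := mul_pos hP.left.C_pos hP.left.Y_pos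
  exact ⟨by linarith [hα.1, hP.pos], by linarith [hα.2]⟩

lemma IsConfig.right_mem (h : IsConfig F α₀ β₀ d σ c α β x₁ x₂)
    (hP : PhaseCharts F a b α₀ β₀ ρ Y C ΩL EL ΩR ER) (hd : d ≤ ρ) : β ∈ Ioi b := by
  have hβ := mem_Icc_of_abs_sub_le h.right_near hd
  have := hP.right_lt
  have := mul_pos hP.left.C_pos hP.left.Y_pos
  exact mem_Ioi.2 (by linarith [hβ.1])

lemma IsConfig.mem_Ioo (h : IsConfig F α₀ β₀ d σ c α β x₁ x₂) (hF : IsFreeEnergy F a b)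
    (hP : PhaseCharts F a b α₀ β₀ ρ Y C ΩL EL ΩR ER) (hd : d ≤ ρ) :
    σ ∈ Ioo (deriv F b) (deriv F a) := by
  have h1 := h.left_mem hP hd
  have h2 := h.right_mem hP hd
  constructor
  · rw [← h.deriv_right]
    exact hF.mono_right self_mem_Ici (Ioi_subset_Ici_self h2) h2
  · rw [← h.deriv_left]
    exact hF.mono_left (Ioo_subset_Ioc_self h1) ⟨hF.pos, le_rfl⟩ h1.2

/-- Between the outer pieces the Gibbs function stays well above the level `c`. -/
lemma PieceBounds.height {u m n v : ℝ} (hB : PieceBounds F a b ℓ σ c α β u m n v)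
    (hF : IsFreeEnergy F a b) (hα : α ∈ Ioo 0 a) (hβ : β ∈ Ioi b) (hασ : deriv F α = σ)
    (hβσ : deriv F β = σ) (hσ : σ ∈ Ioo (deriv F b) (deriv F a)) {z : ℝ} (hz : z ∈ Icc m n) :
    Real.exp (-ℓ) ^ 2 / 32 ≤ gibbs F σ z - c := by
  obtain ⟨ζ, hζ, hζσ⟩ := hF.exists_mid hσ
  have hζ' := Ioo_subset_Icc_self hζ
  have h1 := hB.left_lt
  have h2 := hB.left_le
  have h3 := hB.mid_left
  have h4 := hB.mid_right
  have h5 := hB.right_le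
  have h6 := hB.right_lt
  rcases le_total z ζ with hle | hle
  · have := (hF.gibbs_mono_left (Ioo_subset_Ioc_self hα) hασ hζ' hζσ).monotoneOn
      ⟨by linarith, by linarith [hz.1]⟩ ⟨by linarith [hz.1], hle⟩ hz.1
    linarith [hB.height_m]
  · have := (hF.gibbs_anti_right hζ' hζσ (Ioi_subset_Ici_self hβ) hβσ).antitoneOn
      ⟨hle, by linarith [hz.2]⟩ ⟨by linarith [hz.2], by linarith⟩ hz.2
    linarith [hB.height_n]

/-- Splitting of the quadrature integral into the two outer pieces and the middle piece. -/
lemma IsConfig.quadInt_split (h : IsConfig F α₀ β₀ d σ c α β x₁ x₂) (hF : IsFreeEnergy F a b)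
    (hP : PhaseCharts F a b α₀ β₀ ρ Y C ΩL EL ΩR ER) (hd : d ≤ ρ) (hℓ : Real.exp (-ℓ) ≤ Y)
    (hx₁ : ℓ + 1 ≤ x₁) (hx₂ : ℓ + 1 ≤ x₂) {g : ℝ → ℝ} (hg : ∀ z w, |g z - g w| ≤ |z - w|) {ε : ℝ}
    (hε : ε ∈ Ioc (0 : ℝ) 1) (hεq : ∀ z ∈ Icc α β, ε ^ 2 * (gibbs F σ z - c) < 1) :
    IntervalIntegrable (fun z => g z * Kern ε (gibbs F σ z - c)) MeasureTheory.volume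
      (α + ΩL α (Real.exp (-x₁))) (β - ΩR (-β) (Real.exp (-x₂))) ∧
    quadInt F g ε σ c (α + ΩL α (Real.exp (-x₁))) (β - ΩR (-β) (Real.exp (-x₂))) =
      sideInt (chartJ g ΩL EL ε) ℓ α x₁ +
      quadInt F g ε σ c (α + ΩL α (Real.exp (-x₁) * Real.cosh (x₁ - ℓ)))
        (β - ΩR (-β) (Real.exp (-x₂) * Real.cosh (x₂ - ℓ))) +
      sideInt (chartJ (fun w => g (-w)) ΩR ER ε) ℓ (-β) x₂ := by
  have hα := mem_Icc_of_abs_sub_le h.left_near hd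
  have hβ : -β ∈ Icc (-β₀ - ρ) (-β₀ + ρ) := by
    have := mem_Icc_of_abs_sub_le h.right_near hd
    constructor <;> linarith [this.1, this.2]
  have hg' : ∀ z w, |g (-z) - g (-w)| ≤ |z - w| := fun z w => by
    refine (hg _ _).trans (le_of_eq ?_)
    rw [← abs_neg (z - w)]; congr 1; ring
  have hY1 : min Y 1 = Y := min_eq_left hP.Y_le
  obtain ⟨CL, hCL⟩ := exists_lip_chartJ hP.left hg
  obtain ⟨CR, hCR⟩ := exists_lip_chartJ hP.right hg'
  have iL := (hCL ε hε).intervalIntegrable (x := x₁) (hY1.symm ▸ hℓ) hα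
    (left_mem_Icc.2 (by linarith)) (right_mem_Icc.2 (by linarith))
  have iR := (hCR ε hε).intervalIntegrable (x := x₂) (hY1.symm ▸ hℓ) hβ
    (left_mem_Icc.2 (by linarith)) (right_mem_Icc.2 (by linarith))
  have qL := hP.left.quadrature hα hℓ (show ℓ ≤ x₁ by linarith) g ε
  have qR := hP.right.quadrature hβ hℓ (show ℓ ≤ x₂ by linarith) (fun w => g (-w)) ε
  have eL : ∀ w, F w - F α - deriv F α * (w - α) - Real.exp (-x₁) ^ 2 / 2 = gibbs F σ w - c := by
    intro w
    rw [h.level_left, h.deriv_left]; unfold gibbs; ring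
  have eR : ∀ w, F (-w) - F (- -β) - -deriv F (- -β) * (w - -β) - Real.exp (-x₂) ^ 2 / 2 =
      gibbs F σ (-w) - c := by
    intro w
    rw [h.level_right, neg_neg, h.deriv_right]; unfold gibbs; ring
  simp only [eL] at qL
  simp only [eR] at qR
  have hB := h.pieceBounds hP hd hℓ hx₁ hx₂
  have jL := qL.1.2 iL
  have jR := qR.1.2 iR
  rw [intervalIntegral.integral_comp_neg (fun z => g z * Kern ε (gibbs F σ z - c))] at qR
  have jR' : IntervalIntegrable (fun z => g z * Kern ε (gibbs F σ z - c)) MeasureTheory.volume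
      (β - ΩR (-β) (Real.exp (-x₂) * Real.cosh (x₂ - ℓ))) (β - ΩR (-β) (Real.exp (-x₂))) := by
    have := (IntervalIntegrable.iff_comp_neg enorm_ne_top).1 (IntervalIntegrable.symm jR)
    simpa [sub_eq_add_neg, add_comm] using this
  have g1 : ∀ y, -(-β + ΩR (-β) y) = β - ΩR (-β) y := fun y => by ring
  rw [g1, g1] at qR
  have hgc : Continuous g := by
    have : LipschitzWith 1 g := LipschitzWith.of_dist_le_mul fun x y => by
      simpa [Real.dist_eq] using hg x y
    exact this.continuous
  have ha := h.left_mem hP hd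
  have jM : IntervalIntegrable (fun z => g z * Kern ε (gibbs F σ z - c)) MeasureTheory.volume
      (α + ΩL α (Real.exp (-x₁) * Real.cosh (x₁ - ℓ)))
      (β - ΩR (-β) (Real.exp (-x₂) * Real.cosh (x₂ - ℓ))) := by
    refine ContinuousOn.intervalIntegrable ?_
    have h1 := hB.left_lt
    have h2 := hB.left_le
    have h3 := hB.mid_left
    have h4 := hB.mid_right
    have h5 := hB.right_le
    have h6 := hB.right_lt
    have h7 := hF.lt
    rw [uIcc_of_le (by linarith)]
    intro z hz
    have hz0 : 0 < z := by linarith [hz.1, ha.1]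
    have hpos := hB.height hF ha (h.right_mem hP hd) h.deriv_left h.deriv_right
      (h.mem_Ioo hF hP hd) hz
    have hpos' : 0 < gibbs F σ z - c := lt_of_lt_of_le (by positivity) hpos
    have hlt := hεq z ⟨by linarith [hz.1], by linarith [hz.2]⟩
    have hk : ContinuousAt (fun z => Kern ε (gibbs F σ z - c)) z :=
      ContinuousAt.comp (f := fun z => gibbs F σ z - c) (g := Kern ε) (continuousAt_Kern hpos' hlt)
        ((hF.hasDerivAt_gibbs σ hz0).continuousAt.sub continuousAt_const)
    exact (hgc.continuousAt.mul hk).continuousWithinAt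
  refine ⟨(jL.trans jM).trans jR', ?_⟩
  rw [quadInt, quadInt, ← qL.2, ← qR.2, intervalIntegral.integral_add_adjacent_intervals jL jM,
    intervalIntegral.integral_add_adjacent_intervals (jL.trans jM) jR']

end Config

/-! ### Asymptotics of the quadrature integrals -/

/-- The depth, as a function of `x`, has derivative `-exp (-2x)`. All data of a pair thus depend on
the logarithmic depths with an exponentially small Lipschitz constant, which later beats the factor
of order `1/ε` coming from the length of the integrals. -/
lemma abs_exp_neg_sq_sub_le {m x x' : ℝ} (hx : m ≤ x) (hx' : m ≤ x') :
    |Real.exp (-x) ^ 2 / 2 - Real.exp (-x') ^ 2 / 2| ≤ Real.exp (-m) ^ 2 * |x - x'| := by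
  have key : ∀ {x x' : ℝ}, m ≤ x → x ≤ x' →
      |Real.exp (-x) ^ 2 / 2 - Real.exp (-x') ^ 2 / 2| ≤ Real.exp (-m) ^ 2 * |x - x'| := by
    intro x x' hx hxx
    have h1 := exp_neg_sub_exp_neg_le (2 * x) (2 * x')
    have e : ∀ t : ℝ, Real.exp (-t) ^ 2 = Real.exp (-(2 * t)) := fun t => by
      rw [← Real.exp_nat_mul]; congr 1; push_cast; ring
    rw [e, e, e, abs_of_nonneg, abs_sub_comm, abs_of_nonneg (sub_nonneg.2 hxx)]
    · have h2 : Real.exp (-(2 * x)) ≤ Real.exp (-(2 * m)) := Real.exp_le_exp.2 (by linarith)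
      have := mul_le_mul_of_nonneg_right h2 (sub_nonneg.2 hxx)
      linarith
    · have : Real.exp (-(2 * x')) ≤ Real.exp (-(2 * x)) := Real.exp_le_exp.2 (by linarith)
      linarith
  rcases le_total x x' with h | h
  · exact key hx h
  · rw [abs_sub_comm, abs_sub_comm x]
    exact key hx' h

lemma exists_lipschitz_Kern {μ B : ℝ} (hμ : 0 < μ) : ∃ K : ℝ, 0 < K ∧
    ∀ ε ∈ Ioc (0 : ℝ) 1, ε ^ 2 * B ≤ 1 / 2 → ∀ q ∈ Icc μ B, ∀ q' ∈ Icc μ B,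
      |Kern ε q - Kern ε q'| ≤ K * |q - q'| ∧ |Kern ε q| ≤ K := by
  obtain ⟨Ck, hCk, hkl, hkb⟩ := exists_lipschitz_kap
  have hc : ContDiffOn ℝ 1 (fun q : ℝ => 1 / Real.sqrt (2 * q)) (Icc μ B) := fun q hq => by
    have h0 : 0 < 2 * q := by linarith [hq.1]
    exact (ContDiffAt.div contDiffAt_const (ContDiffAt.sqrt (by fun_prop) h0.ne')
      (Real.sqrt_pos.2 h0).ne').contDiffWithinAt
  obtain ⟨K1, hK1⟩ := hc.exists_lipschitzOnWith one_ne_zero (convex_Icc _ _) isCompact_Icc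
  set s := 1 / Real.sqrt (2 * μ) with hs
  have hspos : 0 < s := by have := Real.sqrt_pos.2 (show 0 < 2 * μ by linarith); positivity
  refine ⟨Ck * s + Ck * K1, by positivity, fun ε hε hεB q hq q' hq' => ?_⟩
  have hε2 : ε ^ 2 ≤ 1 := by nlinarith [hε.1, hε.2]
  have hm : ∀ {q}, q ∈ Icc μ B → ε ^ 2 * q ∈ Icc (-1 / 2 : ℝ) (1 / 2) := fun {q} hq => by
    have h1 : 0 ≤ ε ^ 2 * q := mul_nonneg (sq_nonneg _) (by linarith [hq.1])
    have h2 : ε ^ 2 * q ≤ ε ^ 2 * B := mul_le_mul_of_nonneg_left hq.2 (sq_nonneg _)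
    constructor <;> linarith
  have hb : ∀ {q}, q ∈ Icc μ B → |1 / Real.sqrt (2 * q)| ≤ s := fun {q} hq => by
    rw [abs_of_nonneg (by positivity)]
    exact one_div_le_one_div_of_le (Real.sqrt_pos.2 (by linarith)) (Real.sqrt_le_sqrt (by linarith [hq.1]))
  have h1 := hkl _ (hm hq) _ (hm hq')
  have h2 := hkb _ (hm hq)
  have h2' := hkb _ (hm hq')
  have h3 := hK1.dist_le_mul q hq q' hq'
  rw [Real.dist_eq, Real.dist_eq] at h3
  rw [Kern_eq (by linarith [hq.1]), Kern_eq (by linarith [hq'.1]), div_eq_mul_one_div,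
    div_eq_mul_one_div (kap (ε ^ 2 * q'))]
  rw [← mul_sub, abs_mul, abs_of_nonneg (sq_nonneg ε)] at h1
  have h1' : |kap (ε ^ 2 * q) - kap (ε ^ 2 * q')| ≤ Ck * |q - q'| :=
    h1.trans (mul_le_mul_of_nonneg_left (mul_le_of_le_one_left (abs_nonneg _) hε2) hCk.le)
  set A := kap (ε ^ 2 * q)
  set A' := kap (ε ^ 2 * q')
  set D := 1 / Real.sqrt (2 * q)
  set D' := 1 / Real.sqrt (2 * q')
  constructor
  · rw [show A * D - A' * D' = (A - A') * D + A' * (D - D') by ring]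
    refine (abs_add_le _ _).trans ?_
    rw [abs_mul, abs_mul]
    have t1 : |A - A'| * |D| ≤ Ck * |q - q'| * s := by gcongr; exact hb hq
    have t2 : |A'| * |D - D'| ≤ Ck * (K1 * |q - q'|) := by gcongr
    linarith
  · rw [abs_mul]
    have t1 : |A| * |D| ≤ Ck * s := by gcongr; exact hb hq
    have : 0 ≤ Ck * K1 := by positivity
    linarith

/-- Lipschitz dependence of an integral on its limits and integrand. -/
lemma abs_integral_sub_integral_le {h h' : ℝ → ℝ} {A B K D u v u' v' : ℝ}
    (hc : ContinuousOn h (Icc A B)) (hc' : ContinuousOn h' (Icc A B))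
    (hb : ∀ z ∈ Icc A B, |h z| ≤ K) (hd : ∀ z ∈ Icc A B, |h z - h' z| ≤ D)
    (hu : u ∈ Icc A B) (hv : v ∈ Icc A B) (hu' : u' ∈ Icc A B) (hv' : v' ∈ Icc A B) :
    |(∫ z in u..v, h z) - ∫ z in u'..v', h' z| ≤ K * (|u - u'| + |v - v'|) + D * (B - A) := by
  have hi : ∀ {p q}, p ∈ Icc A B → q ∈ Icc A B → IntervalIntegrable h MeasureTheory.volume p q :=
    fun hp hq => (hc.mono (uIcc_subset_Icc hp hq)).intervalIntegrable
  have hi' : ∀ {p q}, p ∈ Icc A B → q ∈ Icc A B → IntervalIntegrable h' MeasureTheory.volume p q :=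
    fun hp hq => (hc'.mono (uIcc_subset_Icc hp hq)).intervalIntegrable
  have hsub : ∀ {p q}, p ∈ Icc A B → q ∈ Icc A B → uIoc p q ⊆ Icc A B := fun hp hq =>
    uIoc_subset_uIcc.trans (uIcc_subset_Icc hp hq)
  have e : (∫ z in u..v, h z) - ∫ z in u'..v', h' z =
      (∫ z in u..u', h z) + (∫ z in v'..v, h z) + ∫ z in u'..v', (h z - h' z) := by
    rw [intervalIntegral.integral_sub (hi hu' hv') (hi' hu' hv'),
      ← intervalIntegral.integral_add_adjacent_intervals (hi hu hu') (hi hu' hv),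
      ← intervalIntegral.integral_add_adjacent_intervals (hi hu' hv') (hi hv' hv)]
    ring
  have b1 := intervalIntegral.norm_integral_le_of_norm_le_const (f := h) (C := K)
    (fun z hz => hb z (hsub hu hu' hz))
  have b2 := intervalIntegral.norm_integral_le_of_norm_le_const (f := h) (C := K)
    (fun z hz => hb z (hsub hv' hv hz))
  have b3 := intervalIntegral.norm_integral_le_of_norm_le_const (f := fun z => h z - h' z) (C := D)
    (fun z hz => hd z (hsub hu' hv' hz))
  rw [Real.norm_eq_abs] at b1 b2 b3
  have hD : 0 ≤ D := (abs_nonneg _).trans (hd u hu)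
  have b4 : |v' - u'| ≤ B - A := abs_le.2 ⟨by linarith [hu'.2, hv'.1], by linarith [hu'.1, hv'.2]⟩
  have b5 := mul_le_mul_of_nonneg_left b4 hD
  rw [e]
  refine (abs_add_three _ _ _).trans ?_
  rw [abs_sub_comm u u']
  linarith

section Config

variable {F : ℝ → ℝ} {a b σ₀ α₀ β₀ ρ Y C : ℝ} {ΩL EL ΩR ER : ℝ → ℝ → ℝ}
  {d σ c α β x₁ x₂ σ' c' α' β' x₁' x₂' ℓ m : ℝ}

lemma PhaseCharts.exists_bound (hP : PhaseCharts F a b α₀ β₀ ρ Y C ΩL EL ΩR ER)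
    (hF : IsFreeEnergy F a b) : ∃ B : ℝ, 1 ≤ B ∧ ∀ {σ c α β x₁ x₂ : ℝ},
      IsConfig F α₀ β₀ ρ σ c α β x₁ x₂ → 0 ≤ x₁ → ∀ z ∈ Icc (α₀ - ρ) (β₀ + ρ),
        |gibbs F σ z - c| ≤ B := by
  have hpos := hP.pos
  obtain ⟨BF, hBF⟩ := isCompact_Icc.exists_bound_of_continuousOn
    (hF.continuousOn.mono fun z (hz : z ∈ Icc (α₀ - ρ) (β₀ + ρ)) => hpos.trans_le hz.1)
  have hab := hF.lt
  have hρ := hP.left.ρ_pos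
  have hCY := mul_pos hP.left.C_pos hP.left.Y_pos
  have hl := hP.left_lt
  have hr := hP.right_lt
  have hBF0 : 0 ≤ BF := (norm_nonneg _).trans (hBF α₀ ⟨by linarith, by linarith⟩)
  have hβ0 : 0 < β₀ + ρ := by linarith
  refine ⟨2 * BF + (|deriv F b| + |deriv F a|) * (β₀ + ρ) + 1, ?_, ?_⟩
  · have : 0 ≤ (|deriv F b| + |deriv F a|) * (β₀ + ρ) := by positivity
    linarith
  intro σ c α β x₁ x₂ h hx z hz
  have hα := mem_Icc_of_abs_sub_le h.left_near le_rfl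
  have h1 := hBF z hz
  have h2 := hBF α ⟨hα.1, by linarith [hα.2]⟩
  rw [Real.norm_eq_abs] at h1 h2
  have hσ := h.mem_Ioo hF hP le_rfl
  have h3 : |σ| ≤ |deriv F b| + |deriv F a| := by
    rw [abs_le]
    constructor
    · linarith [hσ.1, neg_abs_le (deriv F b), abs_nonneg (deriv F a)]
    · linarith [hσ.2, le_abs_self (deriv F a), abs_nonneg (deriv F b)]
  have h4 : |z - α| ≤ β₀ + ρ := by
    rw [abs_le]; constructor <;> linarith [hz.1, hz.2, hα.1, hα.2]
  have h5 : |Real.exp (-x₁) ^ 2 / 2| ≤ 1 := by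
    have h6 : Real.exp (-x₁) ≤ 1 := Real.exp_le_one_iff.2 (by linarith)
    have h7 := Real.exp_pos (-x₁)
    rw [abs_of_nonneg (by positivity)]
    nlinarith
  rw [h.level_left, show gibbs F σ z - (gibbs F σ α + Real.exp (-x₁) ^ 2 / 2) =
    F z + (-F α) + (-(σ * (z - α))) + (-(Real.exp (-x₁) ^ 2 / 2)) by unfold gibbs; ring]
  refine (abs_add_le _ _).trans ((add_le_add_left (abs_add_three _ _ _) _).trans ?_)
  rw [abs_neg, abs_neg, abs_neg, abs_mul]
  have := mul_le_mul h3 h4 (abs_nonneg _) (by positivity)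
  linarith

/-- Lipschitz dependence of the data of a pair on the logarithmic depths. -/
lemma IsConfig.diff (h : IsConfig F α₀ β₀ d σ c α β x₁ x₂)
    (h' : IsConfig F α₀ β₀ d σ' c' α' β' x₁' x₂') (hF : IsFreeEnergy F a b)
    (hP : PhaseCharts F a b α₀ β₀ ρ Y C ΩL EL ΩR ER) (hd : d ≤ ρ)
    (h1 : m ≤ x₁) (h2 : m ≤ x₂) (h1' : m ≤ x₁') (h2' : m ≤ x₂') :
    |σ - σ'| ≤ 1 / (b - a) * (Real.exp (-m) ^ 2 * (|x₁ - x₁'| + |x₂ - x₂'|)) ∧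
    |α - α'| ≤ C / (b - a) * (Real.exp (-m) ^ 2 * (|x₁ - x₁'| + |x₂ - x₂'|)) ∧
    |β - β'| ≤ C / (b - a) * (Real.exp (-m) ^ 2 * (|x₁ - x₁'| + |x₂ - x₂'|)) ∧
    |c - c'| ≤ (1 + a / (b - a)) * (Real.exp (-m) ^ 2 * (|x₁ - x₁'| + |x₂ - x₂'|)) := by
  have hba : 0 < b - a := sub_pos.2 hF.lt
  have hC := hP.left.C_pos
  have hα := Ioo_subset_Ioc_self (h.left_mem hP hd)
  have hα' := Ioo_subset_Ioc_self (h'.left_mem hP hd)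
  have hβ := Ioi_subset_Ici_self (h.right_mem hP hd)
  have hβ' := Ioi_subset_Ici_self (h'.right_mem hP hd)
  have d1 := abs_exp_neg_sq_sub_le h1 h1'
  have d2 := abs_exp_neg_sq_sub_le h2 h2'
  -- The gap between the minima is the difference of the two depths. Hence the depths control `σ`,
  -- then `α` and `β` through the inverse Lipschitz bound for `F'`, and finally `c`.
  have g1 := hF.abs_sub_le_gap hα' h'.deriv_left hβ' h'.deriv_right hα h.deriv_left hβ h.deriv_right
  have e1 : gibbs F σ β - gibbs F σ α - (gibbs F σ' β' - gibbs F σ' α') =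
      (Real.exp (-x₁) ^ 2 / 2 - Real.exp (-x₁') ^ 2 / 2) -
        (Real.exp (-x₂) ^ 2 / 2 - Real.exp (-x₂') ^ 2 / 2) := by
    linarith [h.level_left, h.level_right, h'.level_left, h'.level_right]
  rw [e1] at g1
  set T := Real.exp (-m) ^ 2 * (|x₁ - x₁'| + |x₂ - x₂'|) with hT
  have g2 := g1.trans ((abs_sub _ _).trans (add_le_add d1 d2))
  rw [← mul_add, ← hT] at g2
  have s1 : |σ - σ'| ≤ 1 / (b - a) * T := by
    rw [one_div_mul_eq_div, le_div_iff₀ hba]; exact g2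
  have a1 : |α - α'| ≤ C / (b - a) * T := by
    have := hP.left.steep α (mem_Icc_of_abs_sub_le h.left_near hd) α'
      (mem_Icc_of_abs_sub_le h'.left_near hd)
    rw [h.deriv_left, h'.deriv_left] at this
    refine this.trans ((mul_le_mul_of_nonneg_left s1 hC.le).trans (le_of_eq ?_))
    ring
  have b1 : |β - β'| ≤ C / (b - a) * T := by
    have hm : ∀ {q}, |q - β₀| ≤ d → -q ∈ Icc (-β₀ - ρ) (-β₀ + ρ) := fun {q} hq => by
      have := mem_Icc_of_abs_sub_le hq hd
      constructor <;> linarith [this.1, this.2]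
    have := hP.right.steep (-β) (hm h.right_near) (-β') (hm h'.right_near)
    simp only [neg_neg, h.deriv_right, h'.deriv_right] at this
    rw [show -β - -β' = -(β - β') by ring, show -σ - -σ' = -(σ - σ') by ring, abs_neg, abs_neg] at this
    refine this.trans ((mul_le_mul_of_nonneg_left s1 hC.le).trans (le_of_eq ?_))
    ring
  have c1 : |gibbs F σ α - gibbs F σ' α'| ≤ |σ - σ'| * a := by
    have m1 := hF.gibbs_min_left hα h.deriv_left hα'
    have m2 := hF.gibbs_min_left hα' h'.deriv_left hα
    have n1 : gibbs F σ α' = gibbs F σ' α' - (σ - σ') * α' := by unfold gibbs; ring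
    have n2 : gibbs F σ' α = gibbs F σ α + (σ - σ') * α := by unfold gibbs; ring
    have n3 := neg_abs_le (σ - σ')
    have n4 := le_abs_self (σ - σ')
    have n5 := abs_nonneg (σ - σ')
    have k : ∀ {t}, t ∈ Ioc 0 a → |(σ - σ') * t| ≤ |σ - σ'| * a := fun {t} ht => by
      rw [abs_mul, abs_of_pos ht.1]; exact mul_le_mul_of_nonneg_left ht.2 n5
    have k1 := abs_le.1 (k hα)
    have k2 := abs_le.1 (k hα')
    rw [abs_le]
    constructor <;> linarith [k1.1, k1.2, k2.1, k2.2]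
  refine ⟨s1, a1, b1, ?_⟩
  have e2 : c - c' = (gibbs F σ α - gibbs F σ' α') +
      (Real.exp (-x₁) ^ 2 / 2 - Real.exp (-x₁') ^ 2 / 2) := by
    linarith [h.level_left, h'.level_left]
  have d3 : Real.exp (-m) ^ 2 * |x₁ - x₁'| ≤ T := by
    rw [hT]; gcongr; linarith [abs_nonneg (x₂ - x₂')]
  rw [e2]
  refine (abs_add_le _ _).trans ((add_le_add (c1.trans (mul_le_mul_of_nonneg_right s1 hF.pos.le))
    (d1.trans d3)).trans (le_of_eq ?_))
  field_simp
  ring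

/-- The inner end of the hyperbolic range is a fixed number plus a multiple of the depth, so cutting
at `s = x - ℓ` moves the limits of the middle piece only exponentially little. -/
lemma exp_neg_mul_cosh_sub (x ℓ : ℝ) :
    Real.exp (-x) * Real.cosh (x - ℓ) =
      Real.exp (-ℓ) / 2 + Real.exp ℓ * (Real.exp (-x) ^ 2 / 2) := by
  rw [Real.cosh_eq]
  have e1 : Real.exp (-x) * Real.exp (x - ℓ) = Real.exp (-ℓ) := by
    rw [← Real.exp_add]; congr 1; ring
  have e2 : Real.exp (-x) * Real.exp (-(x - ℓ)) = Real.exp ℓ * Real.exp (-x) ^ 2 := by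
    rw [sq, ← Real.exp_add, ← Real.exp_add, ← Real.exp_add]; congr 1; ring
  linear_combination e1 / 2 + e2 / 2

lemma IsChart.abs_end_sub_le {f f1 : ℝ → ℝ} {p0 lam : ℝ} {Ω E : ℝ → ℝ → ℝ} {p q x x' : ℝ}
    (h : IsChart f f1 p0 lam ρ Y C Ω E) (hp : p ∈ Icc (p0 - ρ) (p0 + ρ))
    (hq : q ∈ Icc (p0 - ρ) (p0 + ρ)) (hℓ : Real.exp (-ℓ) ≤ Y) (hm : ℓ ≤ m) (hx : m ≤ x) (hx' : m ≤ x') :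
    |(p + Ω p (Real.exp (-x) * Real.cosh (x - ℓ))) - (q + Ω q (Real.exp (-x') * Real.cosh (x' - ℓ)))|
      ≤ (1 + C) * |p - q| + C * Real.exp ℓ * (Real.exp (-m) ^ 2 * |x - x'|) := by
  have h1 := h.lip_Ω p hp q hq _ (exp_neg_mul_cosh_mem hℓ (hm.trans hx)) _
    (exp_neg_mul_cosh_mem hℓ (hm.trans hx'))
  have h2 : |Real.exp (-x) * Real.cosh (x - ℓ) - Real.exp (-x') * Real.cosh (x' - ℓ)| ≤
      Real.exp ℓ * (Real.exp (-m) ^ 2 * |x - x'|) := by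
    rw [exp_neg_mul_cosh_sub, exp_neg_mul_cosh_sub, add_sub_add_left_eq_sub, ← mul_sub, abs_mul,
      abs_of_pos (Real.exp_pos ℓ)]
    exact mul_le_mul_of_nonneg_left (abs_exp_neg_sq_sub_le hx hx') (Real.exp_pos _).le
  have h3 := mul_le_mul_of_nonneg_left h2 h.C_pos.le
  set y := Real.exp (-x) * Real.cosh (x - ℓ)
  set y' := Real.exp (-x') * Real.cosh (x' - ℓ)
  rw [show p + Ω p y - (q + Ω q y') = (p - q) + (Ω p y - Ω q y') by ring]
  refine (abs_add_le _ _).trans ?_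
  linarith

/-- The middle piece is bounded and depends Lipschitz continuously on the pair. -/
lemma PhaseCharts.exists_mid_bound (hP : PhaseCharts F a b α₀ β₀ ρ Y C ΩL EL ΩR ER)
    (hF : IsFreeEnergy F a b) {g : ℝ → ℝ} (hg : ∀ z w, |g z - g w| ≤ |z - w|)
    (hℓ0 : 0 ≤ ℓ) (hℓ : Real.exp (-ℓ) ≤ Y) :
    ∃ K ε₁ : ℝ, 0 ≤ K ∧ ε₁ ∈ Ioc (0 : ℝ) 1 ∧ ∀ ε ∈ Ioc 0 ε₁,
      (∀ {σ c α β x₁ x₂ : ℝ}, IsConfig F α₀ β₀ ρ σ c α β x₁ x₂ → ℓ + 1 ≤ x₁ → ℓ + 1 ≤ x₂ →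
        (∀ z ∈ Icc α β, ε ^ 2 * (gibbs F σ z - c) < 1) ∧
        |quadInt F g ε σ c (α + ΩL α (Real.exp (-x₁) * Real.cosh (x₁ - ℓ)))
          (β - ΩR (-β) (Real.exp (-x₂) * Real.cosh (x₂ - ℓ)))| ≤ K) ∧
      ∀ {m σ c α β x₁ x₂ σ' c' α' β' x₁' x₂' : ℝ}, IsConfig F α₀ β₀ ρ σ c α β x₁ x₂ →
        IsConfig F α₀ β₀ ρ σ' c' α' β' x₁' x₂' → ℓ + 1 ≤ m →
        m ≤ x₁ → m ≤ x₂ → m ≤ x₁' → m ≤ x₂' →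
        |quadInt F g ε σ c (α + ΩL α (Real.exp (-x₁) * Real.cosh (x₁ - ℓ)))
          (β - ΩR (-β) (Real.exp (-x₂) * Real.cosh (x₂ - ℓ))) -
        quadInt F g ε σ' c' (α' + ΩL α' (Real.exp (-x₁') * Real.cosh (x₁' - ℓ)))
          (β' - ΩR (-β') (Real.exp (-x₂') * Real.cosh (x₂' - ℓ)))| ≤
          K * (Real.exp (-m) ^ 2 * (|x₁ - x₁'| + |x₂ - x₂'|)) := by
  obtain ⟨B, hB1, hB⟩ := hP.exists_bound hF
  -- The first entry is the height of the Gibbs function above the level on the middle piece; the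
  -- minimum with `B` keeps `[μ, B]` nonempty. Truncating the height from below at `μ` changes
  -- nothing on the middle piece and makes the integrands of two different pairs comparable on one
  -- fixed interval.
  set μ := min (Real.exp (-ℓ) ^ 2 / 32) B with hμdef
  have hμ : 0 < μ := lt_min (by positivity) (by linarith)
  have hμB : μ ≤ B := min_le_right _ _
  obtain ⟨KK, hKK, hK⟩ := exists_lipschitz_Kern (B := B) hμ
  have hρ := hP.left.ρ_pos
  have hC := hP.left.C_pos
  have hCY := mul_pos hC hP.left.Y_pos
  have hpos := hP.pos
  have hl := hP.left_lt
  have hr := hP.right_lt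
  have hab := hF.lt
  have ha0 := hF.pos
  set AA := α₀ - ρ with hAA
  set BB := β₀ + ρ with hBB
  have hAB : AA ≤ BB := by linarith
  set G := |g AA| + (BB - AA) with hGdef
  have hG0 : 0 ≤ G := by have := abs_nonneg (g AA); linarith
  have hgG : ∀ z ∈ Icc AA BB, |g z| ≤ G := by
    intro z hz
    have h1 := hg z AA
    rw [abs_of_nonneg (sub_nonneg.2 hz.1)] at h1
    have h2 := abs_sub_abs_le_abs_sub (g z) (g AA)
    linarith [hz.2]
  have hgc : Continuous g := by
    have : LipschitzWith 1 g := LipschitzWith.of_dist_le_mul fun x y => by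
      simpa [Real.dist_eq] using hg x y
    exact this.continuous
  set K0 := 2 * ((1 + C) * (C / (b - a)) + C * Real.exp ℓ) with hK0
  set K2 := 1 / (b - a) * BB + (1 + a / (b - a)) with hK2
  have hba : 0 < b - a := by linarith
  have hBB0 : 0 < BB := by linarith
  have hK0p : 0 ≤ K0 := by positivity
  have hK2p : 0 ≤ K2 := by positivity
  -- Ensures `ε^2 * B ≤ 1/2`, so that `kap` is evaluated only where its Lipschitz bound holds.
  set ε₁ := min 1 (1 / (2 * B)) with hε₁
  have hε₁B : ∀ ε ∈ Ioc 0 ε₁, ε ∈ Ioc (0 : ℝ) 1 ∧ ε ^ 2 * B ≤ 1 / 2 := by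
    intro ε hε
    have h1 : ε ≤ 1 := hε.2.trans (min_le_left _ _)
    have h2 : ε ≤ 1 / (2 * B) := hε.2.trans (min_le_right _ _)
    refine ⟨⟨hε.1, h1⟩, ?_⟩
    have h3 : ε * B ≤ 1 / 2 := by
      calc ε * B ≤ 1 / (2 * B) * B := by gcongr
        _ = 1 / 2 := by field_simp
    have h4 : ε ^ 2 * B = ε * (ε * B) := by ring
    rw [h4]; nlinarith [hε.1]
  refine ⟨G * KK * (BB - AA) + (G * KK * K0 + G * KK * K2 * (BB - AA)), ε₁, ?_,
    ⟨lt_min one_pos (by positivity), min_le_left _ _⟩, ?_⟩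
  · have : 0 ≤ BB - AA := by linarith
    positivity
  intro ε hε
  obtain ⟨hε1, hεB⟩ := hε₁B ε hε
  -- the truncated integrand
  set H : ℝ → ℝ → ℝ → ℝ := fun σ c z => g z * Kern ε (max (gibbs F σ z - c) μ) with hH
  have hq : ∀ {σ c α β x₁ x₂ : ℝ}, IsConfig F α₀ β₀ ρ σ c α β x₁ x₂ → ℓ + 1 ≤ x₁ →
      ∀ z ∈ Icc AA BB, max (gibbs F σ z - c) μ ∈ Icc μ B := by
    intro σ c α β x₁ x₂ h hx z hz
    exact ⟨le_max_right _ _, max_le ((le_abs_self _).trans (hB h (by linarith) z hz)) hμB⟩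
  have hHc : ∀ {σ c α β x₁ x₂ : ℝ}, IsConfig F α₀ β₀ ρ σ c α β x₁ x₂ → ℓ + 1 ≤ x₁ →
      ContinuousOn (H σ c) (Icc AA BB) := by
    intro σ c α β x₁ x₂ h hx z hz
    have hz0 : 0 < z := hpos.trans_le hz.1
    have hqz := hq h hx z hz
    have h1 : ContinuousAt (fun z => max (gibbs F σ z - c) μ) z :=
      ((hF.hasDerivAt_gibbs σ hz0).continuousAt.sub continuousAt_const).max continuousAt_const
    have h2 : ContinuousAt (fun z => Kern ε (max (gibbs F σ z - c) μ)) z := by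
      refine ContinuousAt.comp (f := fun z => max (gibbs F σ z - c) μ) (g := Kern ε)
        (continuousAt_Kern (hμ.trans_le hqz.1) ?_) h1
      have := mul_le_mul_of_nonneg_left hqz.2 (sq_nonneg ε)
      linarith
    exact (hgc.continuousAt.mul h2).continuousWithinAt
  have hHb : ∀ {σ c α β x₁ x₂ : ℝ}, IsConfig F α₀ β₀ ρ σ c α β x₁ x₂ → ℓ + 1 ≤ x₁ →
      ∀ z ∈ Icc AA BB, |H σ c z| ≤ G * KK := by
    intro σ c α β x₁ x₂ h hx z hz
    rw [hH]; simp only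
    rw [abs_mul]
    exact mul_le_mul (hgG z hz) (hK ε hε1 hεB _ (hq h hx z hz) _ (hq h hx z hz)).2 (abs_nonneg _) hG0
  -- end points and truncation
  have hends : ∀ {σ c α β x₁ x₂ : ℝ}, IsConfig F α₀ β₀ ρ σ c α β x₁ x₂ → ℓ + 1 ≤ x₁ → ℓ + 1 ≤ x₂ →
      AA ≤ α ∧ β ≤ BB ∧
      (α + ΩL α (Real.exp (-x₁) * Real.cosh (x₁ - ℓ))) ∈ Icc AA BB ∧
      (β - ΩR (-β) (Real.exp (-x₂) * Real.cosh (x₂ - ℓ))) ∈ Icc AA BB ∧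
      quadInt F g ε σ c (α + ΩL α (Real.exp (-x₁) * Real.cosh (x₁ - ℓ)))
        (β - ΩR (-β) (Real.exp (-x₂) * Real.cosh (x₂ - ℓ))) =
      ∫ z in (α + ΩL α (Real.exp (-x₁) * Real.cosh (x₁ - ℓ)))..(β - ΩR (-β) (Real.exp (-x₂) *
        Real.cosh (x₂ - ℓ))), H σ c z := by
    intro σ c α β x₁ x₂ h hx₁ hx₂
    have hPB := h.pieceBounds hP le_rfl hℓ hx₁ hx₂
    have hα := mem_Icc_of_abs_sub_le h.left_near le_rfl
    have hβ := mem_Icc_of_abs_sub_le h.right_near le_rfl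
    have h1 := hPB.left_lt
    have h2 := hPB.left_le
    have h3 := hPB.mid_left
    have h4 := hPB.mid_right
    have h5 := hPB.right_le
    have h6 := hPB.right_lt
    refine ⟨hα.1, hβ.2, ⟨by linarith [hα.1], by linarith [hβ.2]⟩, ⟨by linarith [hα.1], by linarith [hβ.2]⟩, ?_⟩
    refine intervalIntegral.integral_congr fun z hz => ?_
    rw [uIcc_of_le (by linarith)] at hz
    have := hPB.height hF (h.left_mem hP le_rfl) (h.right_mem hP le_rfl) h.deriv_left h.deriv_right
      (h.mem_Ioo hF hP le_rfl) hz
    simp only [hH]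
    rw [max_eq_left ((min_le_left _ _).trans this)]
  refine ⟨?_, ?_⟩
  · intro σ c α β x₁ x₂ h hx₁ hx₂
    obtain ⟨e1, e2, e3, e4, e5⟩ := hends h hx₁ hx₂
    constructor
    · intro z hz
      have h1 := (le_abs_self _).trans (hB h (by linarith) z ⟨e1.trans hz.1, hz.2.trans e2⟩)
      have := mul_le_mul_of_nonneg_left h1 (sq_nonneg ε)
      linarith
    · rw [e5]
      have hle := intervalIntegral.norm_integral_le_of_norm_le_const (f := H σ c) (C := G * KK)
        (fun z hz => hHb h hx₁ z (uIoc_subset_uIcc.trans (uIcc_subset_Icc e3 e4) hz))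
      rw [Real.norm_eq_abs] at hle
      refine hle.trans ?_
      have h1 : |(β - ΩR (-β) (Real.exp (-x₂) * Real.cosh (x₂ - ℓ))) -
          (α + ΩL α (Real.exp (-x₁) * Real.cosh (x₁ - ℓ)))| ≤ BB - AA :=
        abs_le.2 ⟨by linarith [e3.2, e4.1], by linarith [e3.1, e4.2]⟩
      have h2 : 0 ≤ G * KK := by positivity
      have h3 := mul_le_mul_of_nonneg_left h1 h2
      have h4 : 0 ≤ G * KK * K0 + G * KK * K2 * (BB - AA) := by
        have : 0 ≤ BB - AA := by linarith
        positivity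
      linarith
  · intro m σ c α β x₁ x₂ σ' c' α' β' x₁' x₂' h h' hm h1 h2 h1' h2'
    obtain ⟨e1, e2, e3, e4, e5⟩ := hends h (hm.trans h1) (hm.trans h2)
    obtain ⟨e1', e2', e3', e4', e5'⟩ := hends h' (hm.trans h1') (hm.trans h2')
    rw [e5, e5']
    obtain ⟨dσ, dα, dβ, dc⟩ := h.diff h' hF hP le_rfl h1 h2 h1' h2'
    set T := Real.exp (-m) ^ 2 * (|x₁ - x₁'| + |x₂ - x₂'|) with hT
    have hT0 : 0 ≤ T := by positivity
    have hmL : ∀ {q}, |q - α₀| ≤ ρ → q ∈ Icc (α₀ - ρ) (α₀ + ρ) := fun hq =>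
      mem_Icc_of_abs_sub_le hq le_rfl
    have hmR : ∀ {q}, |q - β₀| ≤ ρ → -q ∈ Icc (-β₀ - ρ) (-β₀ + ρ) := fun {q} hq => by
      have := mem_Icc_of_abs_sub_le hq le_rfl
      constructor <;> linarith [this.1, this.2]
    have t1 : Real.exp (-m) ^ 2 * |x₁ - x₁'| ≤ T := by
      rw [hT]; gcongr; linarith [abs_nonneg (x₂ - x₂')]
    have t2 : Real.exp (-m) ^ 2 * |x₂ - x₂'| ≤ T := by
      rw [hT]; gcongr; linarith [abs_nonneg (x₁ - x₁')]
    have hCe : 0 ≤ C * Real.exp ℓ := by positivity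
    have u1 := hP.left.abs_end_sub_le (hmL h.left_near) (hmL h'.left_near) hℓ (by linarith) h1 h1'
    have u2 := hP.right.abs_end_sub_le (hmR h.right_near) (hmR h'.right_near) hℓ (by linarith) h2 h2'
    have u1' := u1.trans (add_le_add (mul_le_mul_of_nonneg_left dα (by linarith : 0 ≤ 1 + C))
      (mul_le_mul_of_nonneg_left t1 hCe))
    rw [show -β - -β' = -(β - β') by ring, abs_neg] at u2
    have u2' := u2.trans (add_le_add (mul_le_mul_of_nonneg_left dβ (by linarith : 0 ≤ 1 + C))
      (mul_le_mul_of_nonneg_left t2 hCe))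
    have hD : ∀ z ∈ Icc AA BB, |H σ c z - H σ' c' z| ≤ G * KK * K2 * T := by
      intro z hz
      simp only [hH]
      rw [← mul_sub, abs_mul]
      have k1 := (hK ε hε1 hεB _ (hq h (hm.trans h1) z hz) _ (hq h' (hm.trans h1') z hz)).1
      have k2 : |max (gibbs F σ z - c) μ - max (gibbs F σ' z - c') μ| ≤ K2 * T := by
        refine (abs_max_sub_max_le_abs _ _ _).trans ?_
        rw [show gibbs F σ z - c - (gibbs F σ' z - c') = -((σ - σ') * z) + -(c - c') by
          unfold gibbs; ring]
        refine (abs_add_le _ _).trans ?_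
        rw [abs_neg, abs_neg, abs_mul, abs_of_pos (hpos.trans_le hz.1)]
        have : |σ - σ'| * z ≤ (1 / (b - a) * T) * BB :=
          mul_le_mul dσ hz.2 (hpos.trans_le hz.1).le (by positivity)
        rw [hK2]
        linarith
      calc |g z| * |Kern ε (max (gibbs F σ z - c) μ) - Kern ε (max (gibbs F σ' z - c') μ)|
          ≤ G * (KK * (K2 * T)) := by
            refine mul_le_mul (hgG z hz) (k1.trans (mul_le_mul_of_nonneg_left k2 hKK.le))
              (abs_nonneg _) hG0
        _ = G * KK * K2 * T := by ring
    have key := abs_integral_sub_integral_le (hHc h (hm.trans h1)) (hHc h' (hm.trans h1'))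
      (hHb h (hm.trans h1)) hD e3 e4 e3' e4'
    refine key.trans ?_
    have hGK : 0 ≤ G * KK := by positivity
    set y2 := ΩR (-β) (Real.exp (-x₂) * Real.cosh (x₂ - ℓ))
    set y2' := ΩR (-β') (Real.exp (-x₂') * Real.cosh (x₂' - ℓ))
    rw [show -β + y2 - (-β' + y2') = -((β - y2) - (β' - y2')) by ring, abs_neg] at u2'
    have k3 := mul_le_mul_of_nonneg_left (add_le_add u1' u2') hGK
    refine (add_le_add_left k3 _).trans ?_
    have k4 : 0 ≤ G * KK * (BB - AA) * T := by
      have : 0 ≤ BB - AA := by linarith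
      positivity
    rw [hK0]
    linarith

end Config

/-- The quadrature integral over the whole range of a solution. -/
noncomputable def configInt (F g : ℝ → ℝ) (ΩL ΩR : ℝ → ℝ → ℝ) (ε σ c α β x₁ x₂ : ℝ) : ℝ :=
  quadInt F g ε σ c (α + ΩL α (Real.exp (-x₁))) (β - ΩR (-β) (Real.exp (-x₂)))

/-- First-order asymptotics of the quadrature integrals in the logarithmic depths, pointwise and
for differences. -/
structure IsAsymptotic (F g : ℝ → ℝ) (α₀ β₀ : ℝ) (ΩL ΩR : ℝ → ℝ → ℝ) (kL kR d K X₀ θ ε : ℝ) :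
    Prop where
  small : ∀ {σ c α β x₁ x₂ : ℝ}, IsConfig F α₀ β₀ d σ c α β x₁ x₂ → X₀ ≤ x₁ → X₀ ≤ x₂ →
    ∀ z ∈ Icc α β, ε ^ 2 * (gibbs F σ z - c) < 1
  integrable : ∀ {σ c α β x₁ x₂ : ℝ}, IsConfig F α₀ β₀ d σ c α β x₁ x₂ → X₀ ≤ x₁ → X₀ ≤ x₂ →
    IntervalIntegrable (fun z => g z * Kern ε (gibbs F σ z - c)) MeasureTheory.volume
      (α + ΩL α (Real.exp (-x₁))) (β - ΩR (-β) (Real.exp (-x₂)))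
  approx : ∀ {σ c α β x₁ x₂ : ℝ}, IsConfig F α₀ β₀ d σ c α β x₁ x₂ → X₀ ≤ x₁ → X₀ ≤ x₂ →
    |configInt F g ΩL ΩR ε σ c α β x₁ x₂ - (kL * x₁ + kR * x₂)| ≤ K + θ * (x₁ + x₂)
  diff : ∀ {m X σ c α β x₁ x₂ σ' c' α' β' x₁' x₂' : ℝ}, IsConfig F α₀ β₀ d σ c α β x₁ x₂ →
    IsConfig F α₀ β₀ d σ' c' α' β' x₁' x₂' → X₀ ≤ m →
    x₁ ∈ Icc m X → x₂ ∈ Icc m X → x₁' ∈ Icc m X → x₂' ∈ Icc m X →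
    |configInt F g ΩL ΩR ε σ c α β x₁ x₂ - configInt F g ΩL ΩR ε σ' c' α' β' x₁' x₂' -
      (kL * (x₁ - x₁') + kR * (x₂ - x₂'))| ≤
      (θ + K * (1 + X) * Real.exp (-m) ^ 2) * (|x₁ - x₁'| + |x₂ - x₂'|)

lemma IsAsymptotic.mono {F g : ℝ → ℝ} {α₀ β₀ : ℝ} {ΩL ΩR : ℝ → ℝ → ℝ}
    {kL kR d K X₀ θ ε d' K' X₀' : ℝ} (h : IsAsymptotic F g α₀ β₀ ΩL ΩR kL kR d K X₀ θ ε)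
    (hd : d' ≤ d) (hK : K ≤ K') (hX : X₀ ≤ X₀') (hX0 : 0 ≤ X₀) :
    IsAsymptotic F g α₀ β₀ ΩL ΩR kL kR d' K' X₀' θ ε := by
  refine ⟨fun hc h1 h2 => h.small (hc.mono hd) (hX.trans h1) (hX.trans h2),
    fun hc h1 h2 => h.integrable (hc.mono hd) (hX.trans h1) (hX.trans h2),
    fun hc h1 h2 => (h.approx (hc.mono hd) (hX.trans h1) (hX.trans h2)).trans (by linarith), ?_⟩
  intro m X σ c α β x₁ x₂ σ' c' α' β' x₁' x₂' hc hc' hm h1 h2 h1' h2'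
  refine (h.diff (hc.mono hd) (hc'.mono hd) (hX.trans hm) h1 h2 h1' h2').trans ?_
  have : 0 ≤ 1 + X := by linarith [h1.1.trans h1.2]
  gcongr

section Config

variable {F : ℝ → ℝ} {a b σ₀ α₀ β₀ ρ Y C : ℝ} {ΩL EL ΩR ER : ℝ → ℝ → ℝ}

/-- The two outer pieces supply the linear terms and the middle piece is bounded. The slope error
`θ` can be prescribed: it is made small by restricting to phases near `α₀`, `β₀` and by cutting the
charts off close to them. The other difference terms carry the factor `exp (-m)^2`. -/
lemma PhaseCharts.exists_isAsymptotic (hP : PhaseCharts F a b α₀ β₀ ρ Y C ΩL EL ΩR ER)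
    (hF : IsFreeEnergy F a b) {g : ℝ → ℝ} (hg : ∀ z w, |g z - g w| ≤ |z - w|) {θ : ℝ} (hθ : 0 < θ) :
    ∃ d K X₀ ε₁ : ℝ, 0 < d ∧ d ≤ ρ ∧ 0 ≤ K ∧ 0 ≤ X₀ ∧ ε₁ ∈ Ioc (0 : ℝ) 1 ∧ ∀ ε ∈ Ioc 0 ε₁,
      IsAsymptotic F g α₀ β₀ ΩL ΩR (g α₀ / Real.sqrt (deriv (deriv F) α₀))
        (g β₀ / Real.sqrt (deriv (deriv F) β₀)) d K X₀ θ ε := by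
  have hρ := hP.left.ρ_pos
  have hY := hP.left.Y_pos
  have hC := hP.left.C_pos
  have hba : 0 < b - a := sub_pos.2 hF.lt
  have hg' : ∀ z w, |g (-z) - g (-w)| ≤ |z - w| := fun z w => by
    refine (hg _ _).trans (le_of_eq ?_)
    rw [← abs_neg (z - w)]; congr 1; ring
  obtain ⟨CL, hCL⟩ := exists_lip_chartJ hP.left hg
  obtain ⟨CR, hCR⟩ := exists_lip_chartJ hP.right hg'
  rw [min_eq_left hP.Y_le] at hCL hCR
  have hCL0 : 0 ≤ CL := (hCL 1 ⟨one_pos, le_rfl⟩).nonneg hρ hY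
  have hCR0 : 0 ≤ CR := (hCR 1 ⟨one_pos, le_rfl⟩).nonneg hρ hY
  set CC := CL + CR + 1 with hCC
  have hCC0 : 0 < CC := by positivity
  -- With this `d` and `y0` below, `CC * d` and `CC * 3 * exp (-ℓ)` are at most `θ / 4` each, so
  -- that each phase contributes at most `θ / 2` to the slope error.
  set d := min ρ (θ / (4 * CC)) with hd
  have hd0 : 0 < d := lt_min hρ (by positivity)
  have hdρ : d ≤ ρ := min_le_left _ _
  set y0 := min Y (θ / (12 * CC)) with hy0
  have hy00 : 0 < y0 := lt_min hY (by positivity)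
  set ℓ := max 0 (-Real.log y0) with hℓ
  have hℓ0 : 0 ≤ ℓ := le_max_left _ _
  have hℓy : Real.exp (-ℓ) ≤ y0 := by
    rw [← Real.exp_log hy00]
    exact Real.exp_le_exp.2 (by linarith [le_max_right 0 (-Real.log y0)])
  have hℓY : Real.exp (-ℓ) ≤ Y := hℓy.trans (min_le_left _ _)
  have hsm : CC * (d + 3 * Real.exp (-ℓ)) ≤ θ / 2 := by
    have h1 : d ≤ θ / (4 * CC) := min_le_right _ _
    have h2 : Real.exp (-ℓ) ≤ θ / (12 * CC) := hℓy.trans (min_le_right _ _)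
    calc CC * (d + 3 * Real.exp (-ℓ)) ≤ CC * (θ / (4 * CC) + 3 * (θ / (12 * CC))) := by gcongr
      _ = θ / 2 := by field_simp; norm_num
  have hCCd : CC * d ≤ θ := by
    have := mul_pos hCC0 (Real.exp_pos (-ℓ))
    linarith
  obtain ⟨Km, ε₁, hKm, hε₁, hmid⟩ := hP.exists_mid_bound hF hg hℓ0 hℓY
  set kL := g α₀ / Real.sqrt (deriv (deriv F) α₀) with hkL
  set kR := g β₀ / Real.sqrt (deriv (deriv F) β₀) with hkR
  set K := (2 * CL + |kL| * ℓ) + (2 * CR + |kR| * ℓ) + Km + (CL + CR) * (C / (b - a)) with hK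
  have hCb : 0 ≤ (CL + CR) * (C / (b - a)) := by positivity
  refine ⟨d, K, ℓ + 1, ε₁, hd0, hdρ, by positivity, by positivity, hε₁, fun ε hε => ?_⟩
  have hε1 : ε ∈ Ioc (0 : ℝ) 1 := ⟨hε.1, hε.2.trans hε₁.2⟩
  obtain ⟨hm1, hm2⟩ := hmid ε hε
  have bL : chartJ g ΩL EL ε α₀ 0 0 = kL := chartJ_base hP.left g ε
  have bR : chartJ (fun w => g (-w)) ΩR ER ε (-β₀) 0 0 = kR := by
    rw [chartJ_base hP.right]; simp only [neg_neg, hkR]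
  have hsplit : ∀ {σ c α β x₁ x₂ : ℝ}, IsConfig F α₀ β₀ d σ c α β x₁ x₂ → ℓ + 1 ≤ x₁ → ℓ + 1 ≤ x₂ → _ :=
    fun {σ c α β x₁ x₂} h h1 h2 => h.quadInt_split hF hP hdρ hℓY h1 h2 hg hε1
      (hm1 (h.mono hdρ) h1 h2).1
  refine ⟨fun h h1 h2 => (hm1 (h.mono hdρ) h1 h2).1, fun h h1 h2 => (hsplit h h1 h2).1, ?_, ?_⟩
  · intro σ c α β x₁ x₂ h h1 h2
    rw [configInt, (hsplit h h1 h2).2]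
    have hα := mem_Icc_of_abs_sub_le h.left_near hdρ
    have hβ : -β ∈ Icc (-β₀ - ρ) (-β₀ + ρ) := by
      have := mem_Icc_of_abs_sub_le h.right_near hdρ
      constructor <;> linarith [this.1, this.2]
    have e1 := (hCL ε hε1).sideInt_approx hρ hY hℓ0 hℓY hα (show ℓ ≤ x₁ by linarith)
    have e2 := (hCR ε hε1).sideInt_approx hρ hY hℓ0 hℓY hβ (show ℓ ≤ x₂ by linarith)
    have e3 := (hm1 (h.mono hdρ) h1 h2).2
    rw [bL] at e1
    rw [bR, show -β - -β₀ = -(β - β₀) by ring, abs_neg] at e2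
    set I1 := sideInt (chartJ g ΩL EL ε) ℓ α x₁
    set I2 := sideInt (chartJ (fun w => g (-w)) ΩR ER ε) ℓ (-β) x₂
    set I3 := quadInt F g ε σ c (α + ΩL α (Real.exp (-x₁) * Real.cosh (x₁ - ℓ)))
        (β - ΩR (-β) (Real.exp (-x₂) * Real.cosh (x₂ - ℓ)))
    rw [show I1 + I3 + I2 - (kL * x₁ + kR * x₂) = (I1 - kL * x₁) + (I2 - kR * x₂) + I3 by ring]
    refine (abs_add_three _ _ _).trans ?_
    have f1 : CL * |α - α₀| * x₁ ≤ θ * x₁ := by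
      refine mul_le_mul_of_nonneg_right ?_ (by linarith)
      refine le_trans ?_ hCCd
      exact mul_le_mul (by linarith) h.left_near (abs_nonneg _) hCC0.le
    have f2 : CR * |β - β₀| * x₂ ≤ θ * x₂ := by
      refine mul_le_mul_of_nonneg_right ?_ (by linarith)
      refine le_trans ?_ hCCd
      exact mul_le_mul (by linarith) h.right_near (abs_nonneg _) hCC0.le
    linarith
  · intro m X σ c α β x₁ x₂ σ' c' α' β' x₁' x₂' h h' hm h1 h2 h1' h2'
    rw [configInt, configInt, (hsplit h (hm.trans h1.1) (hm.trans h2.1)).2,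
      (hsplit h' (hm.trans h1'.1) (hm.trans h2'.1)).2]
    obtain ⟨-, dα, dβ, -⟩ := h.diff h' hF hP hdρ h1.1 h2.1 h1'.1 h2'.1
    have eM := hm2 (h.mono hdρ) (h'.mono hdρ) hm h1.1 h2.1 h1'.1 h2'.1
    have hX : m ≤ X := h1.1.trans h1.2
    have hsub : Icc m X ⊆ Icc ℓ X := Icc_subset_Icc_left (by linarith)
    have hneg : ∀ {q}, |q - β₀| ≤ d → |-q - -β₀| ≤ d := fun {q} hq => by
      rwa [show -q - -β₀ = -(q - β₀) by ring, abs_neg]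
    have eL := (hCL ε hε1).sideInt_sub hρ hY hℓ0 hℓY hdρ h'.left_near h.left_near (hsub h1') (hsub h1)
    have eR := (hCR ε hε1).sideInt_sub hρ hY hℓ0 hℓY hdρ (hneg h'.right_near) (hneg h.right_near)
      (hsub h2') (hsub h2)
    rw [bL] at eL
    rw [bR, show -β - -β' = -(β - β') by ring, abs_neg] at eR
    set S := |x₁ - x₁'| + |x₂ - x₂'| with hS
    have hS0 : 0 ≤ S := by positivity
    set I1 := sideInt (chartJ g ΩL EL ε) ℓ α x₁
    set I2 := sideInt (chartJ (fun w => g (-w)) ΩR ER ε) ℓ (-β) x₂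
    set I3 := quadInt F g ε σ c (α + ΩL α (Real.exp (-x₁) * Real.cosh (x₁ - ℓ)))
        (β - ΩR (-β) (Real.exp (-x₂) * Real.cosh (x₂ - ℓ)))
    set I1' := sideInt (chartJ g ΩL EL ε) ℓ α' x₁'
    set I2' := sideInt (chartJ (fun w => g (-w)) ΩR ER ε) ℓ (-β') x₂'
    set I3' := quadInt F g ε σ' c' (α' + ΩL α' (Real.exp (-x₁') * Real.cosh (x₁' - ℓ)))
        (β' - ΩR (-β') (Real.exp (-x₂') * Real.cosh (x₂' - ℓ)))
    rw [show I1 + I3 + I2 - (I1' + I3' + I2') - (kL * (x₁ - x₁') + kR * (x₂ - x₂')) =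
      (I1 - I1' - kL * (x₁ - x₁')) + (I2 - I2' - kR * (x₂ - x₂')) + (I3 - I3') by ring]
    refine (abs_add_three _ _ _).trans ?_
    set em := Real.exp (-m) ^ 2 with hem
    have hem0 : 0 ≤ em := by positivity
    have hX0 : 0 ≤ X := by linarith
    have a1 : CL * (d + 3 * Real.exp (-ℓ)) * |x₁ - x₁'| ≤ θ / 2 * S := by
      refine mul_le_mul ?_ (by rw [hS]; linarith [abs_nonneg (x₂ - x₂')]) (abs_nonneg _) (by positivity)
      refine le_trans (mul_le_mul_of_nonneg_right (by linarith) ?_) hsm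
      positivity
    have a2 : CR * (d + 3 * Real.exp (-ℓ)) * |x₂ - x₂'| ≤ θ / 2 * S := by
      refine mul_le_mul ?_ (by rw [hS]; linarith [abs_nonneg (x₁ - x₁')]) (abs_nonneg _) (by positivity)
      refine le_trans (mul_le_mul_of_nonneg_right (by linarith) ?_) hsm
      positivity
    have a3 : CL * X * |α - α'| ≤ CL * X * (C / (b - a) * (em * S)) := by gcongr
    have a4 : CR * X * |β - β'| ≤ CR * X * (C / (b - a) * (em * S)) := by gcongr
    have a5 : 0 ≤ (K - (CL + CR) * (C / (b - a))) * X * em * S := by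
      have : 0 ≤ K - (CL + CR) * (C / (b - a)) := by rw [hK, add_sub_cancel_right]; positivity
      positivity
    have a6 : 0 ≤ (K - Km) * em * S := by
      have : 0 ≤ K - Km := by
        rw [hK]
        have : 0 ≤ (2 * CL + |kL| * ℓ) + (2 * CR + |kR| * ℓ) := by positivity
        linarith
      positivity
    linarith

/-! ### Existence of pairs -/

lemma exists_near (hF : IsFreeEnergy F a b) (hM : IsMaxwellPoint F a b σ₀ α₀ β₀) {d : ℝ} (hd : 0 < d) :
    ∃ κ > 0, ∀ σ, |σ - σ₀| < κ → (∀ α ∈ Ioo 0 a, deriv F α = σ → |α - α₀| ≤ d) ∧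
      ∀ β ∈ Ioi b, deriv F β = σ → |β - β₀| ≤ d := by
  obtain ⟨e, he, hed, he1, he2, he3⟩ : ∃ e > 0, e ≤ d ∧ e < α₀ ∧ e < a - α₀ ∧ e < β₀ - b := by
    have h1 := hM.left_mem.1
    have h2 := sub_pos.2 hM.left_mem.2
    have h3 := sub_pos.2 (mem_Ioi.1 hM.right_mem)
    refine ⟨min d (min α₀ (min (a - α₀) (β₀ - b)) / 2), ?_, min_le_left _ _, ?_, ?_, ?_⟩
    · have : 0 < min α₀ (min (a - α₀) (β₀ - b)) := lt_min h1 (lt_min h2 h3)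
      exact lt_min hd (by linarith)
    all_goals
      have : 0 < min α₀ (min (a - α₀) (β₀ - b)) := lt_min h1 (lt_min h2 h3)
      refine (min_le_right _ _).trans_lt ((half_lt_self this).trans_le ?_)
    · exact min_le_left _ _
    · exact (min_le_right _ _).trans (min_le_left _ _)
    · exact (min_le_right _ _).trans (min_le_right _ _)
  have mα := Ioo_subset_Ioc_self hM.left_mem
  have mβ := Ioi_subset_Ici_self hM.right_mem
  have m1 : α₀ - e ∈ Ioc 0 a := ⟨by linarith, by linarith [hM.left_mem.2]⟩
  have m2 : α₀ + e ∈ Ioc 0 a := ⟨by linarith [hM.left_mem.1], by linarith⟩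
  have m3 : β₀ - e ∈ Ici b := mem_Ici.2 (by linarith)
  have m4 : β₀ + e ∈ Ici b := mem_Ici.2 (by linarith [mem_Ici.1 mβ])
  have p1 := hF.mono_left m1 mα (by linarith)
  have p2 := hF.mono_left mα m2 (by linarith)
  have p3 := hF.mono_right m3 mβ (by linarith)
  have p4 := hF.mono_right mβ m4 (by linarith)
  rw [hM.deriv_left] at p1 p2
  rw [hM.deriv_right] at p3 p4
  refine ⟨min (min (σ₀ - deriv F (α₀ - e)) (deriv F (α₀ + e) - σ₀))
    (min (σ₀ - deriv F (β₀ - e)) (deriv F (β₀ + e) - σ₀)),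
    lt_min (lt_min (by linarith) (by linarith)) (lt_min (by linarith) (by linarith)), ?_⟩
  intro σ hσ
  rw [lt_min_iff, lt_min_iff, lt_min_iff] at hσ
  obtain ⟨⟨q1, q2⟩, q3, q4⟩ := hσ
  have q1' := (abs_lt.1 q1).1
  have q2' := (abs_lt.1 q2).2
  have q3' := (abs_lt.1 q3).1
  have q4' := (abs_lt.1 q4).2
  constructor
  · intro α hα h
    have hα' := Ioo_subset_Ioc_self hα
    have r1 : α₀ - e < α := (hF.mono_left.lt_iff_lt m1 hα').1 (by linarith)
    have r2 : α < α₀ + e := (hF.mono_left.lt_iff_lt hα' m2).1 (by linarith)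
    exact abs_le.2 ⟨by linarith, by linarith⟩
  · intro β hβ h
    have hβ' := Ioi_subset_Ici_self hβ
    have r1 : β₀ - e < β := (hF.mono_right.lt_iff_lt m3 hβ').1 (by linarith)
    have r2 : β < β₀ + e := (hF.mono_right.lt_iff_lt hβ' m4).1 (by linarith)
    exact abs_le.2 ⟨by linarith, by linarith⟩

lemma exp_neg_sq_half_mem {x X : ℝ} (h : X ≤ x) :
    Real.exp (-x) ^ 2 / 2 ∈ Ioc 0 (Real.exp (-X)  ^ 2 / 2) := by
  have : Real.exp (-x) ≤ Real.exp (-X) := Real.exp_le_exp.2 (by linarith)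
  exact ⟨by positivity, by gcongr⟩

lemma exists_exp_neg_sq_half_lt {κ : ℝ} (hκ : 0 < κ) : ∃ X : ℝ, 0 ≤ X ∧ Real.exp (-X) ^ 2 / 2 < κ := by
  refine ⟨max 0 (-Real.log κ), le_max_left _ _, ?_⟩
  set X := max 0 (-Real.log κ)
  have h1 : Real.exp (-X) ≤ κ := by
    calc Real.exp (-X) ≤ Real.exp (Real.log κ) :=
          Real.exp_le_exp.2 (by linarith [le_max_right 0 (-Real.log κ)])
      _ = κ := Real.exp_log hκ
  have h2 : Real.exp (-X) ≤ 1 := Real.exp_le_one_iff.2 (by linarith [le_max_left 0 (-Real.log κ)])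
  have h3 := Real.exp_pos (-X)
  nlinarith

/-- Prescribing both depths prescribes the gap between the two minima, which `exists_gap` realises
by some `σ`; the level `c` is then determined. Small depths make the gap small, hence `σ` close to
`σ₀` and the phases close to `α₀`, `β₀`. -/
lemma exists_config (hF : IsFreeEnergy F a b) (hM : IsMaxwellPoint F a b σ₀ α₀ β₀) {d : ℝ} (hd : 0 < d) :
    ∃ X : ℝ, 0 ≤ X ∧ ∀ x₁ x₂, X ≤ x₁ → X ≤ x₂ → ∃ σ c α β, IsConfig F α₀ β₀ d σ c α β x₁ x₂ := by
  obtain ⟨κ, hκ, hnear⟩ := exists_near hF hM hd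
  obtain ⟨κ', hκ', hgap⟩ := hF.exists_gap
  have hba : 0 < b - a := sub_pos.2 hF.lt
  obtain ⟨X, hX0, hX⟩ := exists_exp_neg_sq_half_lt (κ := min κ' (κ * (b - a)))
    (lt_min hκ' (by positivity))
  refine ⟨X, hX0, fun x₁ x₂ h1 h2 => ?_⟩
  have e1 := exp_neg_sq_half_mem h1
  have e2 := exp_neg_sq_half_mem h2
  set D := Real.exp (-x₁) ^ 2 / 2 - Real.exp (-x₂) ^ 2 / 2 with hD
  have hDX : |D| < min κ' (κ * (b - a)) := by
    refine lt_of_le_of_lt (abs_le.2 ⟨?_, ?_⟩) hX <;> linarith [e1.1, e1.2, e2.1, e2.2]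
  obtain ⟨σ, -, α, hα, β, hβ, hασ, hβσ, hg⟩ := hgap D (hDX.trans_le (min_le_left _ _))
  have hσ := hF.abs_sub_le_gap (Ioo_subset_Ioc_self hM.left_mem) hM.deriv_left
    (Ioi_subset_Ici_self hM.right_mem) hM.deriv_right (Ioo_subset_Ioc_self hα) hασ
    (Ioi_subset_Ici_self hβ) hβσ
  rw [hM.gibbs_eq, sub_self, sub_zero, hg] at hσ
  have hσ' : |σ - σ₀| < κ :=
    lt_of_mul_lt_mul_right (hσ.trans_lt (hDX.trans_le (min_le_right _ _))) hba.le
  obtain ⟨n1, n2⟩ := hnear σ hσ'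
  exact ⟨σ, gibbs F σ α + Real.exp (-x₁) ^ 2 / 2, α, β, n1 α hα hασ, n2 β hβ hβσ, hασ, hβσ, rfl,
    by linarith⟩

end Config

/-! ### Solving the quadrature system -/

/-- A pair of equations on a square that is close to a diagonal linear one is solvable. -/
lemma exists_solution_of_almost_diagonal {A B : ℝ → ℝ → ℝ} {k₁ k₂ s M E η As Bs : ℝ}
    (hk₁ : 0 < k₁) (hk₂ : 0 < k₂) (hsM : s ≤ M) (hη₁ : 4 * η ≤ k₁) (hη₂ : 4 * η ≤ k₂)
    (hA : ∀ x ∈ Icc s M, ∀ y ∈ Icc s M, |A x y - k₁ * x| ≤ E)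
    (hB : ∀ x ∈ Icc s M, ∀ y ∈ Icc s M, |B x y - k₂ * y| ≤ E)
    (hA' : ∀ x ∈ Icc s M, ∀ y ∈ Icc s M, ∀ x' ∈ Icc s M, ∀ y' ∈ Icc s M,
      |A x y - A x' y' - k₁ * (x - x')| ≤ η * (|x - x'| + |y - y'|))
    (hB' : ∀ x ∈ Icc s M, ∀ y ∈ Icc s M, ∀ x' ∈ Icc s M, ∀ y' ∈ Icc s M,
      |B x y - B x' y' - k₂ * (y - y')| ≤ η * (|x - x'| + |y - y'|))
    (hAs : As ∈ Icc (k₁ * s + E) (k₁ * M - E)) (hBs : Bs ∈ Icc (k₂ * s + E) (k₂ * M - E)) :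
    ∃ x ∈ Icc s M, ∃ y ∈ Icc s M, A x y = As ∧ B x y = Bs := by
  set S : Set (ℝ × ℝ) := Icc s M ×ˢ Icc s M with hS
  -- One step of the iteration that solves the diagonal part exactly; its fixed points are the
  -- solutions.
  set Φ : ℝ × ℝ → ℝ × ℝ := fun p => ((As - (A p.1 p.2 - k₁ * p.1)) / k₁,
    (Bs - (B p.1 p.2 - k₂ * p.2)) / k₂) with hΦ
  have hmaps : MapsTo Φ S S := by
    rintro ⟨x, y⟩ ⟨hx, hy⟩
    have h1 := abs_le.1 (hA x hx y hy)
    have h2 := abs_le.1 (hB x hx y hy)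
    refine ⟨⟨?_, ?_⟩, ⟨?_, ?_⟩⟩ <;> simp only [hΦ]
    · rw [le_div_iff₀ hk₁]; linarith [hAs.1, h1.2]
    · rw [div_le_iff₀ hk₁]; linarith [hAs.2, h1.1]
    · rw [le_div_iff₀ hk₂]; linarith [hBs.1, h2.2]
    · rw [div_le_iff₀ hk₂]; linarith [hBs.2, h2.1]
  -- In the maximum norm the increment is at most `η * 2D / kᵢ`, and `4η ≤ kᵢ` bounds this by `D /
  -- 2`.
  have hcontr : ContractingWith (1 / 2) (hmaps.restrict Φ S S) := by
    refine ⟨by rw [← NNReal.coe_lt_coe]; norm_num, LipschitzWith.of_dist_le_mul ?_⟩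
    rintro ⟨⟨x, y⟩, hx, hy⟩ ⟨⟨x', y'⟩, hx', hy'⟩
    simp only at hx hy hx' hy'
    rw [Subtype.dist_eq, Subtype.dist_eq, MapsTo.val_restrict_apply, MapsTo.val_restrict_apply,
      Prod.dist_eq, Prod.dist_eq]
    simp only [Real.dist_eq, hΦ, NNReal.coe_div, NNReal.coe_one, NNReal.coe_ofNat]
    set D := max |x - x'| |y - y'| with hD
    have hs : |x - x'| + |y - y'| ≤ 2 * D := by
      linarith [le_max_left |x - x'| |y - y'|, le_max_right |x - x'| |y - y'|]
    have hD0 : 0 ≤ |x - x'| + |y - y'| := by positivity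
    have h1 := hA' x hx y hy x' hx' y' hy'
    have h2 := hB' x hx y hy x' hx' y' hy'
    refine max_le ?_ ?_
    · rw [← sub_div, abs_div, abs_of_pos hk₁, div_le_iff₀ hk₁,
        show As - (A x y - k₁ * x) - (As - (A x' y' - k₁ * x')) =
          -(A x y - A x' y' - k₁ * (x - x')) by ring, abs_neg]
      nlinarith
    · rw [← sub_div, abs_div, abs_of_pos hk₂, div_le_iff₀ hk₂,
        show Bs - (B x y - k₂ * y) - (Bs - (B x' y' - k₂ * y')) =
          -(B x y - B x' y' - k₂ * (y - y')) by ring, abs_neg]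
      nlinarith
  have hcomplete : IsComplete S := (isCompact_Icc.prod isCompact_Icc).isComplete
  have hs : s ∈ Icc s M := left_mem_Icc.2 hsM
  obtain ⟨⟨x, y⟩, ⟨hx, hy⟩, hfix, -⟩ := hcontr.exists_fixedPoint' hcomplete hmaps (x := (s, s))
    ⟨hs, hs⟩ (edist_ne_top _ _)
  refine ⟨x, hx, y, hy, ?_, ?_⟩
  · have := congrArg Prod.fst hfix
    simp only [hΦ] at this
    rw [div_eq_iff hk₁.ne'] at this
    linarith
  · have := congrArg Prod.snd hfix
    simp only [hΦ] at this
    rw [div_eq_iff hk₂.ne'] at this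
    linarith

section Config

variable {F : ℝ → ℝ} {a b σ₀ α₀ β₀ ρ Y C : ℝ} {ΩL EL ΩR ER : ℝ → ℝ → ℝ}

/-- The pair of quadrature equations equivalent to the length and mass constraints. -/
structure SolvesQuadrature (F : ℝ → ℝ) (α₀ β₀ : ℝ) (ΩL ΩR : ℝ → ℝ → ℝ) (ε r σ c α β x₁ x₂ : ℝ) :
    Prop where
  eq_left : configInt F (fun z => β₀ - z) ΩL ΩR ε σ c α β x₁ x₂ = 2 * (β₀ - r) * ε⁻¹
  eq_right : configInt F (fun z => z - α₀) ΩL ΩR ε σ c α β x₁ x₂ = 2 * (r - α₀) * ε⁻¹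

set_option maxHeartbeats 1000000 in
-- Solutions have logarithmic depths of order `t = 1/ε`. Uniqueness holds in the fixed region `x₁,
-- x₂ ≥ X₁`, while for small `ε` the solution can be found beyond any prescribed `X₂`; the latter is
-- what later places its pair in an arbitrary neighbourhood of the Maxwell point.
theorem PhaseCharts.exists_solvesQuadrature (hP : PhaseCharts F a b α₀ β₀ ρ Y C ΩL EL ΩR ER)
    (hF : IsFreeEnergy F a b) (hM : IsMaxwellPoint F a b σ₀ α₀ β₀) {δ : ℝ} (hδ : 0 < δ)
    (hδ' : δ < (β₀ - α₀) / 2) :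
    ∃ d X₁ : ℝ, 0 < d ∧ d ≤ ρ ∧ 0 ≤ X₁ ∧ ∀ X₂ : ℝ, ∃ ε₂ > 0, ∀ ε ∈ Ioo 0 ε₂,
      ∀ r ∈ Icc (α₀ + δ) (β₀ - δ),
      (∃ σ c α β x₁ x₂ : ℝ, IsConfig F α₀ β₀ d σ c α β x₁ x₂ ∧ X₂ ≤ x₁ ∧ X₂ ≤ x₂ ∧ X₁ ≤ x₁ ∧ X₁ ≤ x₂ ∧
        (∀ z ∈ Icc α β, ε ^ 2 * (gibbs F σ z - c) < 1) ∧
        IntervalIntegrable (fun z => (β₀ - z) * Kern ε (gibbs F σ z - c)) MeasureTheory.volume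
          (α + ΩL α (Real.exp (-x₁))) (β - ΩR (-β) (Real.exp (-x₂))) ∧
        IntervalIntegrable (fun z => (z - α₀) * Kern ε (gibbs F σ z - c)) MeasureTheory.volume
          (α + ΩL α (Real.exp (-x₁))) (β - ΩR (-β) (Real.exp (-x₂))) ∧
        SolvesQuadrature F α₀ β₀ ΩL ΩR ε r σ c α β x₁ x₂) ∧
      ∀ {σ c α β x₁ x₂ σ' c' α' β' x₁' x₂' : ℝ}, IsConfig F α₀ β₀ d σ c α β x₁ x₂ →
        IsConfig F α₀ β₀ d σ' c' α' β' x₁' x₂' → X₁ ≤ x₁ → X₁ ≤ x₂ → X₁ ≤ x₁' → X₁ ≤ x₂' →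
        SolvesQuadrature F α₀ β₀ ΩL ΩR ε r σ c α β x₁ x₂ →
        SolvesQuadrature F α₀ β₀ ΩL ΩR ε r σ' c' α' β' x₁' x₂' → σ = σ' ∧ c = c' := by
  set Dl := β₀ - α₀ with hDl
  have hDl0 : 0 < Dl := by linarith
  set k₁ := Dl / Real.sqrt (deriv (deriv F) α₀) with hk₁
  set k₂ := Dl / Real.sqrt (deriv (deriv F) β₀) with hk₂
  have hk₁0 : 0 < k₁ := div_pos hDl0 (Real.sqrt_pos.2 (hF.convex_left α₀ hM.left_mem))
  have hk₂0 : 0 < k₂ := div_pos hDl0 (Real.sqrt_pos.2 (hF.convex_right β₀ hM.right_mem))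
  set k := min k₁ k₂ with hk
  set kk := max k₁ k₂ with hkk
  have hk0 : 0 < k := lt_min hk₁0 hk₂0
  have hkk0 : 0 < kk := hk₁0.trans_le (le_max_left _ _)
  have hkk₁ : k ≤ k₁ := min_le_left _ _
  have hkk₂ : k ≤ k₂ := min_le_right _ _
  have hK₁ : k₁ ≤ kk := le_max_left _ _
  have hK₂ : k₂ ≤ kk := le_max_right _ _
  -- The square is `[s t, Mm t]^2`. The targets lie between `2δt` and `2 Dl t` and the error is at
  -- most `δt`. Since `kᵢ s ≤ δ` there is room below, and since `kᵢ * Mm ≥ 6 Dl` there is room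
  -- above.
  set Mm := 6 * Dl / k with hMm
  have hMm0 : 0 < Mm := by positivity
  have hkM : k * Mm = 6 * Dl := by rw [hMm]; field_simp
  set s := δ / kk with hs
  have hs0 : 0 < s := by positivity
  have hks : kk * s = δ := by rw [hs]; field_simp
  -- The first bound makes the iteration a contraction with `η = 2θ`. The second gives `θ * (x₁ +
  -- x₂) ≤ δt / 2` on the square, leaving the other half of the error budget to `K`.
  set θ := min (k / 8) (δ / (4 * Mm)) with hθ
  have hθ0 : 0 < θ := lt_min (by positivity) (by positivity)
  have hθk : 8 * θ ≤ k := by have : θ ≤ k / 8 := min_le_left _ _; linarith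
  have hθM : 4 * (θ * Mm) ≤ δ := by
    have : θ ≤ δ / (4 * Mm) := min_le_right _ _
    rw [le_div_iff₀ (by positivity)] at this; linarith
  obtain ⟨dA, KA, XA, εA, hdA, hdAρ, hKA, hXA, hεA, hA⟩ := hP.exists_isAsymptotic hF
    (g := fun z => β₀ - z) (fun z w => by rw [← abs_neg (z - w)]; ring_nf; rfl) hθ0
  obtain ⟨dB, KB, XB, εB, hdB, hdBρ, hKB, hXB, hεB, hB⟩ := hP.exists_isAsymptotic hF
    (g := fun z => z - α₀) (fun z w => by rw [sub_sub_sub_cancel_right]) hθ0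
  set d := min dA dB with hd
  have hd0 : 0 < d := lt_min hdA hdB
  obtain ⟨XC, hXC0, hXC⟩ := exists_config hF hM hd0
  set K := max KA KB with hK
  have hK0 : 0 ≤ K := hKA.trans (le_max_left _ _)
  set X₁ := max (max XA XB) XC with hX₁
  have hX₁0 : 0 ≤ X₁ := hXC0.trans (le_max_right _ _)
  have hA' : ∀ ε ∈ Ioc 0 εA, IsAsymptotic F (fun z => β₀ - z) α₀ β₀ ΩL ΩR k₁ 0 d K X₁ θ ε := by
    intro ε hε
    have := (hA ε hε).mono (min_le_left dA dB) (le_max_left KA KB)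
      ((le_max_left XA XB).trans (le_max_left _ XC)) hXA
    simpa using this
  have hB' : ∀ ε ∈ Ioc 0 εB, IsAsymptotic F (fun z => z - α₀) α₀ β₀ ΩL ΩR 0 k₂ d K X₁ θ ε := by
    intro ε hε
    have := (hB ε hε).mono (min_le_right dA dB) (le_max_right KA KB)
      ((le_max_right XA XB).trans (le_max_left _ XC)) hXB
    simpa using this
  refine ⟨d, X₁, hd0, (min_le_left _ _).trans hdAρ, hX₁0, fun X₂ => ?_⟩
  set ε₂ := min (min εA εB) (min (δ / (2 * K + 1)) (min (s / (X₁ + |X₂| + 1))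
    (θ * s ^ 2 / (K * (1 + Mm) + 1)))) with hε₂
  have hε₂0 : 0 < ε₂ := by
    refine lt_min (lt_min hεA.1 hεB.1) (lt_min (by positivity) (lt_min (by positivity) (by positivity)))
  refine ⟨ε₂, hε₂0, fun ε hε r hr => ?_⟩
  have hε0 := hε.1
  have u1 : ε ≤ εA := hε.2.le.trans ((min_le_left _ _).trans (min_le_left _ _))
  have u2 : ε ≤ εB := hε.2.le.trans ((min_le_left _ _).trans (min_le_right _ _))
  have u3 : ε ≤ δ / (2 * K + 1) := hε.2.le.trans ((min_le_right _ _).trans (min_le_left _ _))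
  have u4 : ε ≤ s / (X₁ + |X₂| + 1) :=
    hε.2.le.trans ((min_le_right _ _).trans ((min_le_right _ _).trans (min_le_left _ _)))
  have u5 : ε ≤ θ * s ^ 2 / (K * (1 + Mm) + 1) :=
    hε.2.le.trans ((min_le_right _ _).trans ((min_le_right _ _).trans (min_le_right _ _)))
  have hε1 : ε ≤ 1 := u1.trans hεA.2
  set t := ε⁻¹ with ht
  have ht0 : 0 < t := inv_pos.2 hε0
  have ht1 : 1 ≤ t := (one_le_inv₀ hε0).2 hε1
  have conv : ∀ {p q : ℝ}, 0 < q → ε ≤ p / q → q ≤ p * t := by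
    intro p q hq h
    rw [le_div_iff₀ hq] at h
    rw [ht, ← div_eq_mul_inv, le_div_iff₀ hε0]; linarith
  have v3 : 2 * K ≤ δ * t := by have := conv (by positivity) u3; linarith
  have v4 : X₁ + |X₂| ≤ s * t := by have := conv (by positivity) u4; linarith
  have v5 : K * (1 + Mm) ≤ θ * s ^ 2 * t := by have := conv (by positivity) u5; linarith
  -- On the square, whose lower corner is `s t`, the exponentially small part of the Lipschitz error
  -- is at most `θ`; this follows from `exp (-u) * u ≤ 1` at `u = s t`, squared.
  have v6 : K * (1 + Mm * t) * Real.exp (-(s * t)) ^ 2 ≤ θ := by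
    have e1 := exp_neg_mul_le_one (x := s * t)
    set e := Real.exp (-(s * t))
    have e0 : 0 < e := Real.exp_pos _
    have e2 : (e * (s * t)) ^ 2 ≤ 1 := by
      have : 0 ≤ e * (s * t) := by positivity
      nlinarith
    have e3 : K * (1 + Mm * t) ≤ K * (1 + Mm) * t := by
      have : 1 + Mm * t ≤ (1 + Mm) * t := by linarith
      calc K * (1 + Mm * t) ≤ K * ((1 + Mm) * t) := by gcongr
        _ = _ := by ring
    calc K * (1 + Mm * t) * e ^ 2 ≤ (θ * s ^ 2 * t) * t * e ^ 2 :=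
          mul_le_mul_of_nonneg_right (e3.trans (mul_le_mul_of_nonneg_right v5 ht0.le)) (sq_nonneg e)
      _ = θ * (e * (s * t)) ^ 2 := by ring
      _ ≤ θ := mul_le_of_le_one_right hθ0.le e2
  have aA := hA' ε ⟨hε0, u1⟩
  have aB := hB' ε ⟨hε0, u2⟩
  have w1 : δ * t ≤ (β₀ - r) * t := by gcongr; linarith [hr.2]
  have w2 : δ * t ≤ (r - α₀) * t := by gcongr; linarith [hr.1]
  have w3 : (β₀ - r) * t + (r - α₀) * t = Dl * t := by rw [hDl]; ring
  have w4 : δ * t ≤ Dl * t := by gcongr; linarith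
  have w5 : 4 * (θ * (Mm * t)) ≤ δ * t := by
    have := mul_le_mul_of_nonneg_right hθM ht0.le
    linarith
  have w6 : k * (Mm * t) = 6 * (Dl * t) := by rw [← mul_assoc, hkM]; ring
  have w7 : kk * (s * t) = δ * t := by rw [← mul_assoc, hks]
  have hst0 : 0 < s * t := by positivity
  have hMt0 : 0 < Mm * t := by positivity
  have hX₁st : X₁ ≤ s * t := by linarith [abs_nonneg X₂]
  have hX₂st : X₂ ≤ s * t := by linarith [le_abs_self X₂]
  have hk₁M : 6 * (Dl * t) ≤ k₁ * (Mm * t) := w6 ▸ mul_le_mul_of_nonneg_right hkk₁ hMt0.le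
  have hk₂M : 6 * (Dl * t) ≤ k₂ * (Mm * t) := w6 ▸ mul_le_mul_of_nonneg_right hkk₂ hMt0.le
  have hk₁s : k₁ * (s * t) ≤ δ * t := w7 ▸ mul_le_mul_of_nonneg_right hK₁ hst0.le
  have hk₂s : k₂ * (s * t) ≤ δ * t := w7 ▸ mul_le_mul_of_nonneg_right hK₂ hst0.le
  constructor
  · choose! σf cf αf βf hcf using hXC
    have hcf' : ∀ {x y}, x ∈ Icc (s * t) (Mm * t) → y ∈ Icc (s * t) (Mm * t) →
        IsConfig F α₀ β₀ d (σf x y) (cf x y) (αf x y) (βf x y) x y := fun {x y} hx hy => by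
      have : XC ≤ s * t := (le_max_right _ _).trans hX₁st
      exact hcf x y (this.trans hx.1) (this.trans hy.1)
    have hsM : s * t ≤ Mm * t := by
      have h1 : k * (s * t) ≤ k * (Mm * t) := by
        have := mul_le_mul_of_nonneg_right hkk₁ hst0.le
        linarith
      exact le_of_mul_le_mul_left h1 hk0
    have hE : ∀ {x y}, x ∈ Icc (s * t) (Mm * t) → y ∈ Icc (s * t) (Mm * t) →
        K + θ * (x + y) ≤ δ * t := fun {x y} hx hy => by
      have : θ * (x + y) ≤ θ * (Mm * t + Mm * t) := by
        gcongr
        exacts [hx.2, hy.2]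
      linarith
    obtain ⟨x, hx, y, hy, e1, e2⟩ := exists_solution_of_almost_diagonal
      (A := fun x y => configInt F (fun z => β₀ - z) ΩL ΩR ε (σf x y) (cf x y) (αf x y) (βf x y) x y)
      (B := fun x y => configInt F (fun z => z - α₀) ΩL ΩR ε (σf x y) (cf x y) (αf x y) (βf x y) x y)
      (s := s * t) (M := Mm * t) (E := δ * t) (η := 2 * θ) (As := 2 * (β₀ - r) * t)
      (Bs := 2 * (r - α₀) * t) hk₁0 hk₂0 hsM (by linarith) (by linarith)
      (fun x hx y hy => by
        have := aA.approx (hcf' hx hy) (hX₁st.trans hx.1) (hX₁st.trans hy.1)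
        rw [zero_mul, add_zero] at this
        exact this.trans (hE hx hy))
      (fun x hx y hy => by
        have := aB.approx (hcf' hx hy) (hX₁st.trans hx.1) (hX₁st.trans hy.1)
        rw [zero_mul, zero_add] at this
        exact this.trans (hE hx hy))
      (fun x hx y hy x' hx' y' hy' => by
        have := aA.diff (hcf' hx hy) (hcf' hx' hy') hX₁st hx hy hx' hy'
        rw [zero_mul, add_zero] at this
        exact this.trans (by gcongr; linarith))
      (fun x hx y hy x' hx' y' hy' => by
        have := aB.diff (hcf' hx hy) (hcf' hx' hy') hX₁st hx hy hx' hy'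
        rw [zero_mul, zero_add] at this
        exact this.trans (by gcongr; linarith))
      ⟨by linarith, by linarith⟩ ⟨by linarith, by linarith⟩
    have hc := hcf' hx hy
    have hx1 := hX₁st.trans hx.1
    have hy1 := hX₁st.trans hy.1
    exact ⟨_, _, _, _, x, y, hc, hX₂st.trans hx.1, hX₂st.trans hy.1, hx1, hy1, aA.small hc hx1 hy1,
      aA.integrable hc hx1 hy1, aB.integrable hc hx1 hy1, e1, e2⟩
  -- Adding the two approximate equations bounds `x₁ + x₂` from above, since `2θ` is absorbed by
  -- `k`. With the sum bounded, each equation separately bounds its unknown from below.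
  · have apriori : ∀ {σ c α β x₁ x₂ : ℝ}, IsConfig F α₀ β₀ d σ c α β x₁ x₂ → X₁ ≤ x₁ → X₁ ≤ x₂ →
        SolvesQuadrature F α₀ β₀ ΩL ΩR ε r σ c α β x₁ x₂ →
        x₁ ∈ Icc (s * t) (Mm * t) ∧ x₂ ∈ Icc (s * t) (Mm * t) := by
      intro σ c α β x₁ x₂ hc h1 h2 hq
      have p1 := abs_le.1 (aA.approx hc h1 h2)
      have p2 := abs_le.1 (aB.approx hc h1 h2)
      rw [hq.eq_left, zero_mul, add_zero] at p1
      rw [hq.eq_right, zero_mul, zero_add] at p2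
      have x10 : 0 ≤ x₁ := hX₁0.trans h1
      have x20 : 0 ≤ x₂ := hX₁0.trans h2
      have q1 := mul_le_mul_of_nonneg_right hkk₁ x10
      have q2 := mul_le_mul_of_nonneg_right hkk₂ x20
      have q3 := mul_le_mul_of_nonneg_right hθk (add_nonneg x10 x20)
      have q4 : k * (x₁ + x₂) ≤ k * (Mm * t) := by
        have : 0 ≤ k * (x₁ + x₂) := by positivity
        linarith [p1.1, p2.1]
      have q5 : x₁ + x₂ ≤ Mm * t := le_of_mul_le_mul_left q4 hk0
      have q6 : θ * (x₁ + x₂) ≤ θ * (Mm * t) := by gcongr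
      have q7 : k₁ * (s * t) ≤ k₁ * x₁ := by linarith [p1.2]
      have q8 : k₂ * (s * t) ≤ k₂ * x₂ := by linarith [p2.2]
      exact ⟨⟨le_of_mul_le_mul_left q7 hk₁0, by linarith⟩, le_of_mul_le_mul_left q8 hk₂0, by linarith⟩
    intro σ c α β x₁ x₂ σ' c' α' β' x₁' x₂' hc hc' h1 h2 h1' h2' hq hq'
    obtain ⟨m1, m2⟩ := apriori hc h1 h2 hq
    obtain ⟨m1', m2'⟩ := apriori hc' h1' h2' hq'
    have p1 := aA.diff hc hc' hX₁st m1 m2 m1' m2'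
    have p2 := aB.diff hc hc' hX₁st m1 m2 m1' m2'
    rw [hq.eq_left, hq'.eq_left, sub_self, zero_mul, add_zero, zero_sub, abs_neg, abs_mul,
      abs_of_pos hk₁0] at p1
    rw [hq.eq_right, hq'.eq_right, sub_self, zero_mul, zero_add, zero_sub, abs_neg, abs_mul,
      abs_of_pos hk₂0] at p2
    obtain ⟨dσ, -, -, dc⟩ := hc.diff hc' hF hP ((min_le_left _ _).trans hdAρ) m1.1 m2.1 m1'.1 m2'.1
    have n1 := mul_le_mul_of_nonneg_right hkk₁ (abs_nonneg (x₁ - x₁'))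
    have n2 := mul_le_mul_of_nonneg_right hkk₂ (abs_nonneg (x₂ - x₂'))
    set S := |x₁ - x₁'| + |x₂ - x₂'| with hS
    have hS0 : 0 ≤ S := by positivity
    have n3 := mul_le_mul_of_nonneg_right v6 hS0
    have n4 := mul_le_mul_of_nonneg_right hθk hS0
    -- Equal right-hand sides give `k * S ≤ 4θ * S ≤ k * S / 2`, which forces `S` to vanish.
    have n5 : k * S ≤ 0 := by
      have e : k * S = k * |x₁ - x₁'| + k * |x₂ - x₂'| := by rw [hS]; ring
      linarith
    have n6 : S = 0 := le_antisymm (nonpos_of_mul_nonpos_right n5 hk0) hS0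
    rw [n6, mul_zero, mul_zero] at dσ dc
    exact ⟨sub_eq_zero.1 (abs_nonpos_iff.1 dσ), sub_eq_zero.1 (abs_nonpos_iff.1 dc)⟩

end Config

/-! ### Simple solutions and quadrature -/

lemma continuousOn_of_strictMonoOn_surjOn {z : ℝ → ℝ} {a b : ℝ} (hab : a < b)
    (hm : StrictMonoOn z (Icc a b)) (hs : SurjOn z (Icc a b) (Icc (z a) (z b))) :
    ContinuousOn z (Icc a b) := by
  have ma := left_mem_Icc.2 hab.le
  have mb := right_mem_Icc.2 hab.le
  have hzab := hm ma mb hab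
  intro t ht
  rcases ht.1.eq_or_lt with rfl | hat
  · refine ContinuousWithinAt.mono (t := Ici a) ?_ Icc_subset_Ici_self
    refine hm.continuousWithinAt_right_of_exists_between (Icc_mem_nhdsGE hab) fun y hy => ?_
    obtain ⟨c, hc, hcy⟩ := hs (show min y (z b) ∈ Icc (z a) (z b) from
      ⟨le_min hy.le hzab.le, min_le_right _ _⟩)
    exact ⟨c, hc, by rw [hcy]; exact ⟨lt_min hy hzab, min_le_left _ _⟩⟩
  rcases ht.2.eq_or_lt with rfl | htb
  · refine ContinuousWithinAt.mono (t := Iic t) ?_ Icc_subset_Iic_self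
    refine hm.continuousWithinAt_left_of_exists_between (Icc_mem_nhdsLE hab) fun y hy => ?_
    obtain ⟨c, hc, hcy⟩ := hs (show max y (z a) ∈ Icc (z a) (z t) from
      ⟨le_max_right _ _, max_le hy.le hzab.le⟩)
    exact ⟨c, hc, by rw [hcy]; exact ⟨le_max_left _ _, max_lt hy hzab⟩⟩
  refine (hm.continuousAt_of_image_mem_nhds (Icc_mem_nhds hat htb) ?_).continuousWithinAt
  exact mem_of_superset (Icc_mem_nhds (hm ma ht hat) (hm ht mb htb)) hs

/-- A function which is continuous up to the end points of an interval, with a derivative that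
extends continuously, is differentiable up to the end points. -/
lemma hasDerivWithinAt_Icc_of_Ioo {f g : ℝ → ℝ} {a b : ℝ} (hab : a < b)
    (hf : ContinuousOn f (Icc a b)) (hg : ContinuousOn g (Icc a b))
    (hd : ∀ t ∈ Ioo a b, HasDerivAt f (g t) t) {t : ℝ} (ht : t ∈ Icc a b) :
    HasDerivWithinAt f (g t) (Icc a b) t := by
  have hdiff : DifferentiableOn ℝ f (Ioo a b) := fun x hx =>
    (hd x hx).differentiableAt.differentiableWithinAt
  rcases ht.1.eq_or_lt with rfl | hat
  · refine HasDerivWithinAt.mono (t := Ici a) ?_ Icc_subset_Ici_self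
    refine hasDerivWithinAt_Ici_of_tendsto_deriv hdiff ((hf a ht).mono Ioo_subset_Icc_self)
      (Ioo_mem_nhdsGT hab) ?_
    have h1 : Tendsto g (𝓝[>] a) (𝓝 (g a)) := by
      have := (hg a ht).mono Ioo_subset_Icc_self
      rwa [ContinuousWithinAt, nhdsWithin_Ioo_eq_nhdsGT hab] at this
    refine h1.congr' ?_
    filter_upwards [Ioo_mem_nhdsGT hab] with x hx
    exact (hd x hx).deriv.symm
  rcases ht.2.eq_or_lt with rfl | htb
  · refine HasDerivWithinAt.mono (t := Iic t) ?_ Icc_subset_Iic_self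
    refine hasDerivWithinAt_Iic_of_tendsto_deriv hdiff ((hf t ht).mono Ioo_subset_Icc_self)
      (Ioo_mem_nhdsLT hab) ?_
    have h1 : Tendsto g (𝓝[<] t) (𝓝 (g t)) := by
      have := (hg t ht).mono Ioo_subset_Icc_self
      rwa [ContinuousWithinAt, nhdsWithin_Ioo_eq_nhdsLT hab] at this
    refine h1.congr' ?_
    filter_upwards [Ioo_mem_nhdsLT hab] with x hx
    exact (hd x hx).deriv.symm
  exact (hd t ⟨hat, htb⟩).hasDerivWithinAt

/-- Integrals along a profile `z` with speed `1 / k (z)`. -/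
lemma integral_profile {z v k : ℝ → ℝ} {a b : ℝ} (hab : a ≤ b) (hc : ContinuousOn z (Icc a b))
    (hm : StrictMonoOn z (Icc a b)) (hd : ∀ t ∈ Ioo a b, HasDerivAt z (v t) t)
    (hv : ∀ t ∈ Ioo a b, v t * k (z t) = 1) (g : ℝ → ℝ) :
    ∫ w in (z a)..(z b), g w * k w = ∫ t in a..b, g (z t) := by
  rw [(integral_comp_of_strictMonoOn hab hc hm hd (fun w => g w * k w)).2,
    intervalIntegral.integral_of_le hab, intervalIntegral.integral_of_le hab,
    MeasureTheory.integral_Ioc_eq_integral_Ioo, MeasureTheory.integral_Ioc_eq_integral_Ioo]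
  refine MeasureTheory.setIntegral_congr_fun measurableSet_Ioo fun t ht => ?_
  have := hv t ht
  linear_combination g (z t) * this

/-- The properties of a simple solution used for the quadrature. -/
structure IsProfile (F : ℝ → ℝ) (ε σ c α ζ β : ℝ) (z v : ℝ → ℝ) : Prop where
  cont : ContinuousOn z (dom ε)
  mono : StrictMonoOn z (dom ε)
  left_mem : z (-ε⁻¹) ∈ Ioo α ζ
  right_mem : z ε⁻¹ ∈ Ioo ζ β
  level_left : gibbs F σ (z (-ε⁻¹)) = c
  level_right : gibbs F σ (z ε⁻¹) = c
  deriv : ∀ t ∈ Ioo (-ε⁻¹) ε⁻¹, HasDerivAt z (v t) t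
  v_pos : ∀ t ∈ Ioo (-ε⁻¹) ε⁻¹, 0 < v t
  speed : ∀ t ∈ Ioo (-ε⁻¹) ε⁻¹, P ε (v t) = gibbs F σ (z t) - c

lemma IsProfile.mul_Kern {F : ℝ → ℝ} {ε σ c α ζ β : ℝ} {z v : ℝ → ℝ} (hε : 0 < ε)
    (h : IsProfile F ε σ c α ζ β z v) : ∀ t ∈ Ioo (-ε⁻¹) ε⁻¹, v t * Kern ε (gibbs F σ (z t) - c) = 1 :=
  fun t ht => by rw [← h.speed t ht]; exact mul_Kern_P hε (h.v_pos t ht)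

lemma neg_inv_lt_inv {ε : ℝ} (hε : 0 < ε) : -ε⁻¹ < ε⁻¹ := by
  have := inv_pos.2 hε
  linarith

lemma IsProfile.quadInt_eq {F : ℝ → ℝ} {ε σ c α ζ β : ℝ} {z v : ℝ → ℝ} (hε : 0 < ε)
    (h : IsProfile F ε σ c α ζ β z v) (g : ℝ → ℝ) {t : ℝ} (ht : t ∈ dom ε) :
    quadInt F g ε σ c (z (-ε⁻¹)) (z t) = ∫ s in (-ε⁻¹)..t, g (z s) := by
  have hsub : Icc (-ε⁻¹) t ⊆ dom ε := Icc_subset_Icc_right ht.2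
  have hsub' : Ioo (-ε⁻¹) t ⊆ Ioo (-ε⁻¹) ε⁻¹ := Ioo_subset_Ioo_right ht.2
  exact integral_profile (k := fun w => Kern ε (gibbs F σ w - c)) ht.1 (h.cont.mono hsub)
    (h.mono.mono hsub) (fun s hs => h.deriv s (hsub' hs)) (fun s hs => h.mul_Kern hε s (hsub' hs)) g

/-- Two profiles with the same pair agree. -/
lemma IsProfile.eqOn {F : ℝ → ℝ} {a b ε σ c α ζ β : ℝ} {z v z' v' : ℝ → ℝ} (hε : 0 < ε)
    (hF : IsFreeEnergy F a b) (hT : IsCriticalTriple F a b σ α ζ β)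
    (h : IsProfile F ε σ c α ζ β z v) (h' : IsProfile F ε σ c α ζ β z' v') : EqOn z z' (dom ε) := by
  have hmono := hF.gibbs_mono_left (Ioo_subset_Ioc_self hT.left_mem) hT.deriv_left
    (Ioo_subset_Icc_self hT.mid_mem) hT.deriv_mid
  have h0 : z (-ε⁻¹) = z' (-ε⁻¹) := hmono.injOn (Ioo_subset_Icc_self h.left_mem)
    (Ioo_subset_Icc_self h'.left_mem) (h.level_left.trans h'.level_left.symm)
  have key : ∀ {z v z' v' : ℝ → ℝ}, IsProfile F ε σ c α ζ β z v → IsProfile F ε σ c α ζ β z' v' →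
      z (-ε⁻¹) = z' (-ε⁻¹) → ∀ t ∈ dom ε, z' t ≤ z t := by
    intro z v z' v' h h' h0 t ht
    by_contra hlt
    push Not at hlt
    have hl : -ε⁻¹ ∈ dom ε := left_mem_Icc.2 (neg_inv_lt_inv hε).le
    have hle : z' (-ε⁻¹) ≤ z t := h0 ▸ h.mono.monotoneOn hl ht ht.1
    -- Both profiles start at the same value and need the same time, the integral of `Kern`, to
    -- reach a given value. So the faster profile cannot have reached `z t` at an earlier time.
    obtain ⟨s, hs, hst⟩ := intermediate_value_Icc ht.1 (h'.cont.mono (Icc_subset_Icc_right ht.2))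
      ⟨hle, hlt.le⟩
    have hsd : s ∈ dom ε := ⟨hs.1, hs.2.trans ht.2⟩
    have e1 := h.quadInt_eq hε (fun _ => 1) ht
    have e2 := h'.quadInt_eq hε (fun _ => 1) hsd
    rw [hst, ← h0, e1] at e2
    simp only [intervalIntegral.integral_const, smul_eq_mul, mul_one] at e2
    have : s = t := by linarith
    subst this
    exact hlt.ne hst.symm
  exact fun t ht => le_antisymm (key h' h h0.symm t ht) (key h h' h0 t ht)

/-- A simple solution is a profile joining the two inner zeros of `Φ_σ - c`. -/
lemma IsSimpleSolution.isProfile {F : ℝ → ℝ} {a b ε r : ℝ} {Δ : ℝ × ℝ} {z : ℝ → ℝ} (hε : 0 < ε)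
    (hF : IsFreeEnergy F a b) (h : IsSimpleSolution F a b ε r Δ z) {α ζ β : ℝ}
    (hT : IsCriticalTriple F a b Δ.1 α ζ β)
    (hmax : max (gibbs F Δ.1 α) (gibbs F Δ.1 β) < Δ.2) :
    IsProfile F ε Δ.1 Δ.2 α ζ β z (derivWithin z (dom ε)) := by
  have hlt := neg_inv_lt_inv hε
  have ml : -ε⁻¹ ∈ dom ε := left_mem_Icc.2 hlt.le
  have mr : ε⁻¹ ∈ dom ε := right_mem_Icc.2 hlt.le
  have hc := h.solution.contDiffOn.continuousOn
  have hm := h.strictMono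
  have hP0 : P ε 0 = 0 := by simp [P]
  have gl : gibbs F Δ.1 (z (-ε⁻¹)) = Δ.2 := by
    have := h.first_integral _ ml
    rw [h.solution.neumann_left, hP0] at this; linarith
  have gr : gibbs F Δ.1 (z ε⁻¹) = Δ.2 := by
    have := h.first_integral _ mr
    rw [h.solution.neumann_right, hP0] at this; linarith
  -- The range of `z` is an interval with both ends on the level `c` and no point below it. As `c`
  -- exceeds both minima, this interval contains neither `α` nor `β`. It cannot lie inside one
  -- monotone branch of the Gibbs function either, so it has `ζ` in its interior.
  have hge : ∀ w ∈ Icc (z (-ε⁻¹)) (z ε⁻¹), Δ.2 ≤ gibbs F Δ.1 w := by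
    intro w hw
    obtain ⟨t, ht, rfl⟩ := intermediate_value_Icc hlt.le hc hw
    have := h.first_integral t ht
    linarith [(P_nonneg_lt hε (derivWithin z (dom ε) t)).1]
  have hz := hm ml mr hlt
  have hz0 := h.solution.pos _ ml
  have hα := lt_of_le_of_lt (le_max_left _ _) hmax
  have hβ := lt_of_le_of_lt (le_max_right _ _) hmax
  have mα := Ioo_subset_Ioc_self hT.left_mem
  have mζ := Ioo_subset_Icc_self hT.mid_mem
  have mβ := Ioi_subset_Ici_self hT.right_mem
  have mono1 := hF.gibbs_anti_left mα hT.deriv_left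
  have mono2 := hF.gibbs_mono_left mα hT.deriv_left mζ hT.deriv_mid
  have mono3 := hF.gibbs_anti_right mζ hT.deriv_mid mβ hT.deriv_right
  have mono4 := hF.gibbs_mono_right mβ hT.deriv_right
  have b1 : α < z (-ε⁻¹) := by
    by_contra hcon
    push Not at hcon
    rcases le_total α (z ε⁻¹) with h1 | h1
    · exact absurd (hge α ⟨hcon, h1⟩) (not_le.2 hα)
    · have := mono1 ⟨hz0, hcon⟩ ⟨hz0.trans hz, h1⟩ hz
      linarith
  have b2 : z ε⁻¹ < β := by
    by_contra hcon
    push Not at hcon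
    rcases le_total (z (-ε⁻¹)) β with h1 | h1
    · exact absurd (hge β ⟨h1, hcon⟩) (not_le.2 hβ)
    · have := mono4 h1 hcon hz
      linarith
  have b3 : z (-ε⁻¹) < ζ := by
    by_contra hcon
    push Not at hcon
    have := mono3 ⟨hcon, by linarith⟩ ⟨by linarith, b2.le⟩ hz
    linarith
  have b4 : ζ < z ε⁻¹ := by
    by_contra hcon
    push Not at hcon
    have := mono2 ⟨b1.le, by linarith⟩ ⟨by linarith, hcon⟩ hz
    linarith
  have hd : ∀ t ∈ Ioo (-ε⁻¹) ε⁻¹, HasDerivAt z (derivWithin z (dom ε) t) t := by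
    intro t ht
    have hn : dom ε ∈ 𝓝 t := Icc_mem_nhds ht.1 ht.2
    have := (h.solution.contDiffOn.differentiableOn (by norm_num)) t (Ioo_subset_Icc_self ht)
    exact this.hasDerivWithinAt.hasDerivAt hn
  refine ⟨hc, hm, ⟨b1, b3⟩, ⟨b4, b2⟩, gl, gr, hd, fun t ht => ?_,
    fun t ht => h.first_integral t (Ioo_subset_Icc_self ht)⟩
  have ht' := Ioo_subset_Icc_self ht
  have hnn : 0 ≤ derivWithin z (dom ε) t := hm.monotoneOn.derivWithin_nonneg
  rcases hnn.lt_or_eq with hp | hp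
  · exact hp
  · exfalso
    have hfi := h.first_integral t ht'
    rw [← hp, hP0] at hfi
    have c1 := hm ml ht' ht.1
    have c2 := hm ht' mr ht.2
    rcases le_total (z t) ζ with h1 | h1
    · have := mono2 ⟨b1.le, b3.le⟩ ⟨by linarith, h1⟩ c1
      linarith
    · have := mono3 ⟨h1, by linarith⟩ ⟨b4.le, b2.le⟩ c2
      linarith

lemma hasDerivAt_PInv {ε q : ℝ} (hε : 0 < ε) (hq : 0 < q) (h : ε ^ 2 * q < 1) :
    HasDerivAt (PInv ε) (deriv (deriv Q) (ε * PInv ε q) * PInv ε q)⁻¹ q := by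
  have hpos : 0 < PInv ε q := by rw [PInv_eq_inv]; exact inv_pos.2 (Kern_pos hq h)
  refine HasDerivAt.of_local_left_inverse (continuousAt_PInv h) (hasDerivAt_P ε _)
    (mul_pos (deriv_deriv_Q_pos _) hpos).ne' ?_
  have h1 : ∀ᶠ y in 𝓝 q, ε ^ 2 * y < 1 :=
    (continuous_const.mul continuous_id).continuousAt.eventually (Iio_mem_nhds h)
  filter_upwards [h1, Ioi_mem_nhds hq] with y hy hy0
  exact P_PInv hε hy0.le hy

/-- Construction of a simple solution from the quadrature. -/
lemma exists_isSimpleSolution {F : ℝ → ℝ} {a b ε r σ c α ζ β z₁ z₂ : ℝ} (hε : 0 < ε)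
    (hF : IsFreeEnergy F a b) (hT : IsCriticalTriple F a b σ α ζ β)
    (hσ : σ ∈ Ioo (deriv F b) (deriv F a)) (h1 : z₁ ∈ Ioo α ζ) (h2 : z₂ ∈ Ioo ζ β)
    (hc1 : gibbs F σ z₁ = c) (hc2 : gibbs F σ z₂ = c)
    (hlt : ∀ w ∈ Icc z₁ z₂, ε ^ 2 * (gibbs F σ w - c) < 1)
    (hi : IntervalIntegrable (fun w => Kern ε (gibbs F σ w - c)) MeasureTheory.volume z₁ z₂)
    (hlen : quadInt F (fun _ => 1) ε σ c z₁ z₂ = 2 * ε⁻¹)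
    (hmass : quadInt F (fun w => w) ε σ c z₁ z₂ = 2 * r * ε⁻¹) :
    ∃ z : ℝ → ℝ, IsSimpleSolution F a b ε r (σ, c) z := by
  have hmα := Ioo_subset_Ioc_self hT.left_mem
  have hmζ := Ioo_subset_Icc_self hT.mid_mem
  have hmβ := Ioi_subset_Ici_self hT.right_mem
  have mono2 := hF.gibbs_mono_left hmα hT.deriv_left hmζ hT.deriv_mid
  have mono3 := hF.gibbs_anti_right hmζ hT.deriv_mid hmβ hT.deriv_right
  have h12 : z₁ < z₂ := h1.2.trans h2.1
  have hz10 : 0 < z₁ := hT.left_mem.1.trans h1.1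
  have hlt' := neg_inv_lt_inv hε
  set q : ℝ → ℝ := fun w => gibbs F σ w - c with hq
  have hqpos : ∀ w ∈ Ioo z₁ z₂, 0 < q w := by
    intro w hw
    rw [hq]; simp only
    rcases le_total w ζ with h | h
    · have := mono2 ⟨h1.1.le, h1.2.le⟩ ⟨h1.1.le.trans hw.1.le, h⟩ hw.1
      linarith
    · have := mono3 ⟨h, hw.2.le.trans h2.2.le⟩ ⟨h2.1.le, h2.2.le⟩ hw.2
      linarith
  have hqc : ∀ w ∈ Icc z₁ z₂, ContinuousAt q w := fun w hw =>
    (hF.hasDerivAt_gibbs σ (hz10.trans_le hw.1)).continuousAt.sub continuousAt_const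
  -- The time at which the solution reaches the value `w`. The solution is its inverse, and the
  -- length equation makes `τ` end at `1/ε`.
  set τ : ℝ → ℝ := fun w => -ε⁻¹ + ∫ s in z₁..w, Kern ε (q s) with hτ
  have hτ1 : τ z₁ = -ε⁻¹ := by simp [hτ]
  have hτ2 : τ z₂ = ε⁻¹ := by
    rw [quadInt] at hlen
    simp only [one_mul] at hlen
    simp only [hτ, hq]; rw [hlen]; ring
  have hτc : ContinuousOn τ (Icc z₁ z₂) := by
    have := intervalIntegral.continuousOn_primitive_interval (a := z₁) (b := z₂)
      (f := fun s => Kern ε (q s)) (μ := MeasureTheory.volume)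
      (by rwa [uIcc_of_le h12.le, ← intervalIntegrable_iff_integrableOn_Icc_of_le h12.le])
    rw [uIcc_of_le h12.le] at this
    exact continuousOn_const.add this
  have hKc : ∀ w ∈ Ioo z₁ z₂, ContinuousAt (fun w => Kern ε (q w)) w := fun w hw =>
    ContinuousAt.comp (f := q) (g := Kern ε)
      (continuousAt_Kern (hqpos w hw) (hlt w (Ioo_subset_Icc_self hw))) (hqc w (Ioo_subset_Icc_self hw))
  have hτd : ∀ w ∈ Ioo z₁ z₂, HasDerivAt τ (Kern ε (q w)) w := by
    intro w hw
    refine HasDerivAt.const_add _ (intervalIntegral.integral_hasDerivAt_right ?_ ?_ (hKc w hw))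
    · refine hi.mono_set ?_
      rw [uIcc_of_le hw.1.le, uIcc_of_le h12.le]
      exact Icc_subset_Icc_right hw.2.le
    · exact ContinuousOn.stronglyMeasurableAtFilter_nhdsWithin
        (fun x hx => (hKc x hx).continuousWithinAt) measurableSet_Ioo w |>.filter_mono
        (by rw [nhdsWithin_eq_nhds.2 (Ioo_mem_nhds hw.1 hw.2)])
  have hKpos : ∀ w ∈ Ioo z₁ z₂, 0 < Kern ε (q w) := fun w hw =>
    Kern_pos (hqpos w hw) (hlt w (Ioo_subset_Icc_self hw))
  have hτm : StrictMonoOn τ (Icc z₁ z₂) := by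
    refine strictMonoOn_of_deriv_pos (convex_Icc _ _) hτc fun w hw => ?_
    rw [interior_Icc] at hw
    rw [(hτd w hw).deriv]
    exact hKpos w hw
  have hsurj : ∀ t ∈ dom ε, ∃ w ∈ Icc z₁ z₂, τ w = t := by
    intro t ht
    exact intermediate_value_Icc h12.le hτc (by rw [hτ1, hτ2]; exact ht)
  choose! z hzm hzτ using hsurj
  have ml : -ε⁻¹ ∈ dom ε := left_mem_Icc.2 hlt'.le
  have mr : ε⁻¹ ∈ dom ε := right_mem_Icc.2 hlt'.le
  have m1 : z₁ ∈ Icc z₁ z₂ := left_mem_Icc.2 h12.le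
  have m2 : z₂ ∈ Icc z₁ z₂ := right_mem_Icc.2 h12.le
  have hzl : z (-ε⁻¹) = z₁ := hτm.injOn (hzm _ ml) m1 (by rw [hzτ _ ml, hτ1])
  have hzr : z ε⁻¹ = z₂ := hτm.injOn (hzm _ mr) m2 (by rw [hzτ _ mr, hτ2])
  have hzmono : StrictMonoOn z (dom ε) := by
    intro s hs t ht hst
    rw [← hτm.lt_iff_lt (hzm s hs) (hzm t ht), hzτ s hs, hzτ t ht]
    exact hst
  have hτdom : ∀ w ∈ Icc z₁ z₂, τ w ∈ dom ε := fun w hw => by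
    constructor
    · rw [← hτ1]; exact hτm.monotoneOn m1 hw hw.1
    · rw [← hτ2]; exact hτm.monotoneOn hw m2 hw.2
  have hzτ' : ∀ w ∈ Icc z₁ z₂, z (τ w) = w := fun w hw =>
    hτm.injOn (hzm _ (hτdom w hw)) hw (hzτ _ (hτdom w hw))
  have hzc : ContinuousOn z (dom ε) := by
    refine continuousOn_of_strictMonoOn_surjOn hlt' hzmono ?_
    rw [hzl, hzr]
    exact fun w hw => ⟨τ w, hτdom w hw, hzτ' w hw⟩
  have hzo : ∀ t ∈ Ioo (-ε⁻¹) ε⁻¹, z t ∈ Ioo z₁ z₂ := fun t ht => by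
    have ht' := Ioo_subset_Icc_self ht
    exact ⟨hzl ▸ hzmono ml ht' ht.1, hzr ▸ hzmono ht' mr ht.2⟩
  -- `V` and `W` are the candidates for `z'` and `z''`. `Kern` is singular at the turning points,
  -- but `PInv` is continuous there, so both candidates are continuous up to the ends. This gives
  -- `C^2` regularity on the closed interval and the Neumann conditions.
  set V : ℝ → ℝ := fun t => PInv ε (q (z t)) with hV
  set W : ℝ → ℝ := fun t => (deriv F (z t) - σ) / deriv (deriv Q) (ε * V t) with hW
  have hqz : ContinuousOn (fun t => q (z t)) (dom ε) := fun t ht =>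
    ContinuousAt.comp_continuousWithinAt (hqc (z t) (hzm t ht)) (hzc t ht)
  have hVc : ContinuousOn V (dom ε) := fun t ht =>
    ContinuousAt.comp_continuousWithinAt (f := fun t => q (z t)) (g := PInv ε)
      (continuousAt_PInv (hlt (z t) (hzm t ht))) (hqz t ht)
  have hWc : ContinuousOn W (dom ε) := by
    refine ContinuousOn.div ?_ ?_ fun t _ => (deriv_deriv_Q_pos _).ne'
    · refine ContinuousOn.sub (fun t ht => ?_) continuousOn_const
      exact ContinuousAt.comp_continuousWithinAt (f := z) (g := deriv F)
        (hF.hasDerivAt_deriv (hz10.trans_le (hzm t ht).1)).continuousAt (hzc t ht)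
    · exact continuous_deriv_deriv_Q.comp_continuousOn (continuousOn_const.mul hVc)
  have hzd : ∀ t ∈ Ioo (-ε⁻¹) ε⁻¹, HasDerivAt z (V t) t := by
    intro t ht
    have ht' := Ioo_subset_Icc_self ht
    rw [hV]; simp only
    rw [PInv_eq_inv]
    refine HasDerivAt.of_local_left_inverse (hzc.continuousAt (Icc_mem_nhds ht.1 ht.2))
      (hτd (z t) (hzo t ht)) (hKpos _ (hzo t ht)).ne' ?_
    filter_upwards [Icc_mem_nhds ht.1 ht.2] with s hs
    exact hzτ s hs
  have hVpos : ∀ t ∈ Ioo (-ε⁻¹) ε⁻¹, 0 < V t := fun t ht => by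
    rw [hV]; simp only
    rw [PInv_eq_inv]
    exact inv_pos.2 (hKpos _ (hzo t ht))
  have hVd : ∀ t ∈ Ioo (-ε⁻¹) ε⁻¹, HasDerivAt V (W t) t := by
    intro t ht
    have hzt := hzo t ht
    have e1 := hasDerivAt_PInv hε (hqpos _ hzt) (hlt _ (Ioo_subset_Icc_self hzt))
    have e2 := (hF.hasDerivAt_gibbs σ (hz10.trans hzt.1)).sub_const c
    have e3 := (e1.comp (z t) e2).comp t (hzd t ht)
    refine e3.congr_deriv ?_
    have hp := hVpos t ht
    have hQ := deriv_deriv_Q_pos (ε * V t)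
    change (deriv (deriv Q) (ε * V t) * V t)⁻¹ * (deriv F (z t) - σ) * V t = W t
    rw [hW]
    field_simp
  have hzw : ∀ t ∈ dom ε, HasDerivWithinAt z (V t) (dom ε) t := fun t ht =>
    hasDerivWithinAt_Icc_of_Ioo hlt' hzc hVc hzd ht
  have hVw : ∀ t ∈ dom ε, HasDerivWithinAt V (W t) (dom ε) t := fun t ht =>
    hasDerivWithinAt_Icc_of_Ioo hlt' hVc hWc hVd ht
  have hud : UniqueDiffOn ℝ (dom ε) := uniqueDiffOn_Icc hlt'
  have dz : ∀ t ∈ dom ε, derivWithin z (dom ε) t = V t := fun t ht =>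
    (hzw t ht).derivWithin (hud t ht)
  have ddz : ∀ t ∈ dom ε, derivWithin (derivWithin z (dom ε)) (dom ε) t = W t := fun t ht => by
    rw [derivWithin_congr dz (dz t ht)]
    exact (hVw t ht).derivWithin (hud t ht)
  have hV0 : ∀ t, q (z t) = 0 → V t = 0 := fun t h => by
    rw [hV]; simp only
    rw [h]; simp [PInv]
  have hsmooth : ContDiffOn ℝ 2 z (dom ε) := by
    rw [show (2 : WithTop ℕ∞) = 1 + 1 by norm_num, contDiffOn_succ_iff_derivWithin hud]
    refine ⟨fun t ht => (hzw t ht).differentiableWithinAt, by simp, ContDiffOn.congr ?_ dz⟩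
    rw [show (1 : WithTop ℕ∞) = 0 + 1 by norm_num, contDiffOn_succ_iff_derivWithin hud]
    refine ⟨fun t ht => (hVw t ht).differentiableWithinAt, by simp, ?_⟩
    rw [contDiffOn_zero]
    exact hWc.congr fun t ht => (hVw t ht).derivWithin (hud t ht)
  refine ⟨z, ⟨hsmooth, fun t ht => hz10.trans_le (hzm t ht).1, fun t ht => ?_, ?_, ?_, ?_⟩, hzmono,
    ⟨hσ, α, ζ, β, hT, ?_, ?_⟩, fun t ht => ?_⟩
  · have ht' := Ioo_subset_Icc_self ht
    rw [dz t ht', ddz t ht', hW]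
    exact mul_div_cancel₀ _ (deriv_deriv_Q_pos _).ne'
  · rw [dz _ ml]; exact hV0 _ (by rw [hzl, hq]; simp only; linarith)
  · rw [dz _ mr]; exact hV0 _ (by rw [hzr, hq]; simp only; linarith)
  · rw [← hmass, quadInt, ← hzl, ← hzr]
    refine (integral_profile (k := fun w => Kern ε (q w)) hlt'.le hzc hzmono hzd (fun t ht => ?_)
      (fun w => w)).symm
    rw [hV]; simp only
    rw [PInv_eq_inv, inv_mul_cancel₀ (hKpos _ (hzo t ht)).ne']
  · simp only
    refine max_lt ?_ ?_
    · have := mono2 (left_mem_Icc.2 (h1.1.trans h1.2).le) (Ioo_subset_Icc_self h1) h1.1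
      linarith
    · have := mono3 (Ioo_subset_Icc_self h2) (right_mem_Icc.2 (h2.1.trans h2.2).le) h2.2
      linarith
  · simp only
    have := mono2 (Ioo_subset_Icc_self h1) (right_mem_Icc.2 (h1.1.trans h1.2).le) h1.2
    linarith
  · rw [dz t ht]
    have hqn : 0 ≤ q (z t) := by
      rcases (hzm t ht).1.eq_or_lt with e | e
      · rw [← e, hq]; simp only; linarith
      rcases (hzm t ht).2.eq_or_lt with e' | e'
      · rw [e', hq]; simp only; linarith
      exact (hqpos _ ⟨e, e'⟩).le
    exact P_PInv hε hqn (hlt _ (hzm t ht))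

/-! ### From pairs near the Maxwell point to logarithmic depths and back -/

section Pairs

variable {F : ℝ → ℝ} {a b σ₀ α₀ β₀ ρ Y C : ℝ} {ΩL EL ΩR ER : ℝ → ℝ → ℝ}
  {d σ c α β x₁ x₂ ℓ : ℝ}

/-- Envelope estimate: each minimiser is a competitor for the other minimum, so the minimum value
changes by at most the change of `σ` times the size of the minimisers. -/
lemma IsFreeEnergy.abs_gibbs_left_sub_le {σ' α' : ℝ} (hF : IsFreeEnergy F a b) (hα : α ∈ Ioo 0 a)
    (h : deriv F α = σ) (hα' : α' ∈ Ioo 0 a) (h' : deriv F α' = σ') :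
    |gibbs F σ' α' - gibbs F σ α| ≤ |σ' - σ| * a := by
  have h1 := hF.gibbs_min_left (Ioo_subset_Ioc_self hα) h (Ioo_subset_Ioc_self hα')
  have h2 := hF.gibbs_min_left (Ioo_subset_Ioc_self hα') h' (Ioo_subset_Ioc_self hα)
  have e1 : -(|σ' - σ| * a) ≤ (σ - σ') * α' := by
    have := abs_mul (σ - σ') α'
    rw [abs_of_pos hα'.1, abs_sub_comm] at this
    have h3 := neg_abs_le ((σ - σ') * α')
    nlinarith [abs_nonneg (σ' - σ), hα'.2]
  have e2 : (σ - σ') * α ≤ |σ' - σ| * a := by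
    have := abs_mul (σ - σ') α
    rw [abs_of_pos hα.1, abs_sub_comm] at this
    have h3 := le_abs_self ((σ - σ') * α)
    nlinarith [abs_nonneg (σ' - σ), hα.2]
  unfold gibbs at *
  rw [abs_le]
  constructor <;> linarith

lemma IsFreeEnergy.abs_gibbs_right_sub_le {σ' β' B : ℝ} (hF : IsFreeEnergy F a b) (hβ : β ∈ Ioi b)
    (h : deriv F β = σ) (hβ' : β' ∈ Ioi b) (h' : deriv F β' = σ') (hB : β ≤ B) (hB' : β' ≤ B) :
    |gibbs F σ' β' - gibbs F σ β| ≤ |σ' - σ| * B := by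
  have h1 := hF.gibbs_min_right (Ioi_subset_Ici_self hβ) h (Ioi_subset_Ici_self hβ')
  have h2 := hF.gibbs_min_right (Ioi_subset_Ici_self hβ') h' (Ioi_subset_Ici_self hβ)
  have hb := hF.pos_b
  have e1 : -(|σ' - σ| * B) ≤ (σ - σ') * β' := by
    have := abs_mul (σ - σ') β'
    rw [abs_of_pos (hb.trans hβ'), abs_sub_comm] at this
    have h3 := neg_abs_le ((σ - σ') * β')
    nlinarith [abs_nonneg (σ' - σ)]
  have e2 : (σ - σ') * β ≤ |σ' - σ| * B := by
    have := abs_mul (σ - σ') β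
    rw [abs_of_pos (hb.trans hβ), abs_sub_comm] at this
    have h3 := le_abs_self ((σ - σ') * β)
    nlinarith [abs_nonneg (σ' - σ)]
  unfold gibbs at *
  rw [abs_le]
  constructor <;> linarith

/-- Pairs of small depths are close to the Maxwell point. -/
lemma exists_depth_of_mem_nhds (hF : IsFreeEnergy F a b) (hM : IsMaxwellPoint F a b σ₀ α₀ β₀)
    {U : Set (ℝ × ℝ)} (hU : U ∈ 𝓝 (σ₀, gibbs F σ₀ α₀)) :
    ∃ X : ℝ, ∀ {d σ c α β x₁ x₂ : ℝ}, IsConfig F α₀ β₀ d σ c α β x₁ x₂ → α ∈ Ioo 0 a → β ∈ Ioi b →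
      X ≤ x₁ → X ≤ x₂ → (σ, c) ∈ U := by
  obtain ⟨e, he, hball⟩ := Metric.mem_nhds_iff.1 hU
  have hba : 0 < b - a := sub_pos.2 hF.lt
  have hb := hF.pos_b
  obtain ⟨X, -, hX⟩ := exists_exp_neg_sq_half_lt (κ := min (e * (b - a)) (e * (b - a) / b))
    (lt_min (by positivity) (by positivity))
  refine ⟨X, fun {d σ c α β x₁ x₂} h hα hβ h1 h2 => hball ?_⟩
  set η := Real.exp (-X) ^ 2 / 2
  have hX1 : η < e * (b - a) := hX.trans_le (min_le_left _ _)
  have hX2 : η * b < e * (b - a) := by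
    have := hX.trans_le (min_le_right _ _)
    rwa [lt_div_iff₀ hb] at this
  have m1 : Real.exp (-x₁) ^ 2 / 2 ∈ Ioc 0 η := exp_neg_sq_half_mem h1
  have m2 : Real.exp (-x₂) ^ 2 / 2 ∈ Ioc 0 η := exp_neg_sq_half_mem h2
  have q1 := hF.abs_sub_le_gap (Ioo_subset_Ioc_self hM.left_mem) hM.deriv_left
    (Ioi_subset_Ici_self hM.right_mem) hM.deriv_right (Ioo_subset_Ioc_self hα) h.deriv_left
    (Ioi_subset_Ici_self hβ) h.deriv_right
  have q2 : |(gibbs F σ β - gibbs F σ α) - (gibbs F σ₀ β₀ - gibbs F σ₀ α₀)| ≤ η := by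
    rw [hM.gibbs_eq, sub_self, sub_zero, abs_le]
    constructor <;> linarith [h.level_left, h.level_right, m1.1, m1.2, m2.1, m2.2]
  have q3 := hF.abs_gibbs_left_sub_le hM.left_mem hM.deriv_left hα h.deriv_left
  have q4 : |c - gibbs F σ₀ α₀| ≤ η + |σ - σ₀| * a := by
    have := abs_le.1 q3
    rw [abs_le]
    constructor <;> linarith [h.level_left, m1.1, m1.2]
  have q5 := q1.trans q2
  rw [Metric.mem_ball, Prod.dist_eq, max_lt_iff, Real.dist_eq, Real.dist_eq]
  constructor
  · exact lt_of_mul_lt_mul_right (q5.trans_lt hX1) hba.le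
  · refine lt_of_mul_lt_mul_right (lt_of_le_of_lt ?_ hX2) hba.le
    have ha := hF.pos
    calc |c - gibbs F σ₀ α₀| * (b - a) ≤ (η + |σ - σ₀| * a) * (b - a) := by gcongr
      _ = η * (b - a) + (|σ - σ₀| * (b - a)) * a := by ring
      _ ≤ η * (b - a) + η * a := by gcongr
      _ = η * b := by ring

lemma exists_exp_neg_sq_half_eq {η X : ℝ} (h0 : 0 < η) (h : η ≤ Real.exp (-X) ^ 2 / 2) :
    ∃ x, X ≤ x ∧ η = Real.exp (-x) ^ 2 / 2 := by
  have hs : 0 < Real.sqrt (2 * η) := Real.sqrt_pos.2 (by positivity)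
  refine ⟨-Real.log (Real.sqrt (2 * η)), ?_, ?_⟩
  · have : Real.log (Real.sqrt (2 * η)) ≤ -X := by
      rw [Real.log_le_iff_le_exp hs, Real.sqrt_le_left (Real.exp_pos _).le]
      linarith
    linarith
  · rw [neg_neg, Real.exp_log hs, Real.sq_sqrt (by positivity)]
    ring

/-- Pairs close to the Maxwell point have small depths. -/
lemma exists_nhds_isConfig (hF : IsFreeEnergy F a b) (hM : IsMaxwellPoint F a b σ₀ α₀ β₀)
    (hd : 0 < d) (X : ℝ) : ∃ N ∈ 𝓝 (σ₀, gibbs F σ₀ α₀), ∀ {σ c α β : ℝ}, (σ, c) ∈ N →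
      α ∈ Ioo 0 a → β ∈ Ioi b → deriv F α = σ → deriv F β = σ → gibbs F σ α < c → gibbs F σ β < c →
      ∃ x₁ x₂, X ≤ x₁ ∧ X ≤ x₂ ∧ IsConfig F α₀ β₀ d σ c α β x₁ x₂ := by
  obtain ⟨κ, hκ, hnear⟩ := exists_near hF hM hd
  set η := Real.exp (-X) ^ 2 / 2 with hη
  have hη0 : 0 < η := by positivity
  have ha := hF.pos
  have hβ₀ := hF.pos_b.trans hM.right_mem
  set B := a + β₀ + d with hB
  have hB0 : 0 < B := by positivity
  have hs : 0 < min κ (η / (1 + B)) := lt_min hκ (by positivity)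
  refine ⟨Metric.ball _ _, Metric.ball_mem_nhds _ hs, fun {σ c α β} hmem hα hβ hασ hβσ h1 h2 => ?_⟩
  rw [Metric.mem_ball, Prod.dist_eq, max_lt_iff, Real.dist_eq, Real.dist_eq] at hmem
  obtain ⟨p1, p2⟩ := hmem
  simp only at p1 p2
  obtain ⟨n1, n2⟩ := hnear σ (p1.trans_le (min_le_left _ _))
  have r1 := n1 α hα hασ
  have r2 := n2 β hβ hβσ
  have s1 := p1.trans_le (min_le_right _ _)
  have s2 := p2.trans_le (min_le_right _ _)
  have key : ∀ {g g₀ : ℝ}, |g - g₀| ≤ |σ - σ₀| * B → g₀ = gibbs F σ₀ α₀ → c - g ≤ η := by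
    intro g g₀ hg hg0
    have t1 : |σ - σ₀| * B ≤ η / (1 + B) * B := by gcongr
    have t2 : η / (1 + B) * B + η / (1 + B) = η := by field_simp; ring
    have t3 := abs_le.1 hg
    have t4 := abs_lt.1 s2
    rw [← hg0] at t4
    linarith [t3.1, t4.2]
  have k1 : c - gibbs F σ α ≤ η := by
    refine key ((hF.abs_gibbs_left_sub_le hM.left_mem hM.deriv_left hα hασ).trans ?_) rfl
    gcongr
    linarith
  have k2 : c - gibbs F σ β ≤ η := by
    refine key (hF.abs_gibbs_right_sub_le hM.right_mem hM.deriv_right hβ hβσ ?_ ?_) hM.gibbs_eq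
    · linarith
    · linarith [(abs_le.1 r2).2]
  obtain ⟨x₁, hx₁, e₁⟩ := exists_exp_neg_sq_half_eq (sub_pos.2 h1) k1
  obtain ⟨x₂, hx₂, e₂⟩ := exists_exp_neg_sq_half_eq (sub_pos.2 h2) k2
  exact ⟨x₁, x₂, hx₁, hx₂, r1, r2, hασ, hβσ, by linarith, by linarith⟩

/-- The weights `1` and `z` of the length and mass equations span the same functions as `β₀ - z` and
`z - α₀`, which are the weights that diagonalise the asymptotics. -/
lemma quadInt_affine {ε u v p q : ℝ} {g : ℝ → ℝ} (hg : ∀ z, g z = p * (β₀ - z) + q * (z - α₀))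
    (i1 : IntervalIntegrable (fun z => (β₀ - z) * Kern ε (gibbs F σ z - c)) MeasureTheory.volume u v)
    (i2 : IntervalIntegrable (fun z => (z - α₀) * Kern ε (gibbs F σ z - c)) MeasureTheory.volume u v) :
    IntervalIntegrable (fun z => g z * Kern ε (gibbs F σ z - c)) MeasureTheory.volume u v ∧
    quadInt F g ε σ c u v = p * quadInt F (fun z => β₀ - z) ε σ c u v +
      q * quadInt F (fun z => z - α₀) ε σ c u v := by
  have e : (fun z => g z * Kern ε (gibbs F σ z - c)) = fun z =>
      p * ((β₀ - z) * Kern ε (gibbs F σ z - c)) + q * ((z - α₀) * Kern ε (gibbs F σ z - c)) := by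
    funext z
    rw [hg]; ring
  constructor
  · rw [e]
    exact (i1.const_mul p).add (i2.const_mul q)
  · unfold quadInt
    rw [e, intervalIntegral.integral_add (i1.const_mul p) (i2.const_mul q),
      intervalIntegral.integral_const_mul, intervalIntegral.integral_const_mul]

/-- Solutions of the quadrature equations give simple solutions. -/
lemma SolvesQuadrature.exists_isSimpleSolution {ε r : ℝ} (hε : 0 < ε)
    (hq : SolvesQuadrature F α₀ β₀ ΩL ΩR ε r σ c α β x₁ x₂)
    (h : IsConfig F α₀ β₀ d σ c α β x₁ x₂) (hF : IsFreeEnergy F a b) (hD : α₀ < β₀)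
    (hP : PhaseCharts F a b α₀ β₀ ρ Y C ΩL EL ΩR ER) (hd : d ≤ ρ) (hℓ : Real.exp (-ℓ) ≤ Y)
    (hx₁ : ℓ + 1 ≤ x₁) (hx₂ : ℓ + 1 ≤ x₂)
    (hlt : ∀ z ∈ Icc α β, ε ^ 2 * (gibbs F σ z - c) < 1)
    (i1 : IntervalIntegrable (fun z => (β₀ - z) * Kern ε (gibbs F σ z - c)) MeasureTheory.volume
      (α + ΩL α (Real.exp (-x₁))) (β - ΩR (-β) (Real.exp (-x₂))))
    (i2 : IntervalIntegrable (fun z => (z - α₀) * Kern ε (gibbs F σ z - c)) MeasureTheory.volume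
      (α + ΩL α (Real.exp (-x₁))) (β - ΩR (-β) (Real.exp (-x₂)))) :
    ∃ z : ℝ → ℝ, IsSimpleSolution F a b ε r (σ, c) z := by
  have hB := h.pieceBounds hP hd hℓ hx₁ hx₂
  have hσ := h.mem_Ioo hF hP hd
  obtain ⟨ζ, hζ, hζσ⟩ := hF.exists_mid hσ
  have hT : IsCriticalTriple F a b σ α ζ β :=
    ⟨h.left_mem hP hd, hζ, h.right_mem hP hd, h.deriv_left, hζσ, h.deriv_right⟩
  have hDne : β₀ - α₀ ≠ 0 := (sub_pos.2 hD).ne'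
  have q1 := quadInt_affine (F := F) (p := (β₀ - α₀)⁻¹) (q := (β₀ - α₀)⁻¹) (g := fun _ => 1)
    (fun z => by field_simp; ring) i1 i2
  have q2 := quadInt_affine (F := F) (p := (β₀ - α₀)⁻¹ * α₀) (q := (β₀ - α₀)⁻¹ * β₀) (g := fun z => z)
    (fun z => by field_simp; ring) i1 i2
  have e1 := hq.eq_left
  have e2 := hq.eq_right
  unfold configInt at e1 e2
  rw [e1, e2] at q1 q2
  have b1 := hB.left_lt
  have b2 := hB.left_le
  have b3 := hB.mid_left
  have b4 := hB.mid_right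
  have b5 := hB.right_le
  have b6 := hB.right_lt
  refine MaxwellSolution.exists_isSimpleSolution hε hF hT hσ ⟨b1, by linarith [hζ.1]⟩
    ⟨by linarith [hζ.2], b6⟩ hB.level_u hB.level_v
    (fun w hw => hlt w ⟨by linarith [hw.1], by linarith [hw.2]⟩) ?_ ?_ ?_
  · simpa only [one_mul] using q1.1
  · rw [q1.2]; field_simp; ring
  · rw [q2.2]; field_simp; ring

/-- The pair of a simple solution solves the quadrature equations. -/
lemma IsProfile.solvesQuadrature {ε r ζ : ℝ} {z v : ℝ → ℝ} (hε : 0 < ε)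
    (hz : IsProfile F ε σ c α ζ β z v) (hmass : ∫ t in (-ε⁻¹)..ε⁻¹, z t = 2 * r * ε⁻¹)
    (hT : IsCriticalTriple F a b σ α ζ β) (h : IsConfig F α₀ β₀ d σ c α β x₁ x₂)
    (hF : IsFreeEnergy F a b)
    (hP : PhaseCharts F a b α₀ β₀ ρ Y C ΩL EL ΩR ER) (hd : d ≤ ρ) (hℓ : Real.exp (-ℓ) ≤ Y)
    (hx₁ : ℓ + 1 ≤ x₁) (hx₂ : ℓ + 1 ≤ x₂) :
    SolvesQuadrature F α₀ β₀ ΩL ΩR ε r σ c α β x₁ x₂ := by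
  have hB := h.pieceBounds hP hd hℓ hx₁ hx₂
  have b1 := hB.left_lt
  have b2 := hB.left_le
  have b3 := hB.mid_left
  have b4 := hB.mid_right
  have b5 := hB.right_le
  have b6 := hB.right_lt
  have hα := Ioo_subset_Ioc_self hT.left_mem
  have hζ := Ioo_subset_Icc_self hT.mid_mem
  have hβ := Ioi_subset_Ici_self hT.right_mem
  have e1 : α + ΩL α (Real.exp (-x₁)) = z (-ε⁻¹) :=
    (hF.gibbs_mono_left hα hT.deriv_left hζ hT.deriv_mid).injOn ⟨b1.le, by linarith [hζ.1]⟩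
      (Ioo_subset_Icc_self hz.left_mem) (hB.level_u.trans hz.level_left.symm)
  have e2 : β - ΩR (-β) (Real.exp (-x₂)) = z ε⁻¹ :=
    (hF.gibbs_anti_right hζ hT.deriv_mid hβ hT.deriv_right).injOn ⟨by linarith [hζ.2], b6.le⟩
      (Ioo_subset_Icc_self hz.right_mem) (hB.level_v.trans hz.level_right.symm)
  have hlt := neg_inv_lt_inv hε
  have hi : IntervalIntegrable z MeasureTheory.volume (-ε⁻¹) ε⁻¹ := by
    refine ContinuousOn.intervalIntegrable ?_
    rw [uIcc_of_le hlt.le]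
    exact hz.cont
  have hr : ε⁻¹ ∈ dom ε := right_mem_Icc.2 hlt.le
  constructor
  · rw [configInt, e1, e2, hz.quadInt_eq hε _ hr,
      intervalIntegral.integral_sub intervalIntegrable_const hi, hmass,
      intervalIntegral.integral_const, smul_eq_mul]
    ring
  · rw [configInt, e1, e2, hz.quadInt_eq hε _ hr,
      intervalIntegral.integral_sub hi intervalIntegrable_const, hmass,
      intervalIntegral.integral_const, smul_eq_mul]
    ring

end Pairs

/-! ### Well-posedness of the Maxwell solution and convergence of its pair -/

lemma IsCriticalTriple.eq {F : ℝ → ℝ} {a b σ α ζ β α' ζ' β' : ℝ} (hF : IsFreeEnergy F a b)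
    (h : IsCriticalTriple F a b σ α ζ β) (h' : IsCriticalTriple F a b σ α' ζ' β') :
    α = α' ∧ ζ = ζ' ∧ β = β' :=
  ⟨hF.mono_left.injOn (Ioo_subset_Ioc_self h.left_mem) (Ioo_subset_Ioc_self h'.left_mem)
      (h.deriv_left.trans h'.deriv_left.symm),
    hF.anti_mid.injOn (Ioo_subset_Icc_self h.mid_mem) (Ioo_subset_Icc_self h'.mid_mem)
      (h.deriv_mid.trans h'.deriv_mid.symm),
    hF.mono_right.injOn (Ioi_subset_Ici_self h.right_mem) (Ioi_subset_Ici_self h'.right_mem)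
      (h.deriv_right.trans h'.deriv_right.symm)⟩

/-- Existence and uniqueness of simple solutions near the Maxwell point. -/
theorem exists_nhds_existsUnique {F : ℝ → ℝ} {a b σ₀ α₀ β₀ δ : ℝ} (hF : IsFreeEnergy F a b)
    (hM : IsMaxwellPoint F a b σ₀ α₀ β₀) (hδ : δ ∈ Ioo 0 ((β₀ - α₀) / 2)) :
    ∃ N ∈ 𝓝 (σ₀, gibbs F σ₀ α₀), ∀ U ∈ 𝓝 (σ₀, gibbs F σ₀ α₀), ∃ ε₀ > 0, ∀ ε ∈ Ioo 0 ε₀,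
      ∀ r ∈ Icc (α₀ + δ) (β₀ - δ), (∃ Δ z, IsSimpleSolution F a b ε r Δ z ∧ Δ ∈ U) ∧
        ∀ {Δ Δ' : ℝ × ℝ} {z z' : ℝ → ℝ}, IsSimpleSolution F a b ε r Δ z → Δ ∈ N →
          IsSimpleSolution F a b ε r Δ' z' → Δ' ∈ N → Δ = Δ' ∧ EqOn z z' (dom ε) := by
  obtain ⟨ρ, Y, C, ΩL, EL, ΩR, ER, hP⟩ := exists_phaseCharts hF hM
  obtain ⟨d, X₁, hd, hdρ, -, hX₁⟩ := hP.exists_solvesQuadrature hF hM hδ.1 hδ.2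
  set ℓ := -Real.log Y with hℓ'
  have hℓ : Real.exp (-ℓ) ≤ Y := by rw [hℓ', neg_neg, Real.exp_log hP.left.Y_pos]
  obtain ⟨N, hN, hcfg⟩ := exists_nhds_isConfig hF hM hd (max X₁ (ℓ + 1))
  -- The uniqueness neighbourhood `N` is fixed before `U`: its admissible pairs have depths beyond
  -- `X₁`, where the quadrature system has one solution. Existence holds in every smaller `U`, at
  -- the price of a smaller `ε₀`.
  refine ⟨N, hN, fun U hU => ?_⟩
  obtain ⟨X, hX⟩ := exists_depth_of_mem_nhds hF hM hU
  obtain ⟨ε₀, hε₀, hq⟩ := hX₁ (max X (ℓ + 1))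
  refine ⟨ε₀, hε₀, fun ε hε r hr => ⟨?_, fun {Δ Δ' z z'} hz hΔ hz' hΔ' => ?_⟩⟩
  · obtain ⟨⟨σ, c, α, β, x₁, x₂, h, h1, h2, -, -, hlt, i1, i2, hs⟩, -⟩ := hq ε hε r hr
    obtain ⟨z, hz⟩ := hs.exists_isSimpleSolution hε.1 h hF (hM.lt hF) hP hdρ hℓ
      ((le_max_right _ _).trans h1) ((le_max_right _ _).trans h2) hlt i1 i2
    exact ⟨_, z, hz, hX h (h.left_mem hP hdρ) (h.right_mem hP hdρ) ((le_max_left _ _).trans h1)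
      ((le_max_left _ _).trans h2)⟩
  · have key : ∀ {Δ : ℝ × ℝ} {z : ℝ → ℝ}, IsSimpleSolution F a b ε r Δ z → Δ ∈ N →
        ∃ α ζ β x₁ x₂ v, IsCriticalTriple F a b Δ.1 α ζ β ∧ IsProfile F ε Δ.1 Δ.2 α ζ β z v ∧
          X₁ ≤ x₁ ∧ X₁ ≤ x₂ ∧ IsConfig F α₀ β₀ d Δ.1 Δ.2 α β x₁ x₂ ∧
          SolvesQuadrature F α₀ β₀ ΩL ΩR ε r Δ.1 Δ.2 α β x₁ x₂ := by
      intro Δ z hz hΔ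
      obtain ⟨-, α, ζ, β, hT, hmax, -⟩ := hz.admissible
      have hp := hz.isProfile hε.1 hF hT hmax
      obtain ⟨x₁, x₂, h1, h2, hc⟩ := hcfg hΔ hT.left_mem hT.right_mem hT.deriv_left hT.deriv_right
        ((le_max_left _ _).trans_lt hmax) ((le_max_right _ _).trans_lt hmax)
      exact ⟨α, ζ, β, x₁, x₂, _, hT, hp, (le_max_left _ _).trans h1, (le_max_left _ _).trans h2, hc,
        hp.solvesQuadrature hε.1 hz.solution.mass hT hc hF hP hdρ hℓ ((le_max_right _ _).trans h1)
          ((le_max_right _ _).trans h2)⟩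
    obtain ⟨α, ζ, β, x₁, x₂, v, hT, hp, h1, h2, hc, hs⟩ := key hz hΔ
    obtain ⟨α', ζ', β', x₁', x₂', v', hT', hp', h1', h2', hc', hs'⟩ := key hz' hΔ'
    obtain ⟨e1, e2⟩ := (hq ε hε r hr).2 hc hc' h1 h2 h1' h2' hs hs'
    have e : Δ = Δ' := Prod.ext e1 e2
    subst e
    obtain ⟨rfl, rfl, rfl⟩ := hT.eq hF hT'
    exact ⟨rfl, hp.eqOn hε.1 hF hT hp'⟩

theorem exists_isMaxwellFamily {F : ℝ → ℝ} {a b σ₀ α₀ β₀ δ : ℝ} (hF : IsFreeEnergy F a b)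
    (hM : IsMaxwellPoint F a b σ₀ α₀ β₀) (hδ : δ ∈ Ioo 0 ((β₀ - α₀) / 2)) :
    ∃ (ε₀ : ℝ) (N : Set (ℝ × ℝ)) (Δ : ℝ → ℝ → ℝ × ℝ) (z : ℝ → ℝ → ℝ → ℝ),
      IsMaxwellFamily F a b σ₀ α₀ β₀ δ ε₀ N Δ z := by
  obtain ⟨N, hN, h⟩ := exists_nhds_existsUnique hF hM hδ
  obtain ⟨ε₀, hε₀, h⟩ := h N hN
  choose! Δ z hz using fun ε (hε : ε ∈ Ioo 0 ε₀) r hr => (h ε hε r hr).1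
  exact ⟨ε₀, N, Δ, z, hε₀, hN, hz, fun ε hε r hr Δ' w hw hΔ' =>
    (h ε hε r hr).2 hw hΔ' (hz ε hε r hr).1 (hz ε hε r hr).2⟩

/-- The pairs of a Maxwell family converge to the Maxwell point. -/
lemma IsMaxwellFamily.tendsto_pair {F : ℝ → ℝ} {a b σ₀ α₀ β₀ δ ε₀ : ℝ} {N : Set (ℝ × ℝ)}
    {Δ : ℝ → ℝ → ℝ × ℝ} {z : ℝ → ℝ → ℝ → ℝ} (h : IsMaxwellFamily F a b σ₀ α₀ β₀ δ ε₀ N Δ z)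
    (hF : IsFreeEnergy F a b) (hM : IsMaxwellPoint F a b σ₀ α₀ β₀)
    (hδ : δ ∈ Ioo 0 ((β₀ - α₀) / 2)) {r : ℝ} (hr : r ∈ Icc (α₀ + δ) (β₀ - δ)) :
    Tendsto (fun ε => Δ ε r) (𝓝[>] 0) (𝓝 (σ₀, gibbs F σ₀ α₀)) := by
  obtain ⟨_, _, hE⟩ := exists_nhds_existsUnique hF hM hδ
  rw [tendsto_def]
  intro U hU
  -- The neighbourhood `N` of the given family is arbitrary. A solution with pair in `U ∩ N` exists
  -- and must be the member of the family, by the uniqueness inside `N`.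
  obtain ⟨ε₁, hε₁, hE⟩ := hE (U ∩ N) (inter_mem hU h.nhds)
  filter_upwards [Ioo_mem_nhdsGT (lt_min h.pos hε₁)] with ε hε
  obtain ⟨⟨Δ', w, hw, hΔ'⟩, -⟩ := hE ε ⟨hε.1, hε.2.trans_le (min_le_right _ _)⟩ r hr
  have := (h.unique ε ⟨hε.1, hε.2.trans_le (min_le_left _ _)⟩ r hr Δ' w hw hΔ'.2).1
  rw [mem_preimage, ← this]
  exact hΔ'.1

/-! ### Convergence to the single-interface function -/

lemma le_integral_of_two_step {f : ℝ → ℝ} {A T B p q : ℝ} (hAT : A ≤ T) (hTB : T ≤ B)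
    (hf : ContinuousOn f (Icc A B)) (hp : ∀ t ∈ Icc A T, p ≤ f t) (hq : ∀ t ∈ Icc T B, q ≤ f t) :
    p * (T - A) + q * (B - T) ≤ ∫ t in A..B, f t := by
  have i1 : IntervalIntegrable f MeasureTheory.volume A T :=
    (hf.mono (by rw [uIcc_of_le hAT]; exact Icc_subset_Icc_right hTB)).intervalIntegrable
  have i2 : IntervalIntegrable f MeasureTheory.volume T B :=
    (hf.mono (by rw [uIcc_of_le hTB]; exact Icc_subset_Icc_left hAT)).intervalIntegrable
  rw [← intervalIntegral.integral_add_adjacent_intervals i1 i2]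
  have h1 := intervalIntegral.integral_mono_on hAT intervalIntegrable_const i1 hp
  have h2 := intervalIntegral.integral_mono_on hTB intervalIntegrable_const i2 hq
  rw [intervalIntegral.integral_const, smul_eq_mul] at h1 h2
  linarith

lemma integral_le_of_two_step {f : ℝ → ℝ} {A T B p q : ℝ} (hAT : A ≤ T) (hTB : T ≤ B)
    (hf : ContinuousOn f (Icc A B)) (hp : ∀ t ∈ Icc A T, f t ≤ p) (hq : ∀ t ∈ Icc T B, f t ≤ q) :
    ∫ t in A..B, f t ≤ p * (T - A) + q * (B - T) := by
  have := le_integral_of_two_step hAT hTB hf.neg (fun t ht => neg_le_neg (hp t ht))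
    (fun t ht => neg_le_neg (hq t ht))
  rw [Pi.neg_def, intervalIntegral.integral_neg] at this
  linarith

section Limit

variable {F : ℝ → ℝ} {a b σ₀ α₀ β₀ : ℝ}

/-- Between the two phases, the Gibbs function of the Maxwell point lies above its minimum. -/
lemma IsMaxwellPoint.gibbs_lt (hM : IsMaxwellPoint F a b σ₀ α₀ β₀) (hF : IsFreeEnergy F a b) {w : ℝ}
    (hw : w ∈ Ioo α₀ β₀) : gibbs F σ₀ α₀ < gibbs F σ₀ w := by
  obtain ⟨ζ, hζ, hζσ⟩ := hF.exists_mid (hM.mem_Ioo hF)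
  have hα := hM.left_mem
  have hβ := mem_Ioi.1 hM.right_mem
  rcases le_total w ζ with h | h
  · exact hF.gibbs_mono_left (Ioo_subset_Ioc_self hα) hM.deriv_left (Ioo_subset_Icc_self hζ) hζσ
      ⟨le_rfl, by linarith [hζ.1, hα.2]⟩ ⟨hw.1.le, h⟩ hw.1
  · rw [← hM.gibbs_eq]
    exact hF.gibbs_anti_right (Ioo_subset_Icc_self hζ) hζσ (Ioi_subset_Ici_self hM.right_mem)
      hM.deriv_right ⟨h, hw.2.le⟩ ⟨by linarith [hζ.2], le_rfl⟩ hw.2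

/-- For pairs close to the Maxwell point, the Gibbs function is well above the level of the pair
away from the phases. -/
lemma IsMaxwellPoint.exists_height (hM : IsMaxwellPoint F a b σ₀ α₀ β₀) (hF : IsFreeEnergy F a b)
    {ρ : ℝ} (hρ : 0 < ρ) : ∃ m > 0, ∀ᶠ Δ : ℝ × ℝ in 𝓝 (σ₀, gibbs F σ₀ α₀),
      ∀ w ∈ Icc (α₀ + ρ) (β₀ - ρ), m ^ 2 / 2 ≤ gibbs F Δ.1 w - Δ.2 := by
  have hα := hM.left_mem.1
  have hβ := hF.pos_b.trans hM.right_mem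
  obtain ⟨m, hm, h⟩ : ∃ m > 0, ∀ w ∈ Icc (α₀ + ρ) (β₀ - ρ), m ≤ gibbs F σ₀ w - gibbs F σ₀ α₀ := by
    have hc : ContinuousOn (fun w => gibbs F σ₀ w - gibbs F σ₀ α₀) (Icc (α₀ + ρ) (β₀ - ρ)) :=
      ((hF.continuousOn_gibbs σ₀).mono fun w hw => mem_Ioi.2 (by linarith [hw.1])).sub
        continuousOn_const
    obtain ⟨m, hm, h⟩ := isCompact_Icc.exists_forall_le' hc (a := 0)
      fun w hw => sub_pos.2 (hM.gibbs_lt hF ⟨by linarith [hw.1], by linarith [hw.2]⟩)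
    exact ⟨m, hm, h⟩
  refine ⟨Real.sqrt m, Real.sqrt_pos.2 hm, ?_⟩
  have hlim : ∀ᶠ Δ : ℝ × ℝ in 𝓝 (σ₀, gibbs F σ₀ α₀),
      |Δ.1 - σ₀| * β₀ + |Δ.2 - gibbs F σ₀ α₀| < m / 2 := by
    have hc : Continuous fun Δ : ℝ × ℝ => |Δ.1 - σ₀| * β₀ + |Δ.2 - gibbs F σ₀ α₀| := by fun_prop
    refine hc.continuousAt.eventually (Iio_mem_nhds ?_)
    simp only [sub_self, abs_zero, zero_mul, add_zero]
    linarith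
  filter_upwards [hlim] with Δ hΔ w hw
  rw [Real.sq_sqrt hm.le]
  have h1 := h w hw
  have h2 : (Δ.1 - σ₀) * w ≤ |Δ.1 - σ₀| * β₀ :=
    mul_le_mul (le_abs_self _) (by linarith [hw.2]) (by linarith [hw.1]) (abs_nonneg _)
  have h3 := le_abs_self (Δ.2 - gibbs F σ₀ α₀)
  unfold gibbs at *
  linarith

/-- The first integral and `P ε v ≤ v^2 / 2` give speed at least `m` in the strip from `A` to `B`,
so the mean value theorem bounds the crossing time independently of `ε`. -/
lemma IsProfile.mul_sub_le {ε σ c α ζ β : ℝ} {z v : ℝ → ℝ} (hε : 0 < ε)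
    (h : IsProfile F ε σ c α ζ β z v) {m A B : ℝ}
    (hAB : ∀ w ∈ Icc A B, m ^ 2 / 2 ≤ gibbs F σ w - c) {s t : ℝ} (hs : s ∈ dom ε) (ht : t ∈ dom ε)
    (hst : s < t) (hA : A ≤ z s) (hB : z t ≤ B) : m * (t - s) ≤ B - A := by
  have hsub : Icc s t ⊆ dom ε := Icc_subset_Icc hs.1 ht.2
  have hsub' : Ioo s t ⊆ Ioo (-ε⁻¹) ε⁻¹ := Ioo_subset_Ioo hs.1 ht.2
  obtain ⟨τ, hτ, e⟩ := exists_hasDerivAt_eq_slope z v hst (h.cont.mono hsub)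
    fun x hx => h.deriv x (hsub' hx)
  have hτd := hsub (Ioo_subset_Icc_self hτ)
  have h1 := h.mono hs hτd hτ.1
  have h2 := h.mono hτd ht hτ.2
  have h3 := hAB (z τ) ⟨by linarith, by linarith⟩
  rw [← h.speed τ (hsub' hτ)] at h3
  have h4 : m ≤ v τ := by
    refine le_of_sq_le_sq ?_ (h.v_pos τ (hsub' hτ)).le
    linarith [P_le (s := v τ) hε]
  rw [e, le_div_iff₀ (sub_pos.2 hst)] at h4
  linarith

/-- Simple solutions whose pairs converge to the Maxwell point converge, after rescaling, to the
single-interface function. -/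
theorem tendsto_of_tendsto_pair {r : ℝ} {Δ : ℝ → ℝ × ℝ} {z : ℝ → ℝ → ℝ} (hF : IsFreeEnergy F a b)
    (hM : IsMaxwellPoint F a b σ₀ α₀ β₀) (hr : r ∈ Ioo α₀ β₀)
    (hz : ∀ᶠ ε in 𝓝[>] 0, IsSimpleSolution F a b ε r (Δ ε) (z ε))
    (hΔ : Tendsto Δ (𝓝[>] 0) (𝓝 (σ₀, gibbs F σ₀ α₀))) {x : ℝ} (hx : x ∈ Icc (-1) 1)
    (hxℓ : x ≠ -1 + ell₁ α₀ β₀ r) :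
    Tendsto (fun ε => z ε (x / ε)) (𝓝[>] 0) (𝓝 (u₀ α₀ β₀ r x)) := by
  have hD : 0 < β₀ - α₀ := sub_pos.2 (hM.lt hF)
  set x₀ := -1 + ell₁ α₀ β₀ r with hx₀
  -- The jump point `x₀` is exactly where a function with values `α₀` and then `β₀` has mass `2r`.
  have hmass : 2 * r = α₀ * (x₀ + 1) + β₀ * (1 - x₀) := by
    rw [hx₀, ell₁]; field_simp; ring
  have hx₀1 : x₀ < 1 := by
    rw [hx₀, ell₁, ← sub_pos]
    have : 1 - (-1 + 2 * (β₀ - r) / (β₀ - α₀)) = 2 * (r - α₀) / (β₀ - α₀) := by field_simp; ring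
    rw [this]
    exact div_pos (by linarith [hr.1]) hD
  have hx₀2 : -1 < x₀ := by
    rw [hx₀, ell₁, lt_neg_add_iff_add_lt, ← sub_eq_add_neg, sub_self]
    exact div_pos (by linarith [hr.2]) hD
  rw [Metric.tendsto_nhds]
  intro e he
  obtain ⟨ρ, hρ, hρe, hρx⟩ : ∃ ρ > 0, ρ < e ∧ 4 * ρ < |x - x₀| * (β₀ - α₀) := by
    have h1 : 0 < |x - x₀| * (β₀ - α₀) := mul_pos (abs_pos.2 (sub_ne_zero.2 hxℓ)) hD
    refine ⟨min e (|x - x₀| * (β₀ - α₀) / 4) / 2, by positivity, ?_, ?_⟩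
    · linarith [min_le_left e (|x - x₀| * (β₀ - α₀) / 4)]
    · linarith [min_le_right e (|x - x₀| * (β₀ - α₀) / 4)]
  obtain ⟨m, hm, hheight⟩ := hM.exists_height hF hρ
  obtain ⟨κ, hκ, hnear⟩ := exists_near hF hM hρ
  have hσ : ∀ᶠ Δ : ℝ × ℝ in 𝓝 (σ₀, gibbs F σ₀ α₀), |Δ.1 - σ₀| < κ := by
    have hc : Continuous fun Δ : ℝ × ℝ => |Δ.1 - σ₀| := by fun_prop
    exact hc.continuousAt.eventually (Iio_mem_nhds (by simpa using hκ))
  -- More than the time needed to cross from `α₀ + ρ` to `β₀ - ρ` at speed `m`; it does not depend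
  -- on `ε`.
  set T := (β₀ - α₀) / m + 1 with hT
  have hT0 : 0 < T := by positivity
  have hmT : β₀ - α₀ < m * T := by
    rw [hT, mul_add, mul_one, mul_div_cancel₀ _ hm.ne']
    linarith
  have hsmall : ∀ᶠ ε in 𝓝[>] (0 : ℝ), ε * T < |x - x₀| ∧
      ε * T * (β₀ - α₀) < |x - x₀| * (β₀ - α₀) - 4 * ρ := by
    have h1 : ∀ᶠ ε in 𝓝 (0 : ℝ), ε * T < |x - x₀| := by
      have hc : Continuous fun ε : ℝ => ε * T := by fun_prop
      exact hc.continuousAt.eventually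
        (Iio_mem_nhds (by simpa using abs_pos.2 (sub_ne_zero.2 hxℓ)))
    have h2 : ∀ᶠ ε in 𝓝 (0 : ℝ), ε * T * (β₀ - α₀) < |x - x₀| * (β₀ - α₀) - 4 * ρ := by
      have hc : Continuous fun ε : ℝ => ε * T * (β₀ - α₀) := by fun_prop
      exact hc.continuousAt.eventually (Iio_mem_nhds (by simpa using hρx))
    exact (h1.and h2).filter_mono nhdsWithin_le_nhds
  filter_upwards [hz, hΔ.eventually hheight, hΔ.eventually hσ, hsmall, self_mem_nhdsWithin] with
    ε hs hh hσε ⟨hε1, hε2⟩ hε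
  rw [mem_Ioi] at hε
  obtain ⟨-, α, ζ, β, htr, hmax, -⟩ := hs.admissible
  have hp := hs.isProfile hε hF htr hmax
  obtain ⟨n1, n2⟩ := hnear _ hσε
  have n1 := abs_le.1 (n1 α htr.left_mem htr.deriv_left)
  have n2 := abs_le.1 (n2 β htr.right_mem htr.deriv_right)
  have hlt := neg_inv_lt_inv hε
  have hinv : 0 < ε⁻¹ := inv_pos.2 hε
  have hlow : ∀ t ∈ dom ε, α₀ - ρ ≤ z ε t := fun t ht => by
    have := hp.mono.monotoneOn (left_mem_Icc.2 hlt.le) ht ht.1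
    linarith [hp.left_mem.1, n1.1]
  have hupp : ∀ t ∈ dom ε, z ε t ≤ β₀ + ρ := fun t ht => by
    have := hp.mono.monotoneOn ht (right_mem_Icc.2 hlt.le) ht.2
    linarith [hp.right_mem.2, n2.2]
  have hdom : ∀ {y : ℝ}, -1 ≤ y → y ≤ 1 → y * ε⁻¹ ∈ dom ε := fun h1 h2 =>
    ⟨by nlinarith, by nlinarith⟩
  have hstrip : ∀ {s t : ℝ}, s ∈ dom ε → t ∈ dom ε → s + T ≤ t → z ε t ≤ β₀ - ρ → α₀ + ρ ≤ z ε s →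
      False := by
    intro s t hs ht hst h1 h2
    have h3 := hp.mul_sub_le hε hh hs ht (by linarith) h2 h1
    have h4 : m * T ≤ m * (t - s) := by gcongr; linarith
    linarith
  have hxd := hdom hx.1 hx.2
  have hTε : T = (ε * T) * ε⁻¹ := by field_simp
  have hεT : 0 < ε * T := mul_pos hε hT0
  rw [div_eq_mul_inv, Real.dist_eq]
  refine lt_of_le_of_lt ?_ hρe
  rw [u₀, ← hx₀]
  rcases lt_or_gt_of_ne hxℓ with hlt' | hgt
  · rw [if_pos hlt'.le, abs_le]
    refine ⟨by linarith [hlow _ hxd], ?_⟩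
    -- If the solution has already left the left phase at `x < x₀`, then it is above `β₀ - ρ` from
    -- `x + ε * T` on. Its mass then exceeds `2r`, because `(x₀ - x) * (β₀ - α₀)` dominates the
    -- losses from `ε * T` and `ρ`. The case `x > x₀` is symmetric, with too little mass.
    by_contra hcon
    have hcon : α₀ + ρ ≤ z ε (x * ε⁻¹) := by linarith
    rw [abs_of_neg (sub_neg.2 hlt')] at hε1 hε2
    have hy : x + ε * T ≤ 1 := by linarith
    have hyd := hdom (show -1 ≤ x + ε * T by linarith [hx.1]) hy
    have key := le_integral_of_two_step (p := α₀ - ρ) (q := β₀ - ρ) hyd.1 hyd.2 hp.cont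
      (fun t ht => hlow t ⟨ht.1, ht.2.trans hyd.2⟩) (fun t ht => by
        by_contra hc
        push Not at hc
        refine hstrip hxd ⟨hyd.1.trans ht.1, ht.2⟩ (le_trans (le_of_eq ?_) ht.1) hc.le hcon
        rw [add_mul, ← hTε])
    rw [hs.solution.mass] at key
    have e1 : (α₀ - ρ) * ((x + ε * T) * ε⁻¹ - -ε⁻¹) + (β₀ - ρ) * (ε⁻¹ - (x + ε * T) * ε⁻¹) =
        ((α₀ - ρ) * (x + ε * T + 1) + (β₀ - ρ) * (1 - (x + ε * T))) * ε⁻¹ := by ring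
    rw [e1] at key
    have := le_of_mul_le_mul_right key hinv
    linarith
  · rw [if_neg (not_le.2 hgt), abs_le]
    refine ⟨?_, by linarith [hupp _ hxd]⟩
    by_contra hcon
    have hcon : z ε (x * ε⁻¹) ≤ β₀ - ρ := by linarith
    rw [abs_of_pos (sub_pos.2 hgt)] at hε1 hε2
    have hy : -1 ≤ x - ε * T := by linarith
    have hyd := hdom hy (show x - ε * T ≤ 1 by linarith [hx.2])
    have key := integral_le_of_two_step (p := α₀ + ρ) (q := β₀ + ρ) hyd.1 hyd.2 hp.cont
      (fun t ht => by
        by_contra hc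
        push Not at hc
        refine hstrip ⟨ht.1, ht.2.trans hyd.2⟩ hxd ?_ hcon hc.le
        have := ht.2
        rw [sub_mul, ← hTε] at this
        linarith) (fun t ht => hupp t ⟨hyd.1.trans ht.1, ht.2⟩)
    rw [hs.solution.mass] at key
    have e1 : (α₀ + ρ) * ((x - ε * T) * ε⁻¹ - -ε⁻¹) + (β₀ + ρ) * (ε⁻¹ - (x - ε * T) * ε⁻¹) =
        ((α₀ + ρ) * (x - ε * T + 1) + (β₀ + ρ) * (1 - (x - ε * T))) * ε⁻¹ := by ring
    rw [e1] at key
    have := le_of_mul_le_mul_right key hinv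
    linarith

lemma IsMaxwellFamily.tendsto_rescaled {δ ε₀ r x : ℝ} {N : Set (ℝ × ℝ)} {Δ : ℝ → ℝ → ℝ × ℝ}
    {z : ℝ → ℝ → ℝ → ℝ} (h : IsMaxwellFamily F a b σ₀ α₀ β₀ δ ε₀ N Δ z) (hF : IsFreeEnergy F a b)
    (hM : IsMaxwellPoint F a b σ₀ α₀ β₀) (hδ : δ ∈ Ioo 0 ((β₀ - α₀) / 2))
    (hr : r ∈ Icc (α₀ + δ) (β₀ - δ)) (hx : x ∈ Icc (-1) 1) (hxℓ : x ≠ -1 + ell₁ α₀ β₀ r) :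
    Tendsto (fun ε => rescaled z ε r x) (𝓝[>] 0) (𝓝 (u₀ α₀ β₀ r x)) :=
  tendsto_of_tendsto_pair hF hM ⟨by linarith [hr.1, hδ.1], by linarith [hr.2, hδ.1]⟩
    (by filter_upwards [Ioo_mem_nhdsGT h.pos] with ε hε using (h.simple ε hε r hr).1)
    (h.tendsto_pair hF hM hδ hr) hx hxℓ

end Limit

lemma ell₁_add_ell₂ {α₀ β₀ r : ℝ} (h : α₀ < β₀) : ell₁ α₀ β₀ r + ell₂ α₀ β₀ r = 2 := by
  have : β₀ - α₀ ≠ 0 := (sub_pos.2 h).ne'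
  unfold ell₁ ell₂
  field_simp
  ring

end MaxwellSolution

theorem theorem5p1 (F : ℝ → ℝ) (a b : ℝ) (hF : MaxwellSolution.IsFreeEnergy F a b) :
    (∃! p : ℝ × ℝ × ℝ, MaxwellSolution.IsMaxwellPoint F a b p.1 p.2.1 p.2.2) ∧
    ∀ σ₀ α₀ β₀ : ℝ, MaxwellSolution.IsMaxwellPoint F a b σ₀ α₀ β₀ →
      -- the Maxwell solution is well defined
      (∀ δ ∈ Set.Ioo 0 ((β₀ - α₀) / 2),
        ∃ (ε₀ : ℝ) (N : Set (ℝ × ℝ)) (Δ : ℝ → ℝ → ℝ × ℝ) (z : ℝ → ℝ → ℝ → ℝ),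
          MaxwellSolution.IsMaxwellFamily F a b σ₀ α₀ β₀ δ ε₀ N Δ z) ∧
      -- convergence to the single-interface solutions
      (∀ r ∈ Set.Ioo α₀ β₀, ∀ δ ∈ Set.Ioo 0 ((β₀ - α₀) / 2), r ∈ Set.Icc (α₀ + δ) (β₀ - δ) →
        ∀ (ε₀ : ℝ) (N : Set (ℝ × ℝ)) (Δ : ℝ → ℝ → ℝ × ℝ) (z : ℝ → ℝ → ℝ → ℝ),
          MaxwellSolution.IsMaxwellFamily F a b σ₀ α₀ β₀ δ ε₀ N Δ z →
          ∀ x ∈ Set.Icc (-1 : ℝ) 1,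
            (x ≠ -1 + MaxwellSolution.ell₁ α₀ β₀ r →
              Filter.Tendsto (fun ε => MaxwellSolution.rescaled z ε r x) (nhdsWithin 0 (Set.Ioi 0))
                (nhds (MaxwellSolution.u₀ α₀ β₀ r x))) ∧
            (x ≠ -1 + MaxwellSolution.ell₂ α₀ β₀ r →
              Filter.Tendsto (fun ε => MaxwellSolution.reversal z ε r x) (nhdsWithin 0 (Set.Ioi 0))
                (nhds (MaxwellSolution.u₀ α₀ β₀ r (-x))))) := by
  refine ⟨MaxwellSolution.existsUnique_isMaxwellPoint hF, fun σ₀ α₀ β₀ hM =>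
    ⟨fun δ hδ => MaxwellSolution.exists_isMaxwellFamily hF hM hδ, ?_⟩⟩
  intro r _ δ hδ hr ε₀ N Δ z h x hx
  refine ⟨h.tendsto_rescaled hF hM hδ hr hx, fun hxℓ => ?_⟩
  -- The reversed statement is the first one at `-x`. The two excluded points are negatives of each
  -- other, since the two lengths add up to `2`.
  refine h.tendsto_rescaled hF hM hδ hr ⟨neg_le_neg hx.2, neg_le.1 hx.1⟩ fun he => hxℓ ?_
  have := MaxwellSolution.ell₁_add_ell₂ (r := r) (hM.lt hF)
  linarith
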